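/- Let $G$ and $H$ be locally compact, $\sigma$-compact Hausdorff abelian groups with Haar measures $m_G,m_H$. Let $(G,H,\widetilde L)$ be a cut and project scheme: $\widetilde L$ is a discrete cocompact subgroup of $G\times H$, the projection $G\times H\to G$ is injective on $\widetilde L$, and the projection of $\widetilde L$ to $H$ is dense; elements of $\widetilde L$ are written $(l,l^\star)$. Put $\mathbb T=(G\times H)/\widetilde L$, and let $Z\subset G\times H$ be a measurable set of representatives for $\mathbb T$. Let $\rho\neq 0$ be an $\widetilde L$-invariant complex Radon measure on $G\times H$, and let $\rho_{\mathbb T}$ be the (unique) complex Radon measure on $\mathbb T$ with $$\int_{G\times H} g\,d\rho=\int_{\mathbb T}\sum_{(l,l^\star)\in\widetilde L}g(s+l,h+l^\star)\,d\rho_{\mathbb T}([s,h])\qquad (g\in C_c(G\times H)).$$ Let $f:H\to\mathbb C$ be continuous and admissible, i.e. for all $\varepsilon>0$ and $\varphi\in C_c(G)$ there is a compact $Q\subset H$ with $\int_{G\times H}|\varphi(t+s)f(h+k)|\,(1-1_Q(h+k))\,d|\rho|(t,h)\le\varepsilon$ for all $(s,k)\in G\times H$. Let $\nu_f$ be the measure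 $\nu_f(\varphi)=\int\varphi(t)f(h)\,d\rho(t,h)$, $\varphi \in C_c(G)$, on $G$. For a complex Radon measure $\omega$ on $G$ put $(\alpha_t\omega)(\varphi)=\omega(\varphi(\cdot+t))$ and $\widetilde\omega(\varphi)=\overline{\omega(\overline{\varphi(-\cdot)})}$, and let $\Omega(\nu_f)$ be the closure of $\{\alpha_t\nu_f:t\in G\}$ in the vague topology. Put $\widetilde f(h)=\overline{f(-h)}$. Then $f$ is integrable with respect to $m_H$, so that $(f*\widetilde f)(h)$ exists for almost every $h\in H$. For $\varphi\in C_c(G)$ and $\xi=[s,h]\in\mathbb T$ put $$\gamma_\xi(\varphi)=\frac1{(m_G\times m_H)(Z)}\sum_{(l,l^\star)\in\widetilde L}(f*\widetilde f)(h-l^\star)\,\varphi(s-l)$$ whenever this exists (it does not depend on the representative $(s,h)$ of $\xi$). For every $\varphi\in C_c(G)$, $\gamma_{\xi-\eta}(\varphi)$ exists for $|\rho_{\mathbb T}|\times|\rho_{\mathbb T}|$-almost every $(\xi,\eta)$ and is integrable in $(\xi,\eta)$ with respect to $|\rho_{\mathbb T}|\times|\rho_{\mathbb T}|$. There is exactly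 one $\alpha$-invariant regular Borel probability measure $m$ on $\Omega(\nu_f)$, and the autocorrelation of $\nu_f$, defined by $$\gamma(\varphi)=\int_{\Omega(\nu_f)}\int_G\int_G\varphi(s+t)\psi(t)\,d\omega(s)\,d\widetilde\omega(t)\,dm(\omega)$$ for any $\psi\in C_c(G)$ with $\int\psi\,dm_G=1$, satisfies, independently of $\psi$, $$\gamma(\varphi)=\int_{\mathbb T}\int_{\mathbb T}\gamma_{\xi-\eta}(\varphi)\,d\rho_{\mathbb T}(\xi)\,d\overline{\rho_{\mathbb T}}(\eta)\qquad(\varphi\in C_c(G)).$$ If $\rho=\delta_{\widetilde L}=\sum_{x\in\widetilde L}\delta_x$, then $f$ is square integrable, $(f*\widetilde f)(h)$ exists for every $h\in H$, $\gamma_0(\varphi)$ exists for every $\varphi\in C_c(G)$, and $$\gamma=\gamma_0=\frac1{(m_G\times m_H)(Z)}\sum_{(l,l^\star)\in\widetilde L}(f*\widetilde f)(-l^\star)\,\delta_{-l}.$$ -/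

import Mathlib

open MeasureTheory Filter Topology
open scoped CompactlySupported ENNReal

noncomputable section

namespace CutProject

/-! ### Complex Radon measures -/

section RadonMeasures

variable {X : Type*} [TopologicalSpace X]

/-- A (possibly unbounded) complex Radon measure `ρ` on `X`, given by its polar decomposition
`dρ = phase · d|ρ|`: the total variation `|ρ|` is a regular Borel measure (in particular finite on
compact sets) and the phase is a unimodular Borel function. The `σ`-algebra is always the Borel
`σ`-algebra of the topology of `X`; for a product `X = G × H` it is the Borel `σ`-algebra of the
product topology. -/
structure ComplexRadonMeasure (X : Type*) [TopologicalSpace X] where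
  /-- The total variation measure `|ρ|`. -/
  variation : @Measure X (borel X)
  regular : @Measure.Regular X (borel X) _ variation
  /-- The density of `ρ` with respect to `|ρ|`. -/
  phase : X → ℂ
  measurable_phase : @Measurable X ℂ (borel X) _ phase
  norm_phase : ∀ x, ‖phase x‖ = 1

/-- The integral `∫ g dρ`. -/
def ComplexRadonMeasure.integral (ρ : ComplexRadonMeasure X) (g : X → ℂ) : ℂ :=
  ∫ x, g x * ρ.phase x ∂ρ.variation

/-- The integral `∫ g dρ̄` against the complex conjugate measure,
`ρ̄ (g) = conj (ρ (conj g))`. -/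
def ComplexRadonMeasure.conjIntegral (ρ : ComplexRadonMeasure X) (g : X → ℂ) : ℂ :=
  (starRingEnd ℂ) (ρ.integral fun x => (starRingEnd ℂ) (g x))

/-- The positive measure `|ρ| × |ρ|`, the total variation of `ρ × ρ̄`. -/
def ComplexRadonMeasure.prodVariation (ρ : ComplexRadonMeasure X) :
    @Measure (X × X) (@Prod.instMeasurableSpace X X (borel X) (borel X)) :=
  @Measure.prod X X (borel X) (borel X) ρ.variation ρ.variation

/-- The space `M(X)` of complex regular Borel measures, as the space of linear functionals on
`C_c(X)` that are bounded with respect to the supremum norm on the functions supported in any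
given compact set. -/
structure RadonFunctional (X : Type*) [TopologicalSpace X] where
  toLin : C_c(X, ℂ) →ₗ[ℂ] ℂ
  bounded : ∀ K : Set X, IsCompact K → ∃ C : ℝ, ∀ φ : C_c(X, ℂ), tsupport φ ⊆ K →
    ∀ B : ℝ, (∀ x, ‖φ x‖ ≤ B) → ‖toLin φ‖ ≤ C * B

instance : CoeFun (RadonFunctional X) fun _ => C_c(X, ℂ) → ℂ := ⟨fun ν => ν.toLin⟩

/-- The vague topology: the weakest one for which all `ν ↦ ν φ` are continuous. -/
instance : TopologicalSpace (RadonFunctional X) :=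
  TopologicalSpace.induced (fun ν φ => ν φ) inferInstance

theorem RadonFunctional.continuous_eval (φ : C_c(X, ℂ)) :
    Continuous fun ν : RadonFunctional X => ν φ :=
  (continuous_apply φ).comp continuous_induced_dom

end RadonMeasures

/-! ### Translation, reflection, hull and autocorrelation -/

section Dynamics

variable {G : Type*} [AddCommGroup G] [TopologicalSpace G] [IsTopologicalAddGroup G]

/-- `φ(· + t)`, that is `δ_{-t} ∗ φ`. -/
def shift (t : G) (φ : C_c(G, ℂ)) : C_c(G, ℂ) where
  toFun x := φ (x + t)
  continuous_toFun := by fun_prop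
  hasCompactSupport' := φ.hasCompactSupport.comp_homeomorph (Homeomorph.addRight t)

@[simp]
theorem shift_apply (t : G) (φ : C_c(G, ℂ)) (x : G) : shift t φ x = φ (x + t) := rfl

/-- The function `x ↦ conj (φ(-x))`. -/
def reflectConj (φ : C_c(G, ℂ)) : C_c(G, ℂ) where
  toFun x := (starRingEnd ℂ) (φ (-x))
  continuous_toFun := by
    have := φ.continuous_toFun
    exact Complex.continuous_conj.comp (this.comp continuous_neg)
  hasCompactSupport' :=
    (φ.hasCompactSupport.comp_homeomorph (Homeomorph.neg G)).comp_left (map_zero _)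

@[simp]
theorem reflectConj_apply (φ : C_c(G, ℂ)) (x : G) :
    reflectConj φ x = (starRingEnd ℂ) (φ (-x)) := rfl

/-- The translation action `(α_t ν)(φ) = ν (δ_{-t} ∗ φ)`. -/
def translate (t : G) (ν : RadonFunctional G) : RadonFunctional G where
  toLin :=
    { toFun := fun φ => ν (shift t φ)
      map_add' := fun φ ψ => by
        rw [← map_add]; congr 1
      map_smul' := fun c φ => by
        rw [RingHom.id_apply, ← map_smul]; congr 1 }
  bounded := by
    intro K hK
    obtain ⟨C, hC⟩ := ν.bounded ((fun x => x + -t) '' K) (hK.image (by fun_prop))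
    refine ⟨C, fun φ hφ B hB => hC _ ?_ B fun x => hB _⟩
    intro x hx
    refine ⟨x + t, hφ ?_, by simp⟩
    have := tsupport_comp_eq_preimage φ (Homeomorph.addRight t)
    have hx' : x ∈ tsupport (φ ∘ (Homeomorph.addRight t)) := hx
    rw [this] at hx'
    exact hx'

@[simp]
theorem translate_apply (t : G) (ν : RadonFunctional G) (φ : C_c(G, ℂ)) :
    translate t ν φ = ν (shift t φ) := rfl

/-- The measure `ν̃`, given by `ν̃(φ) = conj (ν (conj φ(-·)))`. -/
def tildeMeasure (ν : RadonFunctional G) : RadonFunctional G where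
  toLin :=
    { toFun := fun φ => (starRingEnd ℂ) (ν (reflectConj φ))
      map_add' := fun φ ψ => by
        rw [← map_add, ← map_add]; congr 2; ext x; simp
      map_smul' := fun c φ => by
        have : reflectConj (c • φ) = (starRingEnd ℂ) c • reflectConj φ := by
          ext x; simp
        rw [this, map_smul]; simp }
  bounded := by
    intro K hK
    obtain ⟨C, hC⟩ := ν.bounded ((fun x => -x) '' K) (hK.image continuous_neg)
    refine ⟨C, fun φ hφ B hB => ?_⟩
    change ‖(starRingEnd ℂ) (ν (reflectConj φ))‖ ≤ _
    rw [RCLike.norm_conj]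
    refine hC _ ?_ B fun x => by simpa using hB (-x)
    intro x hx
    refine ⟨-x, hφ ?_, by simp⟩
    have h1 : tsupport (reflectConj φ) ⊆ tsupport (φ ∘ (Homeomorph.neg G)) := by
      refine closure_mono fun y hy => ?_
      intro h0
      apply hy
      have h0' : φ (-y) = 0 := h0
      simp [h0']
    have h2 := h1 hx
    rw [tsupport_comp_eq_preimage φ (Homeomorph.neg G)] at h2
    exact h2

theorem continuous_translate (t : G) :
    Continuous (translate t : RadonFunctional G → RadonFunctional G) :=
  continuous_induced_rng.2 <| continuous_pi fun φ =>
    RadonFunctional.continuous_eval (shift t φ)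

/-- The hull `Ω(ν)`: the vague closure of the orbit of `ν` under translations. -/
def hull (ν : RadonFunctional G) : Set (RadonFunctional G) :=
  closure (Set.range fun t => translate t ν)

theorem translate_mem_hull (t : G) {ν ω : RadonFunctional G} (hω : ω ∈ hull ν) :
    translate t ω ∈ hull ν := by
  refine map_mem_closure (continuous_translate t) hω ?_
  rintro _ ⟨s, rfl⟩
  refine ⟨t + s, ?_⟩
  change translate (t + s) ν = translate t (translate s ν)
  have : (translate (t + s) ν).toLin = (translate t (translate s ν)).toLin := by
    ext φ
    change ν (shift (t + s) φ) = ν (shift s (shift t φ))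
    congr 1
    ext x
    simp only [shift_apply]
    congr 1
    abel
  cases h1 : translate (t + s) ν
  cases h2 : translate t (translate s ν)
  simp_all

/-- The action of `G` on the hull. -/
def hullAction (ν : RadonFunctional G) (t : G) (ω : hull ν) : hull ν :=
  ⟨translate t ω, translate_mem_hull t ω.2⟩

/-- `m` is a translation invariant (regular Borel) probability measure on the hull of `ν`. -/
structure IsInvariantProbability (ν : RadonFunctional G)
    (m : @Measure (hull ν) (borel (hull ν))) : Prop where
  isProbabilityMeasure : @IsProbabilityMeasure (hull ν) (borel (hull ν)) m
  regular : @Measure.Regular (hull ν) (borel (hull ν)) _ m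
  invariant : ∀ t, @Measure.map _ _ (borel (hull ν)) (borel (hull ν)) (hullAction ν t) m = m

theorem continuous_apply_shift [LocallyCompactSpace G] [T2Space G] (ω : RadonFunctional G)
    (φ : C_c(G, ℂ)) : Continuous fun t => ω (shift t φ) := by
  rw [continuous_iff_continuousAt]
  intro t₀
  obtain ⟨K₀, hK₀, ht₀⟩ := exists_compact_mem_nhds t₀
  have hS : IsCompact (tsupport φ) := φ.hasCompactSupport
  set K : Set G := (fun p : G × G => p.1 - p.2) '' (tsupport φ ×ˢ K₀) with hKdef
  have hK : IsCompact K := (hS.prod hK₀).image (by fun_prop)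
  have hzero : ∀ t ∈ K₀, ∀ x, x ∉ K → φ (x + t) = 0 := by
    intro t ht x hx
    by_contra h
    exact hx ⟨(x + t, t), ⟨subset_tsupport _ h, ht⟩, by simp⟩
  obtain ⟨C, hC⟩ := ω.bounded K hK
  rw [Metric.continuousAt_iff']
  intro ε hε
  have hpos : 0 < ε / (2 * (|C| + 1)) := by positivity
  have hev : ∀ᶠ t in 𝓝 t₀, ∀ x ∈ K, ‖φ (x + t) - φ (x + t₀)‖ < ε / (2 * (|C| + 1)) := by
    refine hK.eventually_forall_of_forall_eventually fun x _ => ?_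
    have hcont : Continuous fun z : G × G => ‖φ (z.2 + z.1) - φ (z.2 + t₀)‖ := by fun_prop
    have := hcont.tendsto (t₀, x)
    simp only [sub_self, norm_zero] at this
    exact this.eventually (gt_mem_nhds hpos)
  filter_upwards [hev, ht₀] with t ht htK
  have hle : ‖ω (shift t φ - shift t₀ φ)‖ ≤ C * (ε / (2 * (|C| + 1))) := by
    refine hC _ ?_ _ fun x => ?_
    · refine closure_minimal (fun x hx => ?_) hK.isClosed
      by_contra hxK
      apply hx
      simp [hzero t htK x hxK, hzero t₀ (mem_of_mem_nhds ht₀) x hxK]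
    · by_cases hxK : x ∈ K
      · simpa using (ht x hxK).le
      · simpa [hzero t htK x hxK, hzero t₀ (mem_of_mem_nhds ht₀) x hxK] using hpos.le
  rw [map_sub] at hle
  rw [dist_eq_norm]
  refine hle.trans_lt ?_
  calc C * (ε / (2 * (|C| + 1))) ≤ (|C| + 1) * (ε / (2 * (|C| + 1))) := by
        gcongr; linarith [le_abs_self C]
    _ = ε / 2 := by field_simp
    _ < ε := by linarith

/-- The function `t ↦ (∫ φ(s + t) dω(s)) ψ(t)`. -/
def innerCorrelation [LocallyCompactSpace G] [T2Space G] (ω : RadonFunctional G)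
    (φ ψ : C_c(G, ℂ)) : C_c(G, ℂ) where
  toFun t := ω (shift t φ) * ψ t
  continuous_toFun := (continuous_apply_shift ω φ).mul ψ.continuous_toFun
  hasCompactSupport' := ψ.hasCompactSupport.mul_left

/-- The double integral `∫∫ φ(s + t) ψ(t) dω(s) dω̃(t)`. -/
def correlation [LocallyCompactSpace G] [T2Space G] (ω : RadonFunctional G)
    (φ ψ : C_c(G, ℂ)) : ℂ :=
  tildeMeasure ω (innerCorrelation ω φ ψ)

/-- The hull of `ν` is uniquely ergodic and, for its unique invariant probability measure `m`, `γ`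
is the autocorrelation
`γ(φ) = ∫ ∫ ∫ φ(s + t) ψ(t) dω(s) dω̃(t) dm(ω)`, for every `ψ ∈ C_c(G)` with `∫ ψ = 1`. -/
def IsAutocorrelation [LocallyCompactSpace G] [T2Space G] [MeasurableSpace G]
    (mG : Measure G) (ν : RadonFunctional G) (γ : C_c(G, ℂ) → ℂ) : Prop :=
  ∃ m : @Measure (hull ν) (borel (hull ν)), IsInvariantProbability ν m ∧
    (∀ m', IsInvariantProbability ν m' → m' = m) ∧
    ∀ ψ : C_c(G, ℂ), ∫ t, ψ t ∂mG = 1 → ∀ φ : C_c(G, ℂ),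
      γ φ = ∫ ω, correlation ω.1 φ ψ ∂m

end Dynamics

/-! ### Cut and project schemes -/

section Schemes

variable {G H : Type*} [AddCommGroup G] [TopologicalSpace G] [IsTopologicalAddGroup G]
  [AddCommGroup H] [TopologicalSpace H] [IsTopologicalAddGroup H]

/-- `(G, H, L)` is a cut and project scheme: `L` is a discrete cocompact subgroup of `G × H`, the
projection to `G` is injective on `L` and the projection of `L` to `H` is dense. An element of `L`
is a pair `(l, l⋆)`. -/
structure IsCutProjectScheme (L : AddSubgroup (G × H)) : Prop where
  discrete : DiscreteTopology L
  cocompact : CompactSpace ((G × H) ⧸ L)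
  injOn_fst : Set.InjOn Prod.fst (L : Set (G × H))
  dense_snd : Dense (Prod.snd '' (L : Set (G × H)))

/-- `ρ` is invariant under translations by elements of `L`. -/
def IsInvariantUnder (L : AddSubgroup (G × H)) (ρ : ComplexRadonMeasure (G × H)) : Prop :=
  ∀ l ∈ L, ∀ g : C_c(G × H, ℂ), ρ.integral (fun x => g (x + l)) = ρ.integral g

/-- `ρ` is the Dirac comb `δ_L`, the sum of the unit point masses at the points of `L`. -/
def IsDiracComb (L : AddSubgroup (G × H)) (ρ : ComplexRadonMeasure (G × H)) : Prop :=
  ∀ g : C_c(G × H, ℂ), ρ.integral g = ∑' l : L, g l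

/-- A measurable, locally bounded `f : H → ℂ` is admissible for `ρ` if for all `ε > 0` and
`φ ∈ C_c(G)` there is a compact `Q ⊆ H` with
`∫ |φ(t + s) f(h + k)| (1 - 1_Q(h + k)) d|ρ|(t, h) ≤ ε` for all `(s, k) ∈ G × H`. -/
structure IsAdmissible [MeasurableSpace H] (ρ : ComplexRadonMeasure (G × H)) (f : H → ℂ) :
    Prop where
  measurable : Measurable f
  locallyBounded : ∀ h, ∃ U ∈ 𝓝 h, ∃ C : ℝ, ∀ k ∈ U, ‖f k‖ ≤ C
  small_outside : ∀ ε : ℝ, 0 < ε → ∀ φ : C_c(G, ℂ), ∃ Q : Set H, IsCompact Q ∧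
    ∀ (s : G) (k : H),
      ∫⁻ x, ‖φ (x.1 + s) * f (x.2 + k)‖ₑ * Qᶜ.indicator 1 (x.2 + k) ∂ρ.variation ≤
        ENNReal.ofReal ε

/-- A measurable set of representatives of `(G × H) / L`. -/
structure IsFundamentalCell [MeasurableSpace G] [MeasurableSpace H] (L : AddSubgroup (G × H))
    (Z : Set (G × H)) : Prop where
  measurableSet : MeasurableSet Z
  bijOn : Set.BijOn (QuotientAddGroup.mk : G × H → (G × H) ⧸ L) Z Set.univ

/-- `σ_ξ(g) = ∑_{l ∈ L} g(x + l)` for `ξ = [x]`. -/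
def orbitSum (L : AddSubgroup (G × H)) (g : C_c(G × H, ℂ)) (ξ : (G × H) ⧸ L) : ℂ :=
  Quotient.liftOn' ξ (fun x => ∑' l : L, g (x + l)) <| by
    intro x y hxy
    rw [QuotientAddGroup.leftRel_apply] at hxy
    refine ((Equiv.addLeft (⟨-x + y, hxy⟩ : L)).tsum_eq fun l : L => g (x + l)).symm.trans ?_
    refine tsum_congr fun l => ?_
    simp [add_assoc]

/-- `ρT` is the measure on `(G × H) / L` with `∫ g dρ = ∫ σ_ξ(g) dρT(ξ)` for all
`g ∈ C_c(G × H)`. -/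
def IsDisintegration (L : AddSubgroup (G × H)) (ρ : ComplexRadonMeasure (G × H))
    (ρT : ComplexRadonMeasure ((G × H) ⧸ L)) : Prop :=
  ∀ g : C_c(G × H, ℂ), ρ.integral g = ρT.integral (orbitSum L g)

/-- `f̃(h) = conj (f(-h))`. -/
def tildeFun (f : H → ℂ) (h : H) : ℂ := (starRingEnd ℂ) (f (-h))

variable [MeasurableSpace H]

/-- `(f ∗ f̃)(h)`. -/
def selfConv (mH : Measure H) (f : H → ℂ) : H → ℂ :=
  MeasureTheory.convolution f (tildeFun f) (ContinuousLinearMap.mul ℂ ℂ) mH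

/-- `(f ∗ f̃)(h)` exists, that is, `k ↦ f(k) f̃(h - k)` is integrable. -/
def SelfConvExistsAt (mH : Measure H) (f : H → ℂ) (h : H) : Prop :=
  MeasureTheory.ConvolutionExistsAt f (tildeFun f) h (ContinuousLinearMap.mul ℂ ℂ) mH

/-- `γ_ξ(φ) = v⁻¹ ∑_{(l, l⋆) ∈ L} (f ∗ f̃)(h - l⋆) φ(s - l)` for `ξ = [s, h]`, where `v` is the
volume of a fundamental cell. -/
def gammaAt (L : AddSubgroup (G × H)) (mH : Measure H) (v : ℝ) (f : H → ℂ)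
    (ξ : (G × H) ⧸ L) (φ : C_c(G, ℂ)) : ℂ :=
  Quotient.liftOn' ξ
    (fun x => (v : ℂ)⁻¹ * ∑' l : L, selfConv mH f (x.2 - l.1.2) * φ (x.1 - l.1.1)) <| by
    intro x y hxy
    rw [QuotientAddGroup.leftRel_apply] at hxy
    refine congrArg (fun c => (v : ℂ)⁻¹ * c) ?_
    refine Eq.trans ?_ ((Equiv.addLeft (⟨-x + y, hxy⟩ : L)).tsum_eq
      fun l : L => selfConv mH f (y.2 - l.1.2) * φ (y.1 - l.1.1))
    refine tsum_congr fun l => ?_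
    have h1 : y.1 - (-x.1 + y.1 + l.1.1) = x.1 - l.1.1 := by abel
    have h2 : y.2 - (-x.2 + y.2 + l.1.2) = x.2 - l.1.2 := by abel
    simp [h1, h2]

/-- `γ_ξ(φ)` exists: for the representatives `(s, h)` of `ξ`, all the values `(f ∗ f̃)(h - l⋆)`
exist and the sum over `L` converges absolutely. -/
def GammaExistsAt (L : AddSubgroup (G × H)) (mH : Measure H) (f : H → ℂ)
    (ξ : (G × H) ⧸ L) (φ : C_c(G, ℂ)) : Prop :=
  ∀ x : G × H, (x : (G × H) ⧸ L) = ξ →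
    (∀ l : L, SelfConvExistsAt mH f (x.2 - l.1.2)) ∧
    Summable fun l : L => selfConv mH f (x.2 - l.1.2) * φ (x.1 - l.1.1)

theorem integrable_weight [LocallyCompactSpace G] [T2Space G] [T2Space H] [BorelSpace H]
    {ρ : ComplexRadonMeasure (G × H)} {f : H → ℂ} (hf : IsAdmissible ρ f) (φ : C_c(G, ℂ)) :
    Integrable (fun x => φ x.1 * f x.2 * ρ.phase x) ρ.variation := by
  let _ : MeasurableSpace (G × H) := borel (G × H)
  have : BorelSpace (G × H) := ⟨rfl⟩
  have := ρ.regular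
  have hmeas : Measurable fun x : G × H => φ x.1 * f x.2 * ρ.phase x := by
    have h1 : Measurable fun x : G × H => φ x.1 :=
      ((map_continuous φ).comp continuous_fst).measurable
    have h2 : Measurable fun x : G × H => f x.2 := hf.measurable.comp continuous_snd.measurable
    exact (h1.mul h2).mul ρ.measurable_phase
  refine ⟨hmeas.aestronglyMeasurable, ?_⟩
  obtain ⟨Q, hQ, hQle⟩ := hf.small_outside 1 one_pos φ
  obtain ⟨C, hC⟩ : ∃ C : ℝ, ∀ h ∈ Q, ‖f h‖ ≤ C := by
    refine hQ.induction_on (p := fun s => ∃ C : ℝ, ∀ h ∈ s, ‖f h‖ ≤ C) ⟨0, by simp⟩ ?_ ?_ ?_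
    · rintro s t hst ⟨C, hC⟩
      exact ⟨C, fun h hh => hC h (hst hh)⟩
    · rintro s t ⟨C, hC⟩ ⟨D, hD⟩
      refine ⟨max C D, fun h hh => ?_⟩
      rcases hh with hh | hh
      · exact (hC h hh).trans (le_max_left _ _)
      · exact (hD h hh).trans (le_max_right _ _)
    · intro h _
      obtain ⟨U, hU, C, hC⟩ := hf.locallyBounded h
      exact ⟨U, mem_nhdsWithin_of_mem_nhds hU, C, hC⟩
  obtain ⟨M, hM⟩ := (map_continuous φ).bounded_above_of_compact_support φ.hasCompactSupport
  have hKc : IsCompact (tsupport φ ×ˢ Q) := φ.hasCompactSupport.isCompact.prod hQ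
  set c : ℝ≥0∞ := ENNReal.ofReal M * ENNReal.ofReal C
  have hpt : ∀ x : G × H, ‖φ x.1 * f x.2 * ρ.phase x‖ₑ ≤
      ‖φ (x.1 + 0) * f (x.2 + 0)‖ₑ * Qᶜ.indicator 1 (x.2 + 0) +
        (tsupport φ ×ˢ Q).indicator (fun _ => c) x := by
    intro x
    have hph : ‖ρ.phase x‖ₑ = 1 := by
      rw [← ofReal_norm, ρ.norm_phase, ENNReal.ofReal_one]
    rw [enorm_mul, hph, mul_one, add_zero, add_zero]
    by_cases hx : x.2 ∈ Q
    · by_cases hx1 : x.1 ∈ tsupport φ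
      · refine le_trans ?_ le_add_self
        rw [Set.indicator_of_mem (Set.mk_mem_prod hx1 hx), enorm_mul]
        refine mul_le_mul' ?_ ?_
        · rw [← ofReal_norm]; exact ENNReal.ofReal_le_ofReal (hM _)
        · rw [← ofReal_norm]; exact ENNReal.ofReal_le_ofReal (hC _ hx)
      · simp [image_eq_zero_of_notMem_tsupport hx1]
    · simp [hx]
  refine lt_of_le_of_lt (lintegral_mono hpt) ?_
  rw [lintegral_add_right _ (measurable_const.indicator hKc.measurableSet)]
  refine ENNReal.add_lt_top.2 ⟨(hQle 0 0).trans_lt ENNReal.ofReal_lt_top, ?_⟩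
  rw [lintegral_indicator_const hKc.measurableSet]
  exact ENNReal.mul_lt_top (ENNReal.mul_lt_top ENNReal.ofReal_lt_top ENNReal.ofReal_lt_top)
    hKc.measure_lt_top

/-- The measure `ν_f` on `G`, `ν_f(φ) = ∫ φ(t) f(h) dρ(t, h)`. -/
def weightedMeasure [LocallyCompactSpace G] [T2Space G] [T2Space H] [BorelSpace H]
    (ρ : ComplexRadonMeasure (G × H)) (f : H → ℂ) (hf : IsAdmissible ρ f) :
    RadonFunctional G where
  toLin :=
    { toFun := fun φ => ρ.integral fun x => φ x.1 * f x.2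
      map_add' := fun φ ψ => by
        unfold ComplexRadonMeasure.integral
        let _ : MeasurableSpace (G × H) := borel (G × H)
        rw [← integral_add (integrable_weight hf φ) (integrable_weight hf ψ)]
        congr 1
        funext x
        simp [add_mul]
      map_smul' := fun c φ => by
        unfold ComplexRadonMeasure.integral
        let _ : MeasurableSpace (G × H) := borel (G × H)
        rw [RingHom.id_apply, smul_eq_mul, ← integral_const_mul]
        congr 1
        funext x
        simp [mul_assoc] }
  bounded := by
    intro K hK
    let _ : MeasurableSpace (G × H) := borel (G × H)
    obtain ⟨χ, hχ1, -, hχc, -⟩ :=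
      exists_continuous_one_zero_of_isCompact hK isClosed_empty (Set.disjoint_empty K)
    let χ' : C_c(G, ℂ) :=
      { toFun := fun x => (χ x : ℂ)
        continuous_toFun := by fun_prop
        hasCompactSupport' := hχc.comp_left (g := fun r : ℝ => (r : ℂ)) Complex.ofReal_zero }
    refine ⟨∫ x, ‖χ' x.1 * f x.2 * ρ.phase x‖ ∂ρ.variation, fun φ hφ B hB => ?_⟩
    change ‖∫ x, φ x.1 * f x.2 * ρ.phase x ∂ρ.variation‖ ≤ _
    refine (norm_integral_le_integral_norm _).trans ?_
    rw [← integral_mul_const]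
    refine integral_mono (integrable_weight hf φ).norm
      ((integrable_weight hf χ').norm.mul_const B) fun x => ?_
    change ‖φ x.1 * f x.2 * ρ.phase x‖ ≤ ‖χ' x.1 * f x.2 * ρ.phase x‖ * B
    have hB0 : 0 ≤ B := (norm_nonneg _).trans (hB 0)
    by_cases hx : x.1 ∈ tsupport φ
    · have h1 : χ' x.1 = 1 := by
        change ((χ x.1 : ℝ) : ℂ) = 1
        rw [hχ1 (hφ hx)]; simp
      rw [h1, mul_assoc, norm_mul, one_mul, mul_comm]
      exact mul_le_mul_of_nonneg_left (hB _) (norm_nonneg _)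
    · rw [image_eq_zero_of_notMem_tsupport hx, zero_mul, zero_mul, norm_zero]
      positivity

end Schemes

end CutProject

end

open CutProject

/-!
A weight in `C_c(H)` in place of `f` gives the measures `ω_ζ(φ) = ∫ σ_{ξ + ζ}(φ ⊗ f) dρT(ξ)` on
`G`, which depend continuously on `ζ` in the compact group `T = (G × H) / L`. Admissibility says
that cutoffs of `f` make the `ω_ζ` converge uniformly in `ζ`, so they are defined for `f` as well,
and `ν_f = ω_0`. Translating `ω_ζ` by `t` moves `ζ` by `[(t, 0)]`, and these points are dense in `T`
because `L` projects densely to `H`. Hence the hull of `ν_f` is a factor of the rotation of `T`: its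
only invariant probability measure is the image of the Haar measure of `T`, and the autocorrelation
is a Haar average over `T`, which unfolds to `∫∫ γ_{ξ - η} dρT(ξ) dρ̄T(η)` when the weight has
compact support. The limit along the cutoffs is dominated convergence: the same unfolding, applied
to `|f|`, bounds the integrals of a majorant of all the `γ_{ξ - η}` uniformly. For the Dirac comb
of `L`, `ρT` is the point mass at `0`.
-/

noncomputable section

namespace CutProject

section Regularity

theorem norm_sub_inv_max_smul_le {E : Type*} [NormedAddCommGroup E] [NormedSpace ℝ E] {a : E}
    (ha : ‖a‖ ≤ 1) (b : E) : ‖a - (max 1 ‖b‖)⁻¹ • b‖ ≤ 2 * ‖a - b‖ := by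
  have hb : ‖b - (max 1 ‖b‖)⁻¹ • b‖ ≤ ‖a - b‖ := by
    have hsub : b - (max 1 ‖b‖)⁻¹ • b = (1 - (max 1 ‖b‖)⁻¹) • b := by rw [sub_smul, one_smul]
    have hle : (max 1 ‖b‖)⁻¹ ≤ 1 := inv_le_one_of_one_le₀ (le_max_left _ _)
    rw [hsub, norm_smul, Real.norm_of_nonneg (sub_nonneg.2 hle)]
    rcases le_total ‖b‖ 1 with hb1 | hb1
    · simp [max_eq_left hb1]
    · rw [max_eq_right hb1, sub_mul, inv_mul_cancel₀ (by positivity), one_mul, norm_sub_rev]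
      linarith [norm_sub_norm_le b a]
  linarith [norm_sub_le_norm_sub_add_norm_sub a b ((max 1 ‖b‖)⁻¹ • b)]

variable {Y : Type*} [TopologicalSpace Y] [MeasurableSpace Y] [BorelSpace Y]

theorem exists_norm_le_one_integral_norm_sub_le [NormalSpace Y] [R1Space Y]
    [WeaklyLocallyCompactSpace Y]
    {E : Type*} [NormedAddCommGroup E] [NormedSpace ℝ E] {μ : Measure Y} [μ.Regular] {h : Y → E}
    (hh : Integrable h μ) (hh1 : ∀ y, ‖h y‖ ≤ 1) {ε : ℝ} (hε : 0 < ε) :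
    ∃ k : C_c(Y, E), (∀ y, ‖k y‖ ≤ 1) ∧ Integrable k μ ∧ ∫ y, ‖h y - k y‖ ∂μ ≤ ε := by
  obtain ⟨k, hkc, hk, hkcont, hki⟩ :=
    hh.exists_hasCompactSupport_integral_sub_le (ε := ε / 2) (by positivity)
  have hpos : ∀ y, (0 : ℝ) < max 1 ‖k y‖ := fun y => lt_max_of_lt_left one_pos
  let k₁ : C_c(Y, E) :=
    { toFun := fun y => (max 1 ‖k y‖)⁻¹ • k y
      continuous_toFun :=
        ((continuous_const.max hkcont.norm).inv₀ fun y => (hpos y).ne').smul hkcont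
      hasCompactSupport' := hkc.smul_left }
  have hk₁ : Integrable k₁ μ :=
    (map_continuous k₁).integrable_of_hasCompactSupport k₁.hasCompactSupport
  refine ⟨k₁, fun y => ?_, hk₁, ?_⟩
  · change ‖(max 1 ‖k y‖)⁻¹ • k y‖ ≤ 1
    rw [norm_smul, norm_inv, Real.norm_of_nonneg (hpos y).le, inv_mul_le_one₀ (hpos y)]
    exact le_max_right _ _
  · calc ∫ y, ‖h y - k₁ y‖ ∂μ ≤ ∫ y, 2 * ‖h y - k y‖ ∂μ :=
          integral_mono (hh.sub hk₁).norm ((hh.sub hki).norm.const_mul 2)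
            fun y => norm_sub_inv_max_smul_le (hh1 y) (k y)
      _ = 2 * ∫ y, ‖h y - k y‖ ∂μ := integral_const_mul _ _
      _ ≤ ε := by linarith

theorem integral_le_of_forall_norm_integral_mul_le [T2Space Y] [NormalSpace Y]
    [WeaklyLocallyCompactSpace Y]
    (μ : Measure Y) [μ.Regular] {u : Y → ℂ} (hu : Measurable u) (hu1 : ∀ y, ‖u y‖ = 1)
    {g : Y → ℝ} (hg : Continuous g) (hgc : HasCompactSupport g) {C : ℝ}
    (hC : ∀ k : C_c(Y, ℂ), (∀ y, ‖k y‖ ≤ 1) → ‖∫ y, (g y : ℂ) * k y * u y ∂μ‖ ≤ C) :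
    ∫ y, g y ∂μ ≤ C := by
  obtain ⟨M, hM⟩ := hg.bounded_above_of_compact_support hgc
  have hK : IsCompact (tsupport g) := hgc
  set h : Y → ℂ := (tsupport g).indicator fun y => (starRingEnd ℂ) (u y)
  have hh1 : ∀ y, ‖h y‖ ≤ 1 := fun y => by
    by_cases hy : y ∈ tsupport g <;> simp [h, hy, hu1]
  have hh : Integrable h μ :=
    (Measure.integrableOn_of_bounded (M := 1) hK.measure_lt_top.ne
      (Complex.continuous_conj.measurable.comp hu).aestronglyMeasurable
      (ae_of_all _ fun y => by simp [hu1])).integrable_indicator hK.measurableSet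
  have hghu : ∀ y, (g y : ℂ) * h y * u y = g y := fun y => by
    by_cases hy : y ∈ tsupport g
    · simp [h, hy, mul_assoc, Complex.conj_mul', hu1]
    · simp [h, hy, image_eq_zero_of_notMem_tsupport hy]
  have hint : ∀ {k : Y → ℂ}, Integrable k μ → Integrable (fun y => (g y : ℂ) * k y * u y) μ :=
    fun hk => (hk.bdd_mul (Complex.continuous_ofReal.comp hg).aestronglyMeasurable
      (ae_of_all _ fun y => by simpa using hM y)).mul_bdd hu.aestronglyMeasurable
        (ae_of_all _ fun y => (hu1 y).le)
  have hclose : ∀ k : C_c(Y, ℂ), Integrable k μ →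
      ‖∫ y, (g y : ℂ) ∂μ - ∫ y, (g y : ℂ) * k y * u y ∂μ‖ ≤ M * ∫ y, ‖h y - k y‖ ∂μ := by
    intro k hk
    simp_rw [← integral_const_mul, ← integral_congr_ae (ae_of_all μ hghu)]
    rw [← integral_sub (hint hh) (hint hk)]
    refine norm_integral_le_of_norm_le ((hh.sub hk).norm.const_mul M) (ae_of_all _ fun y => ?_)
    rw [← sub_mul, ← mul_sub, norm_mul, norm_mul, hu1, mul_one, Complex.norm_real]
    exact mul_le_mul_of_nonneg_right (hM y) (norm_nonneg _)
  refine le_of_forall_pos_le_add fun ε hε => ?_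
  obtain ⟨k, hk1, hk, hhk⟩ := exists_norm_le_one_integral_norm_sub_le hh hh1
    (show 0 < ε / (|M| + 1) by positivity)
  calc ∫ y, g y ∂μ ≤ ‖∫ y, (g y : ℂ) ∂μ‖ := by
        rw [integral_complex_ofReal, Complex.norm_real]; exact Real.le_norm_self _
    _ ≤ ‖∫ y, (g y : ℂ) * k y * u y ∂μ‖ + M * ∫ y, ‖h y - k y‖ ∂μ :=
        (norm_le_norm_add_norm_sub' _ _).trans (by gcongr; exact hclose k hk)
    _ ≤ C + (|M| + 1) * (ε / (|M| + 1)) := by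
        gcongr
        · exact hC k hk1
        · linarith [le_abs_self M]
    _ = C + ε := by rw [mul_div_cancel₀]; positivity

theorem innerRegularCompactLTTop_withDensity [T2Space Y] (μ : Measure Y) [IsFiniteMeasure μ]
    [μ.InnerRegularCompactLTTop] {d : Y → ℝ≥0∞} (hd : ∫⁻ y, d y ∂μ ≠ ∞) :
    (μ.withDensity d).InnerRegularCompactLTTop := by
  refine ⟨fun A ⟨hA, _⟩ r hr => ?_⟩
  obtain ⟨r', hrr', hr'⟩ := exists_between hr
  obtain ⟨δ, hδ, hsmall⟩ := exists_pos_setLIntegral_lt_of_measure_lt hd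
    (ε := r' - r) (tsub_pos_of_lt hrr').ne'
  obtain ⟨K, hKA, hK, hKδ⟩ := hA.exists_isCompact_sdiff_lt (measure_ne_top μ A) hδ.ne'
  have hdiff : μ.withDensity d (A \ K) < r' - r := by
    rw [withDensity_apply _ (hA.diff hK.measurableSet)]
    exact hsmall _ hKδ
  refine ⟨K, hKA, hK, ?_⟩
  by_contra! hle
  refine hr'.not_ge ?_
  calc μ.withDensity d A = μ.withDensity d (K ∪ A \ K) := by rw [Set.union_sdiff_cancel hKA]
    _ ≤ r + (r' - r) := (measure_union_le _ _).trans (add_le_add hle hdiff.le)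
    _ = r' := add_tsub_cancel_of_le hrr'.le

end Regularity

section Functionals

variable {T : Type*} [TopologicalSpace T]

instance (τ : ComplexRadonMeasure T) : @Measure.Regular T (borel T) _ τ.variation := τ.regular

instance [CompactSpace T] (τ : ComplexRadonMeasure T) :
    @IsFiniteMeasure T (borel T) τ.variation := by
  let _ : MeasurableSpace T := borel T
  infer_instance

theorem ComplexRadonMeasure.norm_mul_phase (τ : ComplexRadonMeasure T) (F : T → ℂ) (x : T) :
    ‖F x * τ.phase x‖ = ‖F x‖ := by
  rw [norm_mul, τ.norm_phase, mul_one]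

theorem ComplexRadonMeasure.integrable_mul_phase (τ : ComplexRadonMeasure T) {F : T → ℂ}
    (hF : Integrable F τ.variation) : Integrable (fun x => F x * τ.phase x) τ.variation :=
  hF.mul_bdd τ.measurable_phase.aestronglyMeasurable (ae_of_all _ fun x => (τ.norm_phase x).le)

theorem ComplexRadonMeasure.integrable_of_hasCompactSupport (τ : ComplexRadonMeasure T)
    {E : Type*} [NormedAddCommGroup E] {F : T → E} (hF : Continuous F) (hFc : HasCompactSupport F) :
    Integrable F τ.variation := by
  let _ : MeasurableSpace T := borel T
  have : BorelSpace T := ⟨rfl⟩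
  exact hF.integrable_of_hasCompactSupport hFc

theorem ComplexRadonMeasure.integral_add (τ : ComplexRadonMeasure T) {F F' : T → ℂ}
    (hF : Integrable F τ.variation) (hF' : Integrable F' τ.variation) :
    τ.integral (fun x => F x + F' x) = τ.integral F + τ.integral F' := by
  simp only [ComplexRadonMeasure.integral, add_mul]
  exact MeasureTheory.integral_add (τ.integrable_mul_phase hF) (τ.integrable_mul_phase hF')

theorem ComplexRadonMeasure.integral_sub (τ : ComplexRadonMeasure T) {F F' : T → ℂ}
    (hF : Integrable F τ.variation) (hF' : Integrable F' τ.variation) :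
    τ.integral (fun x => F x - F' x) = τ.integral F - τ.integral F' := by
  simp only [ComplexRadonMeasure.integral, sub_mul]
  exact MeasureTheory.integral_sub (τ.integrable_mul_phase hF) (τ.integrable_mul_phase hF')

theorem ComplexRadonMeasure.integral_const_mul (τ : ComplexRadonMeasure T) (c : ℂ) (F : T → ℂ) :
    τ.integral (fun x => c * F x) = c * τ.integral F := by
  simp only [ComplexRadonMeasure.integral, mul_assoc]
  exact MeasureTheory.integral_const_mul _ _

theorem ComplexRadonMeasure.norm_integral_le (τ : ComplexRadonMeasure T) {F : T → ℂ} {g : T → ℝ}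
    (hg : Integrable g τ.variation) (hFg : ∀ x, ‖F x‖ ≤ g x) :
    ‖τ.integral F‖ ≤ @MeasureTheory.integral T ℝ _ _ (borel T) τ.variation g :=
  norm_integral_le_of_norm_le hg (ae_of_all _ fun x => (τ.norm_mul_phase F x).trans_le (hFg x))

/-- Integration against `ρ` as a linear functional on `C_c(T)`. -/
def ComplexRadonMeasure.toLinearMap (ρ : ComplexRadonMeasure T) : C_c(T, ℂ) →ₗ[ℂ] ℂ where
  toFun g := ρ.integral g
  map_add' g g' := ρ.integral_add
    (ρ.integrable_of_hasCompactSupport (map_continuous g) g.hasCompactSupport)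
    (ρ.integrable_of_hasCompactSupport (map_continuous g') g'.hasCompactSupport)
  map_smul' c g := ρ.integral_const_mul c g

/-- The total variation, as a complex Radon measure. -/
def ComplexRadonMeasure.abs (τ : ComplexRadonMeasure T) : ComplexRadonMeasure T where
  variation := τ.variation
  regular := τ.regular
  phase _ := 1
  measurable_phase := @measurable_const _ _ _ (borel T) _
  norm_phase _ := norm_one

theorem ComplexRadonMeasure.abs_integral_ofReal (τ : ComplexRadonMeasure T) (g : T → ℝ) :
    τ.abs.integral (fun x => (g x : ℂ)) =
      (@MeasureTheory.integral T ℝ _ _ (borel T) τ.variation g : ℂ) := by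
  let _ : MeasurableSpace T := borel T
  simp only [ComplexRadonMeasure.integral, ComplexRadonMeasure.abs, mul_one]
  exact integral_complex_ofReal

variable [CompactSpace T]

theorem ComplexRadonMeasure.integrable (τ : ComplexRadonMeasure T) {E : Type*}
    [NormedAddCommGroup E] {F : T → E} (hF : Continuous F) : Integrable F τ.variation :=
  τ.integrable_of_hasCompactSupport hF (HasCompactSupport.of_compactSpace F)

/-- Integration against `τ` as a continuous linear functional on `C(T)`. -/
def ComplexRadonMeasure.toCLM (τ : ComplexRadonMeasure T) : C(T, ℂ) →L[ℂ] ℂ :=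
  LinearMap.mkContinuous
    { toFun := fun F => τ.integral F
      map_add' := fun F F' =>
        τ.integral_add (τ.integrable F.continuous) (τ.integrable F'.continuous)
      map_smul' := fun c F => τ.integral_const_mul c F }
    (@Measure.real T (borel T) τ.variation Set.univ) fun F =>
      (norm_integral_le_of_norm_le_const (ae_of_all _ fun x =>
        (τ.norm_mul_phase F x).trans_le (F.norm_coe_le_norm x))).trans (mul_comm _ _).le

theorem ComplexRadonMeasure.toCLM_apply (τ : ComplexRadonMeasure T) (F : C(T, ℂ)) :
    τ.toCLM F = τ.integral F := rfl

theorem ComplexRadonMeasure.continuous_integral (τ : ComplexRadonMeasure T)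
    {P : Type*} [TopologicalSpace P] {F : P → T → ℂ} (hF : Continuous (Function.uncurry F)) :
    Continuous fun p => τ.integral (F p) :=
  τ.toCLM.continuous.comp (ContinuousMap.curry ⟨_, hF⟩).continuous

-- Integrating `p ↦ F p` as a `C(T)`-valued function avoids measurability on the product, whose
-- Borel `σ`-algebra need not be generated by rectangles.
theorem ComplexRadonMeasure.integral_integral_swap (τ : ComplexRadonMeasure T)
    {P : Type*} [TopologicalSpace P] [MeasurableSpace P] [BorelSpace P] [R1Space P]
    (m : Measure P) [IsFiniteMeasureOnCompacts m] {F : P → T → ℂ}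
    (hF : Continuous (Function.uncurry F)) {K : Set P} (hK : IsCompact K)
    (hKF : ∀ p, p ∉ K → ∀ x, F p x = 0) :
    ∫ p, τ.integral (F p) ∂m = τ.integral fun x => ∫ p, F p x ∂m := by
  let Φ : C(P, C(T, ℂ)) := ContinuousMap.curry ⟨_, hF⟩
  have hΦ : Integrable Φ m :=
    Φ.continuous.integrable_of_hasCompactSupport <|
      HasCompactSupport.intro hK fun p hp => ContinuousMap.ext (hKF p hp)
  refine (τ.toCLM.integral_comp_comm hΦ).trans ((τ.toCLM_apply _).trans ?_)
  congr 1
  funext x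
  exact ((ContinuousMap.evalCLM ℂ x).integral_comp_comm hΦ).symm

end Functionals

section PushForward

theorem ComplexRadonMeasure.exists_integral_eq_integral_mul {T : Type*} [TopologicalSpace T]
    [T2Space T] [mT : MeasurableSpace T] [hT : BorelSpace T] (κ : Measure T) [IsFiniteMeasure κ]
    [κ.InnerRegularCompactLTTop] {v : T → ℂ} (hv : Measurable v) (hvi : Integrable v κ) :
    ∃ τ : ComplexRadonMeasure T, ∀ F : T → ℂ, τ.integral F = ∫ x, F x * v x ∂κ := by
  obtain rfl := hT.measurable_eq
  let _ : MeasurableSpace T := borel T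
  have hvfin : ∫⁻ x, ((‖v x‖₊ : NNReal) : ℝ≥0∞) ∂κ ≠ ∞ := hvi.hasFiniteIntegral.ne
  have : IsFiniteMeasure (κ.withDensity fun x => ((‖v x‖₊ : NNReal) : ℝ≥0∞)) :=
    isFiniteMeasure_withDensity hvfin
  have := innerRegularCompactLTTop_withDensity κ hvfin
  let τ : ComplexRadonMeasure T :=
    { variation := κ.withDensity fun x => ((‖v x‖₊ : NNReal) : ℝ≥0∞)
      regular := inferInstance
      phase := fun x => if v x = 0 then 1 else v x / ‖v x‖
      measurable_phase := Measurable.ite (hv (measurableSet_singleton 0)) measurable_const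
        (hv.div (Complex.measurable_ofReal.comp hv.norm))
      norm_phase := fun x => by
        split_ifs with h
        · exact norm_one
        · rw [norm_div, Complex.norm_real, norm_norm, div_self (norm_ne_zero_iff.2 h)] }
  have hpolar : ∀ x, ‖v x‖₊ • τ.phase x = v x := fun x => by
    change ‖v x‖₊ • (if v x = 0 then 1 else v x / ‖v x‖ : ℂ) = v x
    rw [NNReal.smul_def, Complex.real_smul, coe_nnnorm]
    split_ifs with h
    · simp [h]
    · exact mul_div_cancel₀ _ (by exact_mod_cast norm_ne_zero_iff.2 h)
  refine ⟨τ, fun F => ?_⟩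
  refine (integral_withDensity_eq_integral_smul hv.nnnorm _).trans ?_
  simp only [← mul_smul_comm, hpolar]

/-- The density of the image measure is the conditional expectation on the fibres of `π`. -/
theorem exists_integrable_map_integral_comp_mul_eq {X T : Type*} [MeasurableSpace X]
    [mT : MeasurableSpace T] (μ : Measure X) [IsFiniteMeasure μ] {π : X → T} (hπ : Measurable π)
    {u : X → ℂ} (hu : Integrable u μ) :
    ∃ v : T → ℂ, Measurable v ∧ Integrable v (μ.map π) ∧ ∀ F : T → ℂ, Measurable F →
      Integrable (fun x => F (π x) * u x) μ →
      ∫ x, F (π x) * u x ∂μ = ∫ y, F y * v y ∂μ.map π := by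
  obtain ⟨v, hv, hve⟩ := (stronglyMeasurable_condExp (μ := μ) (m := mT.comap π)
    (f := u)).measurable.exists_eq_measurable_comp
  have hvi : Integrable (v ∘ π) μ := hve ▸ integrable_condExp
  refine ⟨v, hv, (integrable_map_measure hv.aestronglyMeasurable hπ.aemeasurable).2 hvi,
    fun F hF hFu => ?_⟩
  have hpull : μ[fun x => F (π x) * u x | mT.comap π] =ᵐ[μ] fun x => F (π x) * v (π x) := by
    have := condExp_bilin_of_stronglyMeasurable_left (ContinuousLinearMap.mul ℝ ℂ)
      (hF.comp (comap_measurable π)).stronglyMeasurable hFu hu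
    rwa [hve] at this
  calc ∫ x, F (π x) * u x ∂μ
      = ∫ x, (μ[fun x => F (π x) * u x | mT.comap π]) x ∂μ := (integral_condExp hπ.comap_le).symm
    _ = ∫ x, F (π x) * v (π x) ∂μ := integral_congr_ae hpull
    _ = ∫ y, F y * v y ∂μ.map π :=
        (integral_map hπ.aemeasurable (hF.mul hv).aestronglyMeasurable).symm

variable {X : Type*} [TopologicalSpace X] [T2Space X]

theorem innerRegularCompactLTTop_withDensity_of_hasCompactSupport [MeasurableSpace X]
    [BorelSpace X] (μ : Measure X) [μ.Regular] {w : X → NNReal} (hw : Continuous w)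
    (hwc : HasCompactSupport w) :
    (μ.withDensity fun x => (w x : ℝ≥0∞)).InnerRegularCompactLTTop := by
  have hK : IsCompact (tsupport w) := hwc
  have hrestrict : μ.withDensity (fun x => (w x : ℝ≥0∞)) =
      (μ.restrict (tsupport w)).withDensity fun x => (w x : ℝ≥0∞) := by
    rw [← restrict_withDensity hK.measurableSet]
    refine (Measure.restrict_eq_self_of_ae_mem ?_).symm
    rw [ae_withDensity_iff hw.measurable.coe_nnreal_ennreal]
    exact ae_of_all _ fun x hx => subset_tsupport _ (by simpa using hx)
  have : IsFiniteMeasure (μ.restrict (tsupport w)) :=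
    ⟨by rw [Measure.restrict_apply_univ]; exact hK.measure_lt_top⟩
  rw [hrestrict]
  refine innerRegularCompactLTTop_withDensity _ (ne_top_of_le_ne_top ?_
    (lintegral_mono' Measure.restrict_le_self le_rfl))
  have hint : Integrable (fun x => (w x : ℝ)) μ :=
    (NNReal.continuous_coe.comp hw).integrable_of_hasCompactSupport (hwc.comp_left NNReal.coe_zero)
  simpa only [ENNReal.ofReal_coe_nnreal] using hint.lintegral_lt_top.ne

theorem ComplexRadonMeasure.exists_pushforward {T : Type*} [TopologicalSpace T] [T2Space T]
    (ρ : ComplexRadonMeasure X) {π : X → T} (hπ : Continuous π) {w : X → ℝ} (hw : Continuous w)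
    (hwc : HasCompactSupport w) (hw0 : ∀ x, 0 ≤ w x) :
    ∃ τ : ComplexRadonMeasure T, ∀ F : C(T, ℂ),
      τ.integral F = ρ.integral fun x => w x * F (π x) := by
  let _ : MeasurableSpace X := borel X
  have : BorelSpace X := ⟨rfl⟩
  let _ : MeasurableSpace T := borel T
  have : BorelSpace T := ⟨rfl⟩
  set d : X → NNReal := fun x => (w x).toNNReal
  have hd : Continuous d := continuous_real_toNNReal.comp hw
  set lam : Measure X := ρ.variation.withDensity fun x => (d x : ℝ≥0∞)
  have : IsFiniteMeasure lam := isFiniteMeasure_withDensity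
    (hw.integrable_of_hasCompactSupport (μ := ρ.variation) hwc).lintegral_lt_top.ne
  have hreg : lam.InnerRegularCompactLTTop :=
    innerRegularCompactLTTop_withDensity_of_hasCompactSupport _ hd
      (hwc.comp_left Real.toNNReal_zero)
  have := hreg.map_of_continuous hπ
  have hsmul : ∀ (F : C(T, ℂ)) x,
      d x • (F (π x) * ρ.phase x) = w x * F (π x) * ρ.phase x := fun F x => by
    rw [NNReal.smul_def, Complex.real_smul, Real.coe_toNNReal _ (hw0 x), mul_assoc]
  have hFint : ∀ F : C(T, ℂ), Integrable (fun x => F (π x) * ρ.phase x) lam := fun F => by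
    rw [integrable_withDensity_iff_integrable_smul hd.measurable]
    simp only [hsmul]
    exact ρ.integrable_mul_phase <| ρ.integrable_of_hasCompactSupport (by fun_prop) <|
      (hwc.comp_left Complex.ofReal_zero).mul_right
  obtain ⟨v, hv, hvi, hvint⟩ := exists_integrable_map_integral_comp_mul_eq lam hπ.measurable
    (u := ρ.phase) (by simpa using hFint 1)
  obtain ⟨τ, hτ⟩ := ComplexRadonMeasure.exists_integral_eq_integral_mul (lam.map π) hv hvi
  refine ⟨τ, fun F => ?_⟩
  rw [hτ, ← hvint F F.continuous.measurable (hFint F),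
    integral_withDensity_eq_integral_smul hd.measurable]
  simp only [hsmul]
  rfl

end PushForward

section Lattices

variable {X : Type*} [AddCommGroup X] (L : AddSubgroup X)

/-- The class `[x]` of `x` modulo `L`. -/
abbrev toTorus (x : X) : X ⧸ L := QuotientAddGroup.mk x

theorem toTorus_add_coe (x : X) (l : L) : toTorus L (x + l) = toTorus L x :=
  QuotientAddGroup.mk_add_of_mem x l.2

variable [TopologicalSpace X]

theorem continuous_toTorus : Continuous (toTorus L) := continuous_quot_mk

/-- `w · (F ∘ π)` for `F ∈ C(X / L)`, where `π` is the quotient map. -/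
def mulLift (w : C_c(X, ℂ)) (F : C(X ⧸ L, ℂ)) : C_c(X, ℂ) where
  toFun x := w x * F (toTorus L x)
  continuous_toFun := (map_continuous w).mul (F.continuous.comp (continuous_toTorus L))
  hasCompactSupport' := w.hasCompactSupport.mul_right

theorem mulLift_apply (w : C_c(X, ℂ)) (F : C(X ⧸ L, ℂ)) (x : X) :
    mulLift L w F x = w x * F (toTorus L x) := rfl

variable [IsTopologicalAddGroup X]

theorem exists_isCompact_toTorus_surjOn [WeaklyLocallyCompactSpace X] [CompactSpace (X ⧸ L)] :
    ∃ C : Set X, IsCompact C ∧ ∀ ξ, ∃ x ∈ C, toTorus L x = ξ := by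
  choose V hV hVx using fun x : X => exists_compact_mem_nhds x
  have hopen : ∀ x, IsOpen (toTorus L '' interior (V x)) := fun x =>
    QuotientAddGroup.isOpenQuotientMap_mk.isOpenMap _ isOpen_interior
  obtain ⟨t, ht⟩ := isCompact_univ.elim_finite_subcover _ hopen fun ξ _ => by
    obtain ⟨x, rfl⟩ := QuotientAddGroup.mk_surjective ξ
    exact Set.mem_iUnion.2 ⟨x, x, mem_interior_iff_mem_nhds.2 (hVx x), rfl⟩
  refine ⟨⋃ x ∈ t, V x, t.isCompact_biUnion fun x _ => hV x, fun ξ => ?_⟩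
  obtain ⟨x, hx, y, hy, rfl⟩ := Set.mem_iUnion₂.1 (ht (Set.mem_univ ξ))
  exact ⟨y, Set.mem_iUnion₂.2 ⟨x, hx, interior_subset hy⟩, rfl⟩

variable [T2Space X] [DiscreteTopology L]

theorem finite_lattice_translates {V C : Set X} (hV : IsCompact V) (hC : IsCompact C) :
    {l : L | ∃ x ∈ V, x + l ∈ C}.Finite := by
  have hK : IsCompact ((fun p : X × X => p.1 - p.2) '' (C ×ˢ V)) :=
    (hC.prod hV).image (by fun_prop)
  have hfin := AddSubgroup.tendsto_coe_cofinite_of_discrete L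
    (isDiscrete_iff_discreteTopology.2 inferInstance) hK.compl_mem_cocompact
  rw [mem_map, mem_cofinite] at hfin
  refine hfin.subset ?_
  rintro l ⟨x, hx, hl⟩
  simp only [Set.mem_compl_iff, Set.mem_preimage, not_not]
  exact ⟨(x + l, x), ⟨hl, hx⟩, add_sub_cancel_left _ _⟩

variable {E : Type*} [AddCommMonoid E] [TopologicalSpace E]

theorem summable_lattice_translates {g : X → E} (hg : HasCompactSupport g) (x : X) :
    Summable fun l : L => g (x + l) :=
  summable_of_hasFiniteSupport <|
    (finite_lattice_translates L (isCompact_singleton (x := x)) hg).subset fun _ hl =>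
      ⟨x, rfl, subset_tsupport _ hl⟩

theorem continuous_tsum_lattice_translates [WeaklyLocallyCompactSpace X] [ContinuousAdd E]
    {P : Type*} [TopologicalSpace P] {g : P → X → E} (hg : Continuous (Function.uncurry g))
    {C : Set X} (hC : IsCompact C) (hgC : ∀ p x, x ∉ C → g p x = 0) :
    Continuous fun q : P × X => ∑' l : L, g q.1 (q.2 + l) := by
  rw [continuous_iff_continuousAt]
  rintro ⟨p₀, x₀⟩
  obtain ⟨V, hV, hx₀⟩ := exists_compact_mem_nhds x₀
  have hfin := finite_lattice_translates L hV hC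
  have hsum : Continuous fun q : P × X => ∑ l ∈ hfin.toFinset, g q.1 (q.2 + l) :=
    continuous_finsetSum _ fun l _ =>
      hg.comp (continuous_fst.prodMk (continuous_snd.add continuous_const))
  refine hsum.continuousAt.congr ?_
  filter_upwards [prod_mem_nhds univ_mem hx₀] with q hq
  refine (tsum_eq_sum fun l hl => hgC _ _ fun hlC => hl ?_).symm
  rw [Set.Finite.mem_toFinset]
  exact ⟨q.2, hq.2, hlC⟩

/-- A nonnegative function in `C_c(X)` whose translates under `L` add up to `1`. It lifts functions
on `X / L` to compactly supported functions on `X`. -/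
structure IsBruhatFunction (w : C_c(X, ℝ)) : Prop where
  nonneg : ∀ x, 0 ≤ w x
  tsum_eq_one : ∀ x, ∑' l : L, w (x + l) = 1

theorem exists_isBruhatFunction [LocallyCompactSpace X] [CompactSpace (X ⧸ L)] :
    ∃ w : C_c(X, ℝ), IsBruhatFunction L w := by
  obtain ⟨C, hC, hCs⟩ := exists_isCompact_toTorus_surjOn L
  obtain ⟨u, hu1, -, huc, hu01⟩ :=
    exists_continuous_one_zero_of_isCompact hC isClosed_empty (Set.disjoint_empty C)
  let s : X → ℝ := fun x => ∑' l : L, u (x + l)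
  have hs : Continuous s :=
    (continuous_tsum_lattice_translates L (P := Unit) (g := fun _ => u) (by fun_prop) huc
      fun _ _ => image_eq_zero_of_notMem_tsupport).comp (Continuous.prodMk_right ())
  have hsper : ∀ x (l : L), s (x + l) = s x := fun x l => by
    simp only [s, add_assoc]
    exact (Equiv.addLeft l).tsum_eq fun l' : L => u (x + l')
  have hspos : ∀ x, 0 < s x := fun x => by
    obtain ⟨y, hy, hyx⟩ := hCs (toTorus L x)
    let l : L := ⟨-x + y, QuotientAddGroup.eq.1 hyx.symm⟩
    have hl : u (x + l) = 1 := by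
      rw [show x + (l : X) = y from add_neg_cancel_left x y]
      exact hu1 hy
    calc 0 < u (x + l) := hl ▸ one_pos
      _ ≤ s x := (summable_lattice_translates L huc x).le_tsum l fun _ _ => (hu01 _).1
  refine ⟨⟨⟨fun x => u x / s x, u.continuous.div hs fun x => (hspos x).ne'⟩, ?_⟩,
    fun x => div_nonneg (hu01 x).1 (hspos x).le, fun x => ?_⟩
  · exact HasCompactSupport.intro huc fun x hx =>
      div_eq_zero_iff.2 (.inl (image_eq_zero_of_notMem_tsupport hx))
  · change ∑' l : L, u (x + l) / s (x + l) = 1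
    simp only [hsper, tsum_div_const]
    exact div_self (hspos x).ne'

/-- The finitely many `l ∈ L` for which `x` and `x + l` can lie in the supports of `w` and `g`. -/
def overlap (w g : C_c(X, ℂ)) : Finset L :=
  (finite_lattice_translates L w.hasCompactSupport.isCompact g.hasCompactSupport).toFinset

theorem mul_apply_add_eq_zero_of_notMem_overlap {w g : C_c(X, ℂ)} {l : L}
    (hl : l ∉ overlap L w g) (x : X) : w x * g (x + l) = 0 := by
  by_contra h
  obtain ⟨hw, hg⟩ := mul_ne_zero_iff.1 h
  exact hl ((Set.Finite.mem_toFinset _).2 ⟨x, subset_tsupport _ hw, subset_tsupport _ hg⟩)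

end Lattices

section Complexify

variable {X : Type*} [TopologicalSpace X]

/-- The complex-valued version of a real compactly supported function. -/
def complexify (w : C_c(X, ℝ)) : C_c(X, ℂ) where
  toFun x := (w x : ℂ)
  continuous_toFun := by fun_prop
  hasCompactSupport' :=
    w.hasCompactSupport.comp_left (g := fun r : ℝ => (r : ℂ)) Complex.ofReal_zero

@[simp]
theorem complexify_apply (w : C_c(X, ℝ)) (x : X) : complexify w x = (w x : ℂ) := rfl

theorem IsBruhatFunction.tsum_complexify_eq_one [AddCommGroup X] {L : AddSubgroup X} {w : C_c(X, ℝ)}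
    (hw : IsBruhatFunction L w) (x : X) : ∑' l : L, complexify w (x + l) = 1 := by
  simp only [complexify_apply, ← Complex.ofReal_tsum, hw.tsum_eq_one, Complex.ofReal_one]

end Complexify

section OrbitSums

variable {G H : Type*} [AddCommGroup G] [TopologicalSpace G]
  [AddCommGroup H] [TopologicalSpace H] (L : AddSubgroup (G × H))

theorem orbitSum_mk (g : C_c(G × H, ℂ)) (x : G × H) :
    orbitSum L g (toTorus L x) = ∑' l : L, g (x + l) := rfl

theorem orbitSum_mulLift (w : C_c(G × H, ℂ)) (F : C((G × H) ⧸ L, ℂ)) (ξ : (G × H) ⧸ L) :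
    orbitSum L (mulLift L w F) ξ = orbitSum L w ξ * F ξ := by
  induction ξ using QuotientAddGroup.induction_on with
  | H y =>
    change ∑' l : L, w (y + l) * F (toTorus L (y + l)) = (∑' l : L, w (y + l)) * F (toTorus L y)
    simp only [toTorus_add_coe, tsum_mul_right]

variable [IsTopologicalAddGroup G] [IsTopologicalAddGroup H]

theorem orbitSum_shift (g : C_c(G × H, ℂ)) (x : G × H) (ξ : (G × H) ⧸ L) :
    orbitSum L (shift x g) ξ = orbitSum L g (ξ + toTorus L x) := by
  induction ξ using QuotientAddGroup.induction_on with
  | H y =>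
    change ∑' l : L, g (y + l + x) = ∑' l : L, g (y + x + l)
    exact tsum_congr fun l => by rw [add_right_comm]

variable [T2Space G] [T2Space H] [DiscreteTopology L] [LocallyCompactSpace G]
  [LocallyCompactSpace H]

theorem continuous_uncurry_orbitSum {P : Type*} [TopologicalSpace P] {g : P → C_c(G × H, ℂ)}
    (hg : Continuous fun q : P × (G × H) => g q.1 q.2) {C : Set (G × H)} (hC : IsCompact C)
    (hgC : ∀ p x, x ∉ C → g p x = 0) :
    Continuous fun q : P × ((G × H) ⧸ L) => orbitSum L (g q.1) q.2 := by
  have hq : IsOpenQuotientMap (Prod.map (id : P → P) (toTorus L)) :=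
    IsOpenQuotientMap.id.prodMap QuotientAddGroup.isOpenQuotientMap_mk
  rw [← hq.continuous_comp_iff]
  exact continuous_tsum_lattice_translates L (g := fun p x => g p x) hg hC hgC

theorem continuous_orbitSum (g : C_c(G × H, ℂ)) : Continuous (orbitSum L g) :=
  (continuous_uncurry_orbitSum L (P := Unit) (g := fun _ => g) (by fun_prop) g.hasCompactSupport
    fun _ _ => image_eq_zero_of_notMem_tsupport).comp (Continuous.prodMk_right ())

/-- The orbit sum of `g ∈ C_c(G × H)` as an element of `C((G × H) / L)`. -/
def orbitSumMap (g : C_c(G × H, ℂ)) : C((G × H) ⧸ L, ℂ) :=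
  ⟨orbitSum L g, continuous_orbitSum L g⟩

theorem mulLift_orbitSumMap (w g : C_c(G × H, ℂ)) :
    mulLift L w (orbitSumMap L g) = ∑ l ∈ overlap L w g, w * shift (l : G × H) g := by
  ext x
  rw [mulLift_apply, CompactlySupportedContinuousMap.sum_apply]
  change w x * ∑' l : L, g (x + l) = ∑ l ∈ overlap L w g, w x * g (x + l)
  rw [← tsum_mul_left]
  exact tsum_eq_sum fun l hl => mul_apply_add_eq_zero_of_notMem_overlap L hl x

omit [LocallyCompactSpace G] [LocallyCompactSpace H] in
theorem eq_sum_shift_neg_mul {w : C_c(G × H, ℂ)} (hw : ∀ x, ∑' l : L, w (x + l) = 1)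
    (g : C_c(G × H, ℂ)) : g = ∑ l ∈ overlap L w g, shift (-(l : G × H)) w * g := by
  ext x
  have hzero : ∀ l ∉ overlap L w g, w (x + -(l : G × H)) * g x = 0 := fun l hl => by
    simpa using mul_apply_add_eq_zero_of_notMem_overlap L hl (x + -(l : G × H))
  rw [CompactlySupportedContinuousMap.sum_apply]
  calc g x = (∑' l : L, w (x + l)) * g x := by rw [hw, one_mul]
    _ = (∑' l : L, w (x + -(l : G × H))) * g x :=
        congrArg (· * g x) ((Equiv.neg L).tsum_eq fun l : L => w (x + l)).symm
    _ = ∑ l ∈ overlap L w g, w (x + -(l : G × H)) * g x := by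
        rw [← tsum_mul_right, tsum_eq_sum hzero]

/-- Unfolding: both sides are finite sums over `L`, and translating the summand for `l` by `-l`
takes one to the other. -/
theorem map_mulLift_orbitSumMap (J : C_c(G × H, ℂ) →ₗ[ℂ] ℂ)
    (hJ : ∀ l ∈ L, ∀ g, J (shift l g) = J g) {w : C_c(G × H, ℂ)}
    (hw : ∀ x, ∑' l : L, w (x + l) = 1) (g : C_c(G × H, ℂ)) :
    J (mulLift L w (orbitSumMap L g)) = J g := by
  have hshift : ∀ l : L, shift (-(l : G × H)) (w * shift (l : G × H) g) =
      shift (-(l : G × H)) w * g := fun l => by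
    ext x
    change w (x + -(l : G × H)) * g (x + -(l : G × H) + l) = w (x + -(l : G × H)) * g x
    rw [neg_add_cancel_right]
  calc J (mulLift L w (orbitSumMap L g))
      = ∑ l ∈ overlap L w g, J (w * shift (l : G × H) g) := by rw [mulLift_orbitSumMap, map_sum]
    _ = ∑ l ∈ overlap L w g, J (shift (-(l : G × H)) w * g) :=
        Finset.sum_congr rfl fun l _ => by rw [← hshift, hJ _ (neg_mem l.2)]
    _ = J g := by rw [← map_sum, ← eq_sum_shift_neg_mul L hw]

theorem exists_isDisintegration [CompactSpace ((G × H) ⧸ L)] {ρ : ComplexRadonMeasure (G × H)}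
    (hρ : IsInvariantUnder L ρ) :
    ∃ ρT : ComplexRadonMeasure ((G × H) ⧸ L), IsDisintegration L ρ ρT := by
  obtain ⟨w, hw⟩ := exists_isBruhatFunction L
  obtain ⟨τ, hτ⟩ := ρ.exists_pushforward (continuous_toTorus L) (map_continuous w)
    w.hasCompactSupport hw.nonneg
  exact ⟨τ, fun g => (map_mulLift_orbitSumMap L ρ.toLinearMap hρ hw.tsum_complexify_eq_one g).symm
    |>.trans (hτ (orbitSumMap L g)).symm⟩

end OrbitSums

section RieszRepresentation

/-- The representing measure of `F ↦ ∫ W · (F ∘ π) dμ`. Here `π` need not be measurable: in the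
application `X` is a product, whose product `σ`-algebra may be smaller than its Borel one. -/
theorem exists_regular_integral_eq_integral_mul_comp {X T : Type*} [MeasurableSpace X]
    (μ : Measure X) [TopologicalSpace T] [CompactSpace T] [T2Space T] [MeasurableSpace T]
    [BorelSpace T] {π : X → T} {W : X → ℝ} (hW : ∀ x, 0 ≤ W x)
    (hint : ∀ F : C(T, ℝ), Integrable (fun x => W x * F (π x)) μ) :
    ∃ m : Measure T, m.Regular ∧ ∀ F : C(T, ℂ), ∫ ξ, F ξ ∂m = ∫ x, W x * F (π x) ∂μ := by
  let Λ : C_c(T, ℝ) →ₚ[ℝ] ℝ := PositiveLinearMap.mk₀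
    { toFun := fun F => ∫ x, W x * F (π x) ∂μ
      map_add' := fun F F' => by
        simp only [CompactlySupportedContinuousMap.add_apply, mul_add]
        exact integral_add (hint F) (hint F')
      map_smul' := fun c F => by
        rw [RingHom.id_apply, smul_eq_mul, ← integral_const_mul]
        simp only [CompactlySupportedContinuousMap.smul_apply, smul_eq_mul, mul_left_comm] }
    fun F hF => integral_nonneg fun x => mul_nonneg (hW x) (hF _)
  let m : Measure T := RealRMK.rieszMeasure Λ
  have hm : ∀ F : C(T, ℝ), ∫ ξ, F ξ ∂m = ∫ x, W x * F (π x) ∂μ := fun F =>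
    RealRMK.integral_rieszMeasure Λ ⟨F, HasCompactSupport.of_compactSpace _⟩
  have hreg : m.Regular := RealRMK.regular_rieszMeasure Λ
  refine ⟨m, hreg, fun F => ?_⟩
  let Fre : C(T, ℝ) := ⟨fun ξ => (F ξ).re, by fun_prop⟩
  let Fim : C(T, ℝ) := ⟨fun ξ => (F ξ).im, by fun_prop⟩
  have hF : Integrable F m :=
    F.continuous.integrable_of_hasCompactSupport (HasCompactSupport.of_compactSpace _)
  calc ∫ ξ, F ξ ∂m
      = (∫ ξ, Fre ξ ∂m : ℝ) + (∫ ξ, Fim ξ ∂m : ℝ) *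
          Complex.I := (integral_re_add_im hF).symm
    _ = ∫ x, (W x * Fre (π x) : ℝ) + (W x * Fim (π x) : ℝ) * Complex.I ∂μ := by
        rw [hm, hm, integral_add (hint Fre).ofReal ((hint Fim).ofReal.mul_const _),
          integral_mul_const, integral_complex_ofReal, integral_complex_ofReal]
    _ = ∫ x, W x * F (π x) ∂μ := integral_congr_ae <| ae_of_all _ fun x => by
        apply Complex.ext <;> simp [Fre, Fim]

end RieszRepresentation

section ProductMeasures

theorem integrable_prod_of_hasCompactSupport {X Y E : Type*} [TopologicalSpace X]
    [TopologicalSpace Y] [MeasurableSpace X] [MeasurableSpace Y] [OpensMeasurableSpace X]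
    [OpensMeasurableSpace Y] [NormedAddCommGroup E] (μ : Measure X) [SFinite μ]
    [IsFiniteMeasureOnCompacts μ] (ν : Measure Y) [SFinite ν] [IsFiniteMeasureOnCompacts ν]
    {g : X × Y → E} (hg : Continuous g) (hgc : HasCompactSupport g) :
    Integrable g (μ.prod ν) := by
  obtain ⟨M, hM⟩ := hg.bounded_above_of_compact_support hgc
  have hK : IsCompact (tsupport g) := hgc
  have hfin : (μ.prod ν) ((Prod.fst '' tsupport g) ×ˢ (Prod.snd '' tsupport g)) ≠ ∞ := by
    rw [Measure.prod_prod]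
    exact ENNReal.mul_ne_top (hK.image continuous_fst).measure_ne_top
      (hK.image continuous_snd).measure_ne_top
  refine (integrableOn_iff_integrable_of_support_subset fun x hx => ?_).1 <|
    Measure.integrableOn_of_bounded hfin
      (hgc.stronglyMeasurable_of_prod hg).aestronglyMeasurable (ae_of_all _ hM)
  exact ⟨⟨x, subset_tsupport _ hx, rfl⟩, ⟨x, subset_tsupport _ hx, rfl⟩⟩

theorem measure_prod_pos_of_isOpen {X Y : Type*} [TopologicalSpace X] [TopologicalSpace Y]
    [MeasurableSpace X] [MeasurableSpace Y] (μ : Measure X) [μ.IsOpenPosMeasure] (ν : Measure Y)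
    [SFinite ν] [ν.IsOpenPosMeasure] {U : Set (X × Y)} (hU : IsOpen U) (hne : U.Nonempty) :
    0 < (μ.prod ν) U := by
  obtain ⟨x, hx⟩ := hne
  obtain ⟨V, W, hV, hxV, hW, hxW, hVW⟩ := mem_nhds_prod_iff'.1 (hU.mem_nhds hx)
  refine lt_of_lt_of_le ?_ (measure_mono hVW)
  rw [Measure.prod_prod]
  exact ENNReal.mul_pos (hV.measure_pos μ ⟨_, hxV⟩).ne' (hW.measure_pos ν ⟨_, hxW⟩).ne'

instance {G H : Type*} [AddCommGroup G] [AddCommGroup H] [MeasurableSpace G] [MeasurableSpace H]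
    [MeasurableAdd G] [MeasurableAdd H] : MeasurableAdd (G × H) where
  measurable_const_add c :=
    ((measurable_const_add c.1).comp measurable_fst).prodMk
      ((measurable_const_add c.2).comp measurable_snd)
  measurable_add_const c :=
    ((measurable_add_const c.1).comp measurable_fst).prodMk
      ((measurable_add_const c.2).comp measurable_snd)

end ProductMeasures

section FundamentalCells

theorem countable_lattice {X : Type*} [AddCommGroup X] [TopologicalSpace X]
    [IsTopologicalAddGroup X] [T2Space X] [SigmaCompactSpace X] (L : AddSubgroup X)
    [DiscreteTopology L] : Countable L := by
  have hL : IsClosed (L : Set X) := AddSubgroup.isClosed_of_discrete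
  have : SigmaCompactSpace L := hL.isClosedEmbedding_subtypeVal.sigmaCompactSpace
  exact countable_of_Lindelof_of_discrete

variable {G H : Type*} [AddCommGroup G] [MeasurableSpace G] [AddCommGroup H] [MeasurableSpace H]
  {L : AddSubgroup (G × H)} {Z : Set (G × H)}

theorem IsFundamentalCell.isAddFundamentalDomain (μ : Measure (G × H))
    (hZ : IsFundamentalCell L Z) : IsAddFundamentalDomain L Z μ where
  nullMeasurableSet := hZ.measurableSet.nullMeasurableSet
  ae_covers := ae_of_all _ fun x => by
    obtain ⟨z, hz, hzx⟩ := hZ.bijOn.surjOn (Set.mem_univ (toTorus L x))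
    refine ⟨⟨-x + z, QuotientAddGroup.eq.1 hzx.symm⟩, ?_⟩
    change -x + z + x ∈ Z
    rwa [neg_add_cancel_comm]
  aedisjoint := fun a b hab => by
    refine Disjoint.aedisjoint (Set.disjoint_left.2 ?_)
    rintro _ ⟨x, hx, rfl⟩ ⟨y, hy, hyx⟩
    change (b : G × H) + y = a + x at hyx
    have hxy : x = y := hZ.bijOn.injOn hx hy <| calc
      toTorus L x = toTorus L (x + a) := (toTorus_add_coe L x a).symm
      _ = toTorus L (y + b) := by rw [add_comm x, ← hyx, add_comm y]
      _ = toTorus L y := toTorus_add_coe L y b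
    subst hxy
    exact hab (Subtype.ext (add_right_cancel hyx).symm)

variable [TopologicalSpace G] [IsTopologicalAddGroup G] [T2Space G] [SigmaCompactSpace G]
  [BorelSpace G] [TopologicalSpace H] [IsTopologicalAddGroup H] [T2Space H] [SigmaCompactSpace H]
  [BorelSpace H] [DiscreteTopology L]

theorem IsBruhatFunction.integral_eq (hZ : IsFundamentalCell L Z) (μ : Measure (G × H))
    [μ.IsAddLeftInvariant] {w : C_c(G × H, ℝ)} (hw : IsBruhatFunction L w) :
    ∫ x, w x ∂μ = μ.real Z := by
  have := countable_lattice L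
  have hwm : Measurable w := w.hasCompactSupport.measurable_of_prod (map_continuous w)
  have hwl : ∀ l : L, Measurable fun x : G × H => ENNReal.ofReal (w (l +ᵥ x)) := fun l =>
    (hwm.comp (measurable_const_vadd l)).ennreal_ofReal
  have hsum : ∀ x : G × H, ∑' l : L, ENNReal.ofReal (w (l +ᵥ x)) = 1 := fun x => by
    rw [← ENNReal.ofReal_one, ← hw.tsum_eq_one x, ENNReal.ofReal_tsum_of_nonneg
      (fun l => hw.nonneg _) (summable_lattice_translates L w.hasCompactSupport x)]
    exact tsum_congr fun l => by rw [AddSubgroup.vadd_def, vadd_eq_add, add_comm]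
  rw [integral_eq_lintegral_of_nonneg_ae (ae_of_all _ hw.nonneg) hwm.aestronglyMeasurable,
    Measure.real, (hZ.isAddFundamentalDomain μ).lintegral_eq_tsum'',
    ← lintegral_tsum fun l => (hwl l).aemeasurable]
  simp only [hsum, lintegral_one, Measure.restrict_apply_univ]

variable [LocallyCompactSpace G] [LocallyCompactSpace H] [CompactSpace ((G × H) ⧸ L)]

theorem IsFundamentalCell.measureReal_pos (hZ : IsFundamentalCell L Z) (mG : Measure G)
    [mG.IsAddHaarMeasure] (mH : Measure H) [mH.IsAddHaarMeasure] : 0 < (mG.prod mH).real Z := by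
  obtain ⟨w, hw⟩ := exists_isBruhatFunction L
  rw [← hw.integral_eq hZ (mG.prod mH), integral_pos_iff_support_of_nonneg hw.nonneg
    (integrable_prod_of_hasCompactSupport mG mH (map_continuous w) w.hasCompactSupport)]
  refine measure_prod_pos_of_isOpen mG mH (map_continuous w).isOpen_support ?_
  by_contra! h
  simpa [Function.support_eq_empty_iff.1 h] using hw.tsum_eq_one 0

end FundamentalCells

section HaarTorus

variable {G H : Type*} [AddCommGroup G] [TopologicalSpace G] [IsTopologicalAddGroup G]
  [SigmaCompactSpace G] [MeasurableSpace G] [BorelSpace G]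
  [AddCommGroup H] [TopologicalSpace H] [IsTopologicalAddGroup H]
  [SigmaCompactSpace H] [MeasurableSpace H] [BorelSpace H]
  (mG : Measure G) [mG.IsAddHaarMeasure] (mH : Measure H) [mH.IsAddHaarMeasure]

/-- Integration over `G × H` as a functional on `C_c(G × H)`. -/
def haarFunctional : C_c(G × H, ℂ) →ₗ[ℂ] ℂ where
  toFun g := ∫ x, g x ∂mG.prod mH
  map_add' g g' := integral_add
    (integrable_prod_of_hasCompactSupport mG mH (map_continuous g) g.hasCompactSupport)
    (integrable_prod_of_hasCompactSupport mG mH (map_continuous g') g'.hasCompactSupport)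
  map_smul' c _ := integral_smul c _

theorem haarFunctional_shift (x : G × H) (g : C_c(G × H, ℂ)) :
    haarFunctional mG mH (shift x g) = haarFunctional mG mH g :=
  integral_add_right_eq_self (μ := mG.prod mH) g x

variable (L : AddSubgroup (G × H))

/-- `m` is the normalized Haar measure on the torus `(G × H) / L`, and `v` is the volume of a
fundamental cell. -/
structure IsTorusHaar (v : ℝ) (m : @Measure ((G × H) ⧸ L) (borel _)) : Prop where
  isProbabilityMeasure : @IsProbabilityMeasure _ (borel _) m
  regular : @Measure.Regular _ (borel _) _ m
  integral_orbitSum : ∀ g : C_c(G × H, ℂ),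
    ∫ ξ, orbitSum L g ξ ∂m = (v : ℂ)⁻¹ * ∫ x, g x ∂mG.prod mH
  integral_add_right : ∀ (F : C((G × H) ⧸ L, ℂ)) (η : (G × H) ⧸ L),
    ∫ ξ, F (ξ + η) ∂m = ∫ ξ, F ξ ∂m

theorem integral_add_right_of_integral_orbitSum {m : @Measure ((G × H) ⧸ L) (borel _)} {c : ℂ}
    (hm : ∀ g, ∫ ξ, orbitSum L g ξ ∂m = c * haarFunctional mG mH g) {w : C_c(G × H, ℝ)}
    (hw : IsBruhatFunction L w) (F : C((G × H) ⧸ L, ℂ)) (η : (G × H) ⧸ L) :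
    ∫ ξ, F (ξ + η) ∂m = ∫ ξ, F ξ ∂m := by
  obtain ⟨x, rfl⟩ := QuotientAddGroup.mk_surjective η
  have hF : ∀ ξ, orbitSum L (mulLift L (complexify w) F) ξ = F ξ := fun ξ => by
    obtain ⟨y, rfl⟩ := QuotientAddGroup.mk_surjective ξ
    rw [orbitSum_mulLift, orbitSum_mk, hw.tsum_complexify_eq_one, one_mul]
  calc ∫ ξ, F (ξ + toTorus L x) ∂m
      = ∫ ξ, orbitSum L (shift x (mulLift L (complexify w) F)) ξ ∂m := by
        simp only [orbitSum_shift, hF]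
    _ = ∫ ξ, orbitSum L (mulLift L (complexify w) F) ξ ∂m := by
        rw [hm, hm, haarFunctional_shift]
    _ = ∫ ξ, F ξ ∂m := by simp only [hF]

variable {L} [T2Space G] [LocallyCompactSpace G] [T2Space H] [LocallyCompactSpace H]
  [DiscreteTopology L] [CompactSpace ((G × H) ⧸ L)]

theorem IsFundamentalCell.exists_isTorusHaar {Z : Set (G × H)}
    (hZ : IsFundamentalCell L Z) : ∃ m, IsTorusHaar mG mH L ((mG.prod mH).real Z) m := by
  let _ : MeasurableSpace ((G × H) ⧸ L) := borel _
  have : BorelSpace ((G × H) ⧸ L) := ⟨rfl⟩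
  have hL : IsClosed (L : Set (G × H)) := AddSubgroup.isClosed_of_discrete
  obtain ⟨w, hw⟩ := exists_isBruhatFunction L
  set v := (mG.prod mH).real Z
  have hv : 0 < v := hZ.measureReal_pos mG mH
  obtain ⟨m, hreg, hm⟩ := exists_regular_integral_eq_integral_mul_comp (mG.prod mH)
    (π := toTorus L) (W := fun x => v⁻¹ * w x) (fun x => mul_nonneg (inv_nonneg.2 hv.le)
      (hw.nonneg x)) fun F => integrable_prod_of_hasCompactSupport mG mH
        (((map_continuous w).const_mul _).mul (F.continuous.comp (continuous_toTorus L)))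
        w.hasCompactSupport.mul_left.mul_right
  have hmLift : ∀ F : C((G × H) ⧸ L, ℂ),
      ∫ ξ, F ξ ∂m = (v : ℂ)⁻¹ * haarFunctional mG mH (mulLift L (complexify w) F) := fun F => by
    refine (hm F).trans (Eq.trans ?_ (integral_const_mul _ _))
    simp only [Complex.ofReal_mul, Complex.ofReal_inv, mul_assoc]
    rfl
  have hmOrbit : ∀ g : C_c(G × H, ℂ),
      ∫ ξ, orbitSum L g ξ ∂m = (v : ℂ)⁻¹ * haarFunctional mG mH g := fun g => by
    rw [← map_mulLift_orbitSumMap L (haarFunctional mG mH)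
      (fun l _ g => haarFunctional_shift mG mH l g) hw.tsum_complexify_eq_one g]
    exact hmLift (orbitSumMap L g)
  have hmass : m.real Set.univ = 1 := by
    have h1 := hm 1
    simp only [ContinuousMap.one_apply, mul_one, integral_complex_ofReal, integral_const_mul,
      hw.integral_eq hZ (mG.prod mH)] at h1
    rw [inv_mul_cancel₀ hv.ne'] at h1
    simpa using h1
  exact ⟨m, isProbabilityMeasure_iff_real.2 hmass, hreg, hmOrbit,
    integral_add_right_of_integral_orbitSum mG mH L hmOrbit hw⟩

end HaarTorus

section Tensor

variable {X Y : Type*} [TopologicalSpace X] [TopologicalSpace Y]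

/-- The function `φ ⊗ f` on `X × Y`, `(x, y) ↦ φ(x) f(y)`. -/
def tensor (φ : C_c(X, ℂ)) (f : C_c(Y, ℂ)) : C_c(X × Y, ℂ) where
  toFun p := φ p.1 * f p.2
  continuous_toFun := by fun_prop
  hasCompactSupport' := by
    refine HasCompactSupport.intro' (φ.hasCompactSupport.isCompact.prod f.hasCompactSupport)
      ((isClosed_tsupport φ).prod (isClosed_tsupport f)) fun p hp => ?_
    by_contra h
    exact hp ⟨subset_tsupport _ (left_ne_zero_of_mul h), subset_tsupport _ (right_ne_zero_of_mul h)⟩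

@[simp]
theorem tensor_apply (φ : C_c(X, ℂ)) (f : C_c(Y, ℂ)) (p : X × Y) :
    tensor φ f p = φ p.1 * f p.2 := rfl

end Tensor

section SelfConvolution

theorem integral_tsum_of_eq_zero {ι α E : Type*} [MeasurableSpace α] {μ : Measure α}
    [NormedAddCommGroup E] [NormedSpace ℝ E] {F : ι → α → E} (s : Finset ι)
    (hF : ∀ i ∉ s, ∀ a, F i a = 0) (hint : ∀ i, Integrable (F i) μ) :
    ∫ a, ∑' i, F i a ∂μ = ∑' i, ∫ a, F i a ∂μ := by
  calc ∫ a, ∑' i, F i a ∂μ = ∫ a, ∑ i ∈ s, F i a ∂μ :=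
        integral_congr_ae <| ae_of_all _ fun a => tsum_eq_sum fun i hi => hF i hi a
    _ = ∑ i ∈ s, ∫ a, F i a ∂μ := integral_finsetSum s fun i _ => hint i
    _ = ∑' i, ∫ a, F i a ∂μ := (tsum_eq_sum fun i hi => by simp only [hF i hi, integral_zero]).symm

variable {H : Type*} [AddCommGroup H] [TopologicalSpace H] [IsTopologicalAddGroup H]
  [MeasurableSpace H] [BorelSpace H] (mH : Measure H)

theorem selfConv_eq_integral_add [mH.IsAddRightInvariant] (f : H → ℂ) (h : H) :
    selfConv mH f h = ∫ k, f (k + h) * (starRingEnd ℂ) (f k) ∂mH := by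
  unfold selfConv MeasureTheory.convolution
  rw [← integral_add_right_eq_self _ h]
  simp [tildeFun]

variable [T2Space H] [LocallyCompactSpace H] [mH.IsAddHaarMeasure]

/-- `f ∗ f̃` as an element of `C_c(H)`, for `f ∈ C_c(H)`. -/
def autoConv (f : C_c(H, ℂ)) : C_c(H, ℂ) where
  toFun := selfConv mH f
  continuous_toFun := (reflectConj f).hasCompactSupport.continuous_convolution_right _
    ((map_continuous f).locallyIntegrable (μ := mH)) (map_continuous (reflectConj f))
  hasCompactSupport' := f.hasCompactSupport.convolution _ (reflectConj f).hasCompactSupport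

theorem autoConv_apply (f : C_c(H, ℂ)) (h : H) : autoConv mH f h = selfConv mH f h := rfl

variable {G : Type*} [AddCommGroup G] [TopologicalSpace G] (L : AddSubgroup (G × H))

theorem gammaAt_eq_orbitSum (v : ℝ) (f : C_c(H, ℂ)) (ξ : (G × H) ⧸ L) (φ : C_c(G, ℂ)) :
    gammaAt L mH v f ξ φ = (v : ℂ)⁻¹ * orbitSum L (tensor φ (autoConv mH f)) ξ := by
  obtain ⟨z, rfl⟩ := QuotientAddGroup.mk_surjective ξ
  change (v : ℂ)⁻¹ * ∑' l : L, selfConv mH f (z.2 - l.1.2) * φ (z.1 - l.1.1) =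
    (v : ℂ)⁻¹ * ∑' l : L, φ (z.1 + l.1.1) * selfConv mH f (z.2 + l.1.2)
  rw [← (Equiv.neg L).tsum_eq]
  congr 1
  refine tsum_congr fun l => ?_
  simp [mul_comm]

variable [IsTopologicalAddGroup G] [T2Space G] [DiscreteTopology L]

theorem integral_orbitSum_tensor_mul_conj (φ : C_c(G, ℂ)) (f : C_c(H, ℂ)) (ξ : (G × H) ⧸ L) :
    ∫ k, orbitSum L (tensor φ f) (ξ + toTorus L (0, k)) * (starRingEnd ℂ) (f k) ∂mH =
      orbitSum L (tensor φ (autoConv mH f)) ξ := by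
  obtain ⟨z, rfl⟩ := QuotientAddGroup.mk_surjective ξ
  let F : L → H → ℂ := fun l k =>
    φ (z.1 + l.1.1) * (f (k + (z.2 + l.1.2)) * (starRingEnd ℂ) (f k))
  have hfin := finite_lattice_translates L
    (f.hasCompactSupport.isCompact.image (by fun_prop : Continuous fun k : H => z + ((0 : G), k)))
    (φ.hasCompactSupport.isCompact.prod f.hasCompactSupport)
  have hzero : ∀ l ∉ hfin.toFinset, ∀ k, F l k = 0 := fun l hl k => by
    by_contra h
    obtain ⟨hφ, hf, hfk⟩ : φ (z.1 + l.1.1) ≠ 0 ∧ f (k + (z.2 + l.1.2)) ≠ 0 ∧ f k ≠ 0 := by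
      simpa only [F, mul_ne_zero_iff, ne_eq, map_eq_zero] using h
    refine hl <| hfin.mem_toFinset.2 ⟨z + (0, k), ⟨k, subset_tsupport _ hfk, rfl⟩, ?_, ?_⟩
    · exact subset_tsupport _ (by simpa using hφ)
    · exact subset_tsupport _ (by simpa [add_assoc, add_left_comm] using hf)
  have hint : ∀ l, Integrable (F l) mH := fun l =>
    Continuous.integrable_of_hasCompactSupport (by fun_prop)
      (f.hasCompactSupport.comp_left (map_zero (starRingEnd ℂ))).mul_left.mul_left
  calc ∫ k, orbitSum L (tensor φ f) (toTorus L z + toTorus L (0, k)) * (starRingEnd ℂ) (f k) ∂mH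
      = ∫ k, ∑' l, F l k ∂mH := integral_congr_ae <| ae_of_all _ fun k => by
        change (∑' l : L, φ (z.1 + 0 + l.1.1) * f (z.2 + k + l.1.2)) * _ = _
        simp only [F, ← tsum_mul_right, add_zero, mul_assoc, add_assoc, add_left_comm]
    _ = ∑' l, ∫ k, F l k ∂mH := integral_tsum_of_eq_zero hfin.toFinset hzero hint
    _ = ∑' l : L, tensor φ (autoConv mH f) (z + l) := tsum_congr fun l => by
        rw [integral_const_mul, tensor_apply, autoConv_apply, selfConv_eq_integral_add]
        rfl

end SelfConvolution

section Correlation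

variable {G H : Type*} [AddCommGroup G] [TopologicalSpace G] [AddCommGroup H] [TopologicalSpace H]
  [IsTopologicalAddGroup G] [IsTopologicalAddGroup H] (L : AddSubgroup (G × H))

theorem continuous_toTorus_snd_sub (η : (G × H) ⧸ L) :
    Continuous fun k : H => toTorus L ((0 : G), k) - η :=
  ((continuous_toTorus L).comp (by fun_prop)).sub continuous_const

variable (τ : ComplexRadonMeasure ((G × H) ⧸ L))

/-- `∫ σ_{ξ + ζ}(φ ⊗ f) dτ(ξ)`, the value at `φ` of the measure on `G` with weight `f`
belonging to the point `ζ` of the torus. -/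
def torusValue (φ : C_c(G, ℂ)) (f : C_c(H, ℂ)) (ζ : (G × H) ⧸ L) : ℂ :=
  τ.integral fun ξ => orbitSum L (tensor φ f) (ξ + ζ)

variable [T2Space G] [LocallyCompactSpace G] [T2Space H] [LocallyCompactSpace H]
  [DiscreteTopology L] [CompactSpace ((G × H) ⧸ L)]

theorem continuous_torusValue (φ : C_c(G, ℂ)) (f : C_c(H, ℂ)) :
    Continuous (torusValue L τ φ f) :=
  τ.continuous_integral (F := fun ζ ξ => orbitSum L (tensor φ f) (ξ + ζ))
    ((continuous_orbitSum L _).comp (continuous_snd.add continuous_fst))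

/-- The counterpart of `innerCorrelation` for the measure on `G` belonging to `ζ`:
`s ↦ conj (b(ζ - [s, 0]) ψ(-s))` with `b = torusValue φ f`. -/
def torusInnerCorrelation (φ ψ : C_c(G, ℂ)) (f : C_c(H, ℂ)) (ζ : (G × H) ⧸ L) : C_c(G, ℂ) where
  toFun s := (starRingEnd ℂ) (torusValue L τ φ f (ζ - toTorus L (s, 0))) * reflectConj ψ s
  continuous_toFun := by
    refine Continuous.mul (Complex.continuous_conj.comp ?_) (map_continuous _)
    refine (continuous_torusValue L τ φ f).comp (continuous_const.sub ?_)
    exact (continuous_toTorus L).comp (by fun_prop)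
  hasCompactSupport' := (reflectConj ψ).hasCompactSupport.mul_left

theorem torusInnerCorrelation_apply (φ ψ : C_c(G, ℂ)) (f : C_c(H, ℂ)) (ζ : (G × H) ⧸ L) (s : G) :
    torusInnerCorrelation L τ φ ψ f ζ s =
      (starRingEnd ℂ) (torusValue L τ φ f (ζ - toTorus L (s, 0))) * reflectConj ψ s := rfl

/-- The counterpart of `correlation`: the double integral `∫∫ φ(s + t) ψ(t) dω(s) dω̃(t)` for the
measure `ω = torusValue · f ζ` on `G`. -/
def torusCorrelation (φ ψ : C_c(G, ℂ)) (f : C_c(H, ℂ)) (ζ : (G × H) ⧸ L) : ℂ :=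
  (starRingEnd ℂ) (torusValue L τ (torusInnerCorrelation L τ φ ψ f ζ) f ζ)

theorem continuous_orbitSum_torusInnerCorrelation (φ ψ : C_c(G, ℂ)) (f : C_c(H, ℂ)) :
    Continuous fun q : ((G × H) ⧸ L) × ((G × H) ⧸ L) =>
      orbitSum L (tensor (torusInnerCorrelation L τ φ ψ f q.1) f) (q.2 + q.1) := by
  refine (continuous_uncurry_orbitSum L
    (g := fun ζ => tensor (torusInnerCorrelation L τ φ ψ f ζ) f) ?_
    ((reflectConj ψ).hasCompactSupport.isCompact.prod f.hasCompactSupport) fun ζ x hx => ?_).comp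
      (continuous_fst.prodMk (continuous_snd.add continuous_fst))
  · simp only [tensor_apply, torusInnerCorrelation_apply]
    have hsub : Continuous fun q : ((G × H) ⧸ L) × (G × H) => q.1 - toTorus L (q.2.1, 0) :=
      continuous_fst.sub ((continuous_toTorus L).comp (by fun_prop))
    exact ((Complex.continuous_conj.comp ((continuous_torusValue L τ φ f).comp hsub)).mul
      (by fun_prop)).mul (by fun_prop)
  · rw [tensor_apply, torusInnerCorrelation_apply]
    by_contra h
    exact hx ⟨subset_tsupport _ (right_ne_zero_of_mul (left_ne_zero_of_mul h)),
      subset_tsupport _ (right_ne_zero_of_mul h)⟩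

theorem continuous_torusCorrelation (φ ψ : C_c(G, ℂ)) (f : C_c(H, ℂ)) :
    Continuous (torusCorrelation L τ φ ψ f) :=
  Complex.continuous_conj.comp
    (τ.continuous_integral (continuous_orbitSum_torusInnerCorrelation L τ φ ψ f))

/-- The function `k ↦ conj (b([0, k] - η)) f(k)` with `b = torusValue φ f`: it absorbs the inner
integral of a correlation into the weight, see `orbitSum_torusInnerCorrelation_sub`. -/
def torusWeight (φ : C_c(G, ℂ)) (f : C_c(H, ℂ)) (η : (G × H) ⧸ L) : C_c(H, ℂ) where
  toFun k := (starRingEnd ℂ) (torusValue L τ φ f (toTorus L (0, k) - η)) * f k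
  continuous_toFun := (Complex.continuous_conj.comp
    ((continuous_torusValue L τ φ f).comp (continuous_toTorus_snd_sub L η))).mul (map_continuous f)
  hasCompactSupport' := f.hasCompactSupport.mul_left

theorem torusWeight_apply (φ : C_c(G, ℂ)) (f : C_c(H, ℂ)) (η : (G × H) ⧸ L) (k : H) :
    torusWeight L τ φ f η k =
      (starRingEnd ℂ) (torusValue L τ φ f (toTorus L (0, k) - η)) * f k := rfl

/-- `[p + l] - [s, 0] = [0, k]` at `p + l = (s, k)`: the value `b` enters `σ_θ` only through its
restriction to the classes `[0, k]`. -/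
theorem orbitSum_torusInnerCorrelation_sub (φ ψ : C_c(G, ℂ)) (f : C_c(H, ℂ))
    (η θ : (G × H) ⧸ L) :
    orbitSum L (tensor (torusInnerCorrelation L τ φ ψ f (θ - η)) f) θ =
      orbitSum L (tensor (reflectConj ψ) (torusWeight L τ φ f η)) θ := by
  obtain ⟨p, rfl⟩ := QuotientAddGroup.mk_surjective θ
  change ∑' l : L, torusInnerCorrelation L τ φ ψ f (toTorus L p - η) (p.1 + l.1.1) *
      f (p.2 + l.1.2) =
    ∑' l : L, reflectConj ψ (p.1 + l.1.1) * torusWeight L τ φ f η (p.2 + l.1.2)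
  refine tsum_congr fun l => ?_
  have hclass : toTorus L p - toTorus L (p.1 + l.1.1, 0) = toTorus L (0, p.2 + l.1.2) := by
    refine (QuotientAddGroup.eq (s := L) (a := p - (p.1 + l.1.1, 0))).2 ?_
    convert l.2 using 1
    ext <;> simp
  rw [torusInnerCorrelation_apply, torusWeight_apply, sub_right_comm, hclass]
  ring

theorem integral_torusWeight [MeasurableSpace H] [BorelSpace H] (mH : Measure H)
    [mH.IsAddHaarMeasure] (φ : C_c(G, ℂ)) (f : C_c(H, ℂ)) (η : (G × H) ⧸ L) :
    ∫ k, torusWeight L τ φ f η k ∂mH =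
      (starRingEnd ℂ)
        (τ.integral fun ξ => orbitSum L (tensor φ (autoConv mH f)) (ξ - η)) := by
  let F : H → (G × H) ⧸ L → ℂ := fun k ξ =>
    (starRingEnd ℂ) (f k) * orbitSum L (tensor φ f) (ξ + (toTorus L (0, k) - η))
  have hF : Continuous (Function.uncurry F) :=
    (Complex.continuous_conj.comp ((map_continuous f).comp continuous_fst)).mul <|
      (continuous_orbitSum L _).comp
        (continuous_snd.add ((continuous_toTorus_snd_sub L η).comp continuous_fst))
  have hconv : ∀ ξ, orbitSum L (tensor φ (autoConv mH f)) (ξ - η) = ∫ k, F k ξ ∂mH := fun ξ => by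
    simp only [F, ← integral_orbitSum_tensor_mul_conj, ← sub_add_eq_add_sub, add_sub_assoc',
      mul_comm]
  have hinner : ∀ k, τ.integral (F k) = (starRingEnd ℂ) (torusWeight L τ φ f η k) := fun k => by
    rw [torusWeight_apply, map_mul, Complex.conj_conj, mul_comm]
    exact τ.integral_const_mul _ _
  rw [← Complex.conj_conj (∫ k, torusWeight L τ φ f η k ∂mH), ← integral_conj]
  simp only [hconv, ← hinner]
  rw [τ.integral_integral_swap mH hF f.hasCompactSupport fun k hk ξ => by
    simp only [F, image_eq_zero_of_notMem_tsupport hk, map_zero, zero_mul]]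

variable [MeasurableSpace G] [BorelSpace G] (mG : Measure G) [mG.IsAddHaarMeasure] [mG.Regular]
  [MeasurableSpace H] (mH : Measure H) [mH.IsAddHaarMeasure] [SigmaCompactSpace G]
  [SigmaCompactSpace H]

theorem integral_orbitSum_torusInnerCorrelation {v : ℝ} {m : @Measure ((G × H) ⧸ L) (borel _)}
    (hm : IsTorusHaar mG mH L v m) (φ ψ : C_c(G, ℂ)) (hψ : ∫ t, ψ t ∂mG = 1) (f : C_c(H, ℂ))
    (η : (G × H) ⧸ L) :
    ∫ ζ, orbitSum L (tensor (torusInnerCorrelation L τ φ ψ f ζ) f) (η + ζ) ∂m =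
      (v : ℂ)⁻¹ * ∫ k, torusWeight L τ φ f η k ∂mH := by
  let Ψ : C((G × H) ⧸ L, ℂ) := orbitSumMap L (tensor (reflectConj ψ) (torusWeight L τ φ f η))
  have hΨ : ∀ ζ, orbitSum L (tensor (torusInnerCorrelation L τ φ ψ f ζ) f) (η + ζ) = Ψ (ζ + η) :=
    fun ζ => by
      have := orbitSum_torusInnerCorrelation_sub L τ φ ψ f η (ζ + η)
      rw [add_sub_cancel_right] at this
      rwa [add_comm η ζ]
  have hone : ∫ t, reflectConj ψ t ∂mG = 1 := by
    simp only [reflectConj_apply]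
    rw [integral_conj, integral_neg_eq_self (fun t => ψ t) mG, hψ, map_one]
  simp only [hΨ]
  rw [hm.integral_add_right Ψ η]
  refine (hm.integral_orbitSum _).trans ?_
  simp only [tensor_apply]
  rw [integral_prod_mul, hone, one_mul]

variable [BorelSpace H]

theorem integral_torusCorrelation {v : ℝ} {m : @Measure ((G × H) ⧸ L) (borel _)}
    (hm : IsTorusHaar mG mH L v m) (φ ψ : C_c(G, ℂ)) (hψ : ∫ t, ψ t ∂mG = 1) (f : C_c(H, ℂ)) :
    ∫ ζ, torusCorrelation L τ φ ψ f ζ ∂m =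
      τ.conjIntegral fun η => τ.integral fun ξ => gammaAt L mH v f (ξ - η) φ := by
  let _ : MeasurableSpace ((G × H) ⧸ L) := borel _
  have : BorelSpace ((G × H) ⧸ L) := ⟨rfl⟩
  have := hm.isProbabilityMeasure
  have hL : IsClosed (L : Set (G × H)) := AddSubgroup.isClosed_of_discrete
  unfold torusCorrelation ComplexRadonMeasure.conjIntegral
  rw [integral_conj]
  congr 1
  refine (τ.integral_integral_swap m
    (F := fun ζ η => orbitSum L (tensor (torusInnerCorrelation L τ φ ψ f ζ) f) (η + ζ))
    (continuous_orbitSum_torusInnerCorrelation L τ φ ψ f) isCompact_univ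
    fun p hp => absurd (Set.mem_univ p) hp).trans ?_
  congr 1
  funext η
  rw [integral_orbitSum_torusInnerCorrelation L τ mG mH hm φ ψ hψ,
    integral_torusWeight]
  simp only [gammaAt_eq_orbitSum]
  rw [τ.integral_const_mul, map_mul, map_inv₀, Complex.conj_ofReal]

end Correlation

section RadonFunctionals

variable {X : Type*} [TopologicalSpace X]

theorem RadonFunctional.ext {ν ω : RadonFunctional X} (h : ∀ φ, ν φ = ω φ) : ν = ω := by
  cases ν
  cases ω
  congr 1
  exact LinearMap.ext h

instance : T2Space (RadonFunctional X) :=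
  T2Space.of_injective_continuous (f := fun (ν : RadonFunctional X) (φ : C_c(X, ℂ)) => ν φ)
    (fun _ _ h => RadonFunctional.ext (congrFun h)) continuous_induced_dom

theorem RadonFunctional.continuous_iff {P : Type*} [TopologicalSpace P]
    {β : P → RadonFunctional X} : Continuous β ↔ ∀ φ, Continuous fun p => β p φ :=
  continuous_induced_rng.trans continuous_pi_iff

end RadonFunctionals

section GroupFactors

variable {G T Y : Type*} [AddCommGroup T] [TopologicalSpace T] [TopologicalSpace Y]

/-- The maps `a t` on `Y` are a factor of the translations by the points `j t` of the group `T`,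
with factor map `b`; the points `j t` are dense in `T`. -/
structure IsGroupFactor (j : G → T) (a : G → Y → Y) (b : T → Y) : Prop where
  denseRange : DenseRange j
  continuous : Continuous b
  surjective : Function.Surjective b
  apply_add : ∀ ζ t, b (ζ + j t) = a t (b ζ)

variable {j : G → T} {a : G → Y → Y} {b : T → Y}

theorem IsGroupFactor.apply_add_congr [ContinuousAdd T] [T2Space Y] (hb : IsGroupFactor j a b)
    {ξ ξ' : T} (h : b ξ = b ξ') (η : T) : b (ξ + η) = b (ξ' + η) := by
  have : (fun η => b (ξ + η)) = fun η => b (ξ' + η) := hb.denseRange.equalizer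
    (hb.continuous.comp (by fun_prop)) (hb.continuous.comp (by fun_prop)) <| funext fun t => by
      simp only [Function.comp_apply, hb.apply_add, h]
  exact congrFun this η

theorem IsGroupFactor.regular_map [T2Space Y] [MeasurableSpace T] [BorelSpace T]
    [MeasurableSpace Y] [BorelSpace Y] {mT : Measure T} [IsProbabilityMeasure mT] [mT.Regular]
    (hb : IsGroupFactor j a b) : (mT.map b).Regular := by
  have := Measure.isProbabilityMeasure_map (μ := mT) hb.continuous.aemeasurable
  have : (mT.map b).InnerRegularCompactLTTop :=
    Measure.InnerRegularCompactLTTop.map_of_continuous hb.continuous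
  infer_instance

variable [ContinuousAdd T] [CompactSpace T] [T2Space Y]

/-- The action on a factor extends from `G` to all of `T`. The map is jointly continuous because a
continuous map from a compact space onto a Hausdorff space is a quotient map. -/
theorem IsGroupFactor.exists_continuous_action [T2Space T] (hb : IsGroupFactor j a b) :
    ∃ A : T → Y → Y, Continuous (Function.uncurry A) ∧ (∀ η ξ, A η (b ξ) = b (ξ + η)) ∧
      ∀ t, A (j t) = a t := by
  obtain ⟨s, hs⟩ := hb.surjective.hasRightInverse
  have hA : ∀ η ξ, b (s (b ξ) + η) = b (ξ + η) := fun η ξ => hb.apply_add_congr (hs (b ξ)) η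
  refine ⟨fun η y => b (s y + η), ?_, hA, fun t => funext fun y => ?_⟩
  · have hc : Continuous (Prod.map (id : T → T) b) := continuous_id.prodMap hb.continuous
    have : CompactSpace Y := hb.surjective.compactSpace hb.continuous
    have hq : Topology.IsQuotientMap (Prod.map (id : T → T) b) :=
      hc.isClosedMap.isQuotientMap hc (Function.surjective_id.prodMap hb.surjective)
    refine hq.continuous_iff.2 <| (hb.continuous.comp (continuous_snd.add continuous_fst)).congr ?_
    exact fun p => (hA p.1 p.2).symm
  · exact (hb.apply_add _ t).trans (congrArg (a t) (hs y))

variable [MeasurableSpace T] [BorelSpace T] {mT : Measure T} [MeasurableSpace Y] [BorelSpace Y]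

theorem IsGroupFactor.map_map_eq [mT.IsAddRightInvariant] (hb : IsGroupFactor j a b) (t : G) :
    (mT.map b).map (a t) = mT.map b := by
  have hq : Topology.IsQuotientMap b :=
    hb.continuous.isClosedMap.isQuotientMap hb.continuous hb.surjective
  have hcomm : a t ∘ b = b ∘ fun ζ => ζ + j t := funext fun ζ => (hb.apply_add ζ t).symm
  have hat : Continuous (a t) := hq.continuous_iff.2 <| by
    rw [hcomm]
    exact hb.continuous.comp (continuous_add_const (j t))
  rw [Measure.map_map hat.measurable hb.continuous.measurable, hcomm,
    ← Measure.map_map hb.continuous.measurable (measurable_add_const (j t)),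
    map_add_right_eq_self]

variable [T2Space T] [IsProbabilityMeasure mT] [mT.IsAddRightInvariant]

theorem IsGroupFactor.integral_eq_integral_comp (hb : IsGroupFactor j a b) {m : Measure Y}
    [IsProbabilityMeasure m] (hm : ∀ t, m.map (a t) = m) (F : C(Y, ℝ)) :
    ∫ y, F y ∂m = ∫ ζ, F (b ζ) ∂mT := by
  have : CompactSpace Y := hb.surjective.compactSpace hb.continuous
  obtain ⟨A, hA, hAb, hAj⟩ := hb.exists_continuous_action
  have hFA : Continuous (Function.uncurry fun η y => F (A η y)) := F.continuous.comp hA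
  have hconst : (fun η => ∫ y, F (A η y) ∂m) = fun _ => ∫ y, F y ∂m := by
    refine hb.denseRange.equalizer (continuousOn_univ.1 <| continuousOn_integral_of_compact_support
      isCompact_univ hFA.continuousOn fun _ y _ hy => absurd (Set.mem_univ y) hy)
      continuous_const <| funext fun t => ?_
    have hat : Continuous (a t) := hAj t ▸ hA.comp (Continuous.prodMk_right (j t))
    simp only [Function.comp_apply, hAj]
    rw [← integral_map hat.aemeasurable F.continuous.measurable.aestronglyMeasurable, hm t]
  have hinner : ∀ y, ∫ η, F (A η y) ∂mT = ∫ ζ, F (b ζ) ∂mT := fun y => by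
    obtain ⟨ξ, rfl⟩ := hb.surjective y
    simp only [hAb, add_comm ξ]
    exact integral_add_right_eq_self (fun ζ => F (b ζ)) ξ
  calc ∫ y, F y ∂m = ∫ η, ∫ y, F (A η y) ∂m ∂mT := by
        rw [hconst, integral_const, probReal_univ, one_smul]
    _ = ∫ y, ∫ η, F (A η y) ∂mT ∂m :=
        integral_integral_swap_of_hasCompactSupport hFA (HasCompactSupport.of_compactSpace _)
    _ = ∫ ζ, F (b ζ) ∂mT := by
        simp only [hinner, integral_const, probReal_univ, one_smul]

theorem IsGroupFactor.eq_map [mT.Regular] (hb : IsGroupFactor j a b) {m : Measure Y}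
    [IsProbabilityMeasure m] [m.Regular] (hm : ∀ t, m.map (a t) = m) : m = mT.map b := by
  have : CompactSpace Y := hb.surjective.compactSpace hb.continuous
  have := hb.regular_map (mT := mT)
  refine Measure.ext_of_integral_eq_on_compactlySupported fun F => ?_
  exact (hb.integral_eq_integral_comp (mT := mT) hm F.toContinuousMap).trans
    (integral_map hb.continuous.aemeasurable
      F.continuous.measurable.aestronglyMeasurable).symm

end GroupFactors

section UniqueErgodicity

variable {T : Type*} [AddCommGroup T] [TopologicalSpace T]

theorem isAddRightInvariant_of_integral_add_right [ContinuousAdd T] [T2Space T] [CompactSpace T]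
    [MeasurableSpace T] [BorelSpace T] {mT : Measure T} [mT.Regular]
    (hinv : ∀ (F : C(T, ℂ)) (η : T), ∫ ξ, F (ξ + η) ∂mT = ∫ ξ, F ξ ∂mT) :
    mT.IsAddRightInvariant where
  map_add_right_eq_self η := by
    have : (mT.map (Homeomorph.addRight η)).Regular := Measure.Regular.map _
    change mT.map (Homeomorph.addRight η) = mT
    refine Measure.ext_of_integral_eq_on_compactlySupported fun F => ?_
    rw [integral_map (Homeomorph.addRight η).continuous.aemeasurable
      (map_continuous F).measurable.aestronglyMeasurable]
    have h := hinv ⟨fun ξ => (F ξ : ℂ), by fun_prop⟩ η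
    simp only [ContinuousMap.coe_mk, integral_complex_ofReal] at h
    exact_mod_cast h

variable {G : Type*} [AddCommGroup G] [TopologicalSpace G] [IsTopologicalAddGroup G]
  {β : T → RadonFunctional G} {j : G → T}

theorem hull_eq_range [CompactSpace T] (hβ : Continuous β) (hj : DenseRange j)
    (hβj : ∀ ζ t, β (ζ + j t) = translate t (β ζ)) : hull (β 0) = Set.range β := by
  have horbit : (Set.range fun t => translate t (β 0)) = β '' Set.range j := by
    rw [← Set.range_comp]
    congr 1
    funext t
    rw [Function.comp_apply, ← hβj, zero_add]
  rw [hull, horbit]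
  apply subset_antisymm
  · exact closure_minimal (Set.image_subset_range _ _) (isCompact_range hβ).isClosed
  · rw [← Set.image_univ, ← hj.closure_range]
    exact image_closure_subset_closure_image hβ

theorem isGroupFactor_hull [CompactSpace T] (hβ : Continuous β) (hj : DenseRange j)
    (hβj : ∀ ζ t, β (ζ + j t) = translate t (β ζ)) :
    IsGroupFactor j (hullAction (β 0))
      fun ζ => ⟨β ζ, (hull_eq_range hβ hj hβj).superset ⟨ζ, rfl⟩⟩ where
  denseRange := hj
  continuous := continuous_induced_rng.2 hβ
  surjective := fun ω => by
    obtain ⟨ζ, hζ⟩ := (hull_eq_range hβ hj hβj).subset ω.2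
    exact ⟨ζ, Subtype.ext hζ⟩
  apply_add := fun ζ t => Subtype.ext (hβj ζ t)

theorem exists_unique_isInvariantProbability [ContinuousAdd T] [T2Space T] [CompactSpace T]
    [MeasurableSpace T] [BorelSpace T] (mT : Measure T) [IsProbabilityMeasure mT] [mT.Regular]
    [mT.IsAddRightInvariant] (hβ : Continuous β) (hj : DenseRange j)
    (hβj : ∀ ζ t, β (ζ + j t) = translate t (β ζ)) :
    ∃ m : @Measure (hull (β 0)) (borel _), IsInvariantProbability (β 0) m ∧
      (∀ m', IsInvariantProbability (β 0) m' → m' = m) ∧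
      ∀ F : RadonFunctional G → ℂ, Continuous (fun ζ => F (β ζ)) →
        ∫ ω, F ω.1 ∂m = ∫ ζ, F (β ζ) ∂mT := by
  let _ : MeasurableSpace (hull (β 0)) := borel _
  have : BorelSpace (hull (β 0)) := ⟨rfl⟩
  have hb := isGroupFactor_hull hβ hj hβj
  set b : T → hull (β 0) := fun ζ => ⟨β ζ, (hull_eq_range hβ hj hβj).superset ⟨ζ, rfl⟩⟩
  have hinv : IsInvariantProbability (β 0) (mT.map b) :=
    ⟨Measure.isProbabilityMeasure_map hb.continuous.aemeasurable, hb.regular_map, hb.map_map_eq⟩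
  refine ⟨mT.map b, hinv, fun m' hm' => ?_, fun F hF => ?_⟩
  · have := hm'.regular
    have := hm'.isProbabilityMeasure
    exact hb.eq_map hm'.invariant
  · have hq : Topology.IsQuotientMap b :=
      hb.continuous.isClosedMap.isQuotientMap hb.continuous hb.surjective
    have hFc : Continuous fun ω : hull (β 0) => F ω.1 := hq.continuous_iff.2 hF
    exact integral_map hb.continuous.aemeasurable hFc.measurable.aestronglyMeasurable

end UniqueErgodicity

section TotalVariation

variable {X Y : Type*} [TopologicalSpace X] [TopologicalSpace Y]

/-- The function `|g|` as a complex-valued function, so that `orbitSum` applies to it. -/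
def complexNorm (g : C_c(X, ℂ)) : C_c(X, ℂ) where
  toFun x := (‖g x‖ : ℂ)
  continuous_toFun := by fun_prop
  hasCompactSupport' := g.hasCompactSupport.comp_left (g := fun z : ℂ => (‖z‖ : ℂ)) (by simp)

@[simp]
theorem complexNorm_apply (g : C_c(X, ℂ)) (x : X) : complexNorm g x = (‖g x‖ : ℂ) := rfl

theorem complexNorm_tensor (φ : C_c(X, ℂ)) (f : C_c(Y, ℂ)) :
    complexNorm (tensor φ f) = tensor (complexNorm φ) (complexNorm f) := by
  ext x
  simp

theorem ComplexRadonMeasure.variation_eq_zero [T2Space X] [NormalSpace X] [LocallyCompactSpace X]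
    {ρ : ComplexRadonMeasure X} (hρ : ∀ g : C_c(X, ℂ), ρ.integral g = 0) : ρ.variation = 0 := by
  let _ : MeasurableSpace X := borel _
  have : BorelSpace X := ⟨rfl⟩
  have hnonpos : ∀ χ : C_c(X, ℝ), ∫ y, χ y ∂ρ.variation ≤ 0 := fun χ =>
    integral_le_of_forall_norm_integral_mul_le ρ.variation ρ.measurable_phase ρ.norm_phase
      χ.continuous χ.hasCompactSupport fun k _ =>
        ((congrArg norm (hρ (complexify χ * k))).trans norm_zero).le
  refine Measure.ext_of_integral_eq_on_compactlySupported fun χ => ?_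
  rw [integral_zero_measure]
  refine le_antisymm (hnonpos χ) ?_
  have := hnonpos (-χ)
  simp only [CompactlySupportedContinuousMap.coe_neg, Pi.neg_apply, integral_neg] at this
  linarith

variable {G H : Type*} [AddCommGroup G] [TopologicalSpace G] [AddCommGroup H] [TopologicalSpace H]

theorem IsDisintegration.variation_ne_zero [T2Space G] [T2Space H]
    [LocallyCompactSpace G] [LocallyCompactSpace H] [SigmaCompactSpace G] [SigmaCompactSpace H]
    {L : AddSubgroup (G × H)} {ρ : ComplexRadonMeasure (G × H)}
    {τ : ComplexRadonMeasure ((G × H) ⧸ L)} (hτ : IsDisintegration L ρ τ)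
    (hρ : ρ.variation ≠ 0) : τ.variation ≠ 0 := fun h0 =>
  hρ <| ComplexRadonMeasure.variation_eq_zero fun g => by
    rw [hτ g]
    unfold ComplexRadonMeasure.integral
    rw [h0, integral_zero_measure]

variable (L : AddSubgroup (G × H)) (τ : ComplexRadonMeasure ((G × H) ⧸ L))

/-- The sum `∑_{l ∈ L} |g(x + l)|` at the class of `x`. -/
def normSum (g : C_c(G × H, ℂ)) (ξ : (G × H) ⧸ L) : ℝ := (orbitSum L (complexNorm g) ξ).re

theorem normSum_mk (g : C_c(G × H, ℂ)) (x : G × H) :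
    normSum L g (toTorus L x) = ∑' l : L, ‖g (x + l)‖ := by
  unfold normSum
  rw [orbitSum_mk]
  simp only [complexNorm_apply]
  rw [← Complex.ofReal_tsum, Complex.ofReal_re]

theorem orbitSum_complexNorm (g : C_c(G × H, ℂ)) (ξ : (G × H) ⧸ L) :
    orbitSum L (complexNorm g) ξ = (normSum L g ξ : ℂ) := by
  obtain ⟨x, rfl⟩ := QuotientAddGroup.mk_surjective ξ
  rw [normSum_mk, orbitSum_mk, Complex.ofReal_tsum]
  rfl

theorem normSum_nonneg (g : C_c(G × H, ℂ)) (ξ : (G × H) ⧸ L) : 0 ≤ normSum L g ξ := by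
  obtain ⟨x, rfl⟩ := QuotientAddGroup.mk_surjective ξ
  rw [normSum_mk]
  exact tsum_nonneg fun l => norm_nonneg _

/-- The integral of `∑_{l ∈ L} |g(x + l)|` against `|τ|`, where `x` represents `ξ + ζ` and `ξ` is
the variable of integration. -/
def torusNorm (g : C_c(G × H, ℂ)) (ζ : (G × H) ⧸ L) : ℝ :=
  ∫ ξ, normSum L g (ξ + ζ) ∂τ.variation

theorem torusNorm_nonneg (g : C_c(G × H, ℂ)) (ζ : (G × H) ⧸ L) : 0 ≤ torusNorm L τ g ζ := by
  let _ : MeasurableSpace ((G × H) ⧸ L) := borel _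
  exact integral_nonneg fun _ => normSum_nonneg L g _

theorem abs_integral_orbitSum_complexNorm (g : C_c(G × H, ℂ)) (ζ : (G × H) ⧸ L) :
    τ.abs.integral (fun ξ => orbitSum L (complexNorm g) (ξ + ζ)) = (torusNorm L τ g ζ : ℂ) := by
  simp only [orbitSum_complexNorm]
  exact τ.abs_integral_ofReal _

variable [IsTopologicalAddGroup G] [IsTopologicalAddGroup H] [T2Space G] [T2Space H]
  [DiscreteTopology L]

theorem summable_norm_translates (g : C_c(G × H, ℂ)) (x : G × H) :
    Summable fun l : L => ‖g (x + l)‖ :=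
  summable_lattice_translates L g.hasCompactSupport.norm x

theorem norm_orbitSum_le (g : C_c(G × H, ℂ)) (ξ : (G × H) ⧸ L) :
    ‖orbitSum L g ξ‖ ≤ normSum L g ξ := by
  obtain ⟨x, rfl⟩ := QuotientAddGroup.mk_surjective ξ
  rw [normSum_mk, orbitSum_mk]
  exact norm_tsum_le_tsum_norm (summable_norm_translates L g x)

theorem normSum_le_mul {g g' : C_c(G × H, ℂ)} {c : ℝ} (h : ∀ x, ‖g x‖ ≤ c * ‖g' x‖)
    (ξ : (G × H) ⧸ L) : normSum L g ξ ≤ c * normSum L g' ξ := by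
  obtain ⟨x, rfl⟩ := QuotientAddGroup.mk_surjective ξ
  rw [normSum_mk, normSum_mk, ← tsum_mul_left]
  exact (summable_norm_translates L g x).tsum_le_tsum (fun l => h _)
    ((summable_norm_translates L g' x).mul_left c)

theorem normSum_le_add {g g₁ g₂ : C_c(G × H, ℂ)} (h : ∀ x, ‖g x‖ ≤ ‖g₁ x‖ + ‖g₂ x‖)
    (ξ : (G × H) ⧸ L) : normSum L g ξ ≤ normSum L g₁ ξ + normSum L g₂ ξ := by
  obtain ⟨x, rfl⟩ := QuotientAddGroup.mk_surjective ξ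
  rw [normSum_mk, normSum_mk, normSum_mk,
    ← (summable_norm_translates L g₁ x).tsum_add (summable_norm_translates L g₂ x)]
  exact (summable_norm_translates L g x).tsum_le_tsum (fun l => h _)
    ((summable_norm_translates L g₁ x).add (summable_norm_translates L g₂ x))

variable [LocallyCompactSpace G] [LocallyCompactSpace H]

theorem continuous_normSum (g : C_c(G × H, ℂ)) : Continuous (normSum L g) :=
  Complex.continuous_re.comp (continuous_orbitSum L _)

variable [CompactSpace ((G × H) ⧸ L)]

theorem integrable_normSum (g : C_c(G × H, ℂ)) (ζ : (G × H) ⧸ L) :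
    Integrable (fun ξ => normSum L g (ξ + ζ)) τ.variation :=
  τ.integrable ((continuous_normSum L g).comp (continuous_add_const ζ))

theorem norm_integral_orbitSum_le (g : C_c(G × H, ℂ)) (ζ : (G × H) ⧸ L) :
    ‖τ.integral fun ξ => orbitSum L g (ξ + ζ)‖ ≤ torusNorm L τ g ζ :=
  τ.norm_integral_le (integrable_normSum L τ g ζ) fun _ => norm_orbitSum_le L g _

theorem torusNorm_le_mul {g g' : C_c(G × H, ℂ)} {c : ℝ} (h : ∀ x, ‖g x‖ ≤ c * ‖g' x‖)
    (ζ : (G × H) ⧸ L) : torusNorm L τ g ζ ≤ c * torusNorm L τ g' ζ := by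
  let _ : MeasurableSpace ((G × H) ⧸ L) := borel _
  unfold torusNorm
  rw [← integral_const_mul]
  exact integral_mono (integrable_normSum L τ g ζ) ((integrable_normSum L τ g' ζ).const_mul c)
    fun _ => normSum_le_mul L h _

theorem torusNorm_le_add {g g₁ g₂ : C_c(G × H, ℂ)} (h : ∀ x, ‖g x‖ ≤ ‖g₁ x‖ + ‖g₂ x‖)
    (ζ : (G × H) ⧸ L) : torusNorm L τ g ζ ≤ torusNorm L τ g₁ ζ + torusNorm L τ g₂ ζ := by
  let _ : MeasurableSpace ((G × H) ⧸ L) := borel _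
  unfold torusNorm
  rw [← integral_add (integrable_normSum L τ g₁ ζ) (integrable_normSum L τ g₂ ζ)]
  exact integral_mono (integrable_normSum L τ g ζ)
    ((integrable_normSum L τ g₁ ζ).add (integrable_normSum L τ g₂ ζ))
    fun _ => normSum_le_add L h _

theorem exists_torusNorm_le (g : C_c(G × H, ℂ)) : ∃ C, ∀ ζ, torusNorm L τ g ζ ≤ C := by
  have hc : Continuous fun ζ => τ.abs.integral fun ξ => orbitSum L (complexNorm g) (ξ + ζ) :=
    τ.abs.continuous_integral ((continuous_orbitSum L _).comp (continuous_snd.add continuous_fst))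
  obtain ⟨C, hC⟩ := hc.bounded_above_of_compact_support (HasCompactSupport.of_compactSpace _)
  refine ⟨C, fun ζ => ?_⟩
  have := hC ζ
  rw [abs_integral_orbitSum_complexNorm, Complex.norm_real] at this
  exact (Real.le_norm_self _).trans this

variable {L τ} {ρ : ComplexRadonMeasure (G × H)}

theorem IsDisintegration.torusNorm_le (hτ : IsDisintegration L ρ τ) (g : C_c(G × H, ℂ))
    (x : G × H) : torusNorm L τ g (toTorus L x) ≤ ∫ y, ‖g (y + x)‖ ∂ρ.variation := by
  let _ : MeasurableSpace ((G × H) ⧸ L) := borel _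
  have : BorelSpace ((G × H) ⧸ L) := ⟨rfl⟩
  have hcl : IsClosed (L : Set (G × H)) := AddSubgroup.isClosed_of_discrete
  refine integral_le_of_forall_norm_integral_mul_le τ.variation τ.measurable_phase τ.norm_phase
    ((continuous_normSum L g).comp (continuous_id.add continuous_const))
    (HasCompactSupport.of_compactSpace _) fun k hk => ?_
  let k' : C((G × H) ⧸ L, ℂ) := ⟨k, map_continuous k⟩
  have hunfold : τ.integral (orbitSum L (mulLift L (shift x (complexNorm g)) k')) =
      ∫ ξ, (normSum L g (ξ + toTorus L x) : ℂ) * k ξ * τ.phase ξ ∂τ.variation := by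
    unfold ComplexRadonMeasure.integral
    congr 1
    funext ξ
    rw [orbitSum_mulLift, orbitSum_shift, orbitSum_complexNorm]
    rfl
  change ‖∫ ξ, (normSum L g (ξ + toTorus L x) : ℂ) * k ξ * τ.phase ξ ∂τ.variation‖ ≤ _
  rw [← hunfold, ← hτ]
  let _ : MeasurableSpace (G × H) := borel _
  have : BorelSpace (G × H) := ⟨rfl⟩
  refine ρ.norm_integral_le (g := fun y => ‖g (y + x)‖) ?_ fun y => ?_
  · exact Continuous.integrable_of_hasCompactSupport (map_continuous (shift x g)).norm
      (shift x g).hasCompactSupport.norm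
  · rw [mulLift_apply, norm_mul]
    change ‖(‖g (y + x)‖ : ℂ)‖ * ‖k _‖ ≤ _
    rw [Complex.norm_real, norm_norm]
    exact mul_le_of_le_one_right (norm_nonneg _) (hk _)

end TotalVariation

section Cutoff

variable {X : Type*} [TopologicalSpace X]

/-- An increasing sequence of compactly supported functions with values in `[0, 1]` that are
eventually equal to `1` on every compact set. -/
structure IsCutoffSeq (χ : ℕ → C_c(X, ℝ)) : Prop where
  nonneg : ∀ n x, 0 ≤ χ n x
  le_one : ∀ n x, χ n x ≤ 1
  mono : ∀ x, Monotone fun n => χ n x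
  eventually_one : ∀ Q : Set X, IsCompact Q → ∃ N, ∀ n ≥ N, ∀ x ∈ Q, χ n x = 1

theorem exists_isCutoffSeq (X : Type*) [TopologicalSpace X] [T2Space X] [LocallyCompactSpace X]
    [SigmaCompactSpace X] : ∃ χ : ℕ → C_c(X, ℝ), IsCutoffSeq χ := by
  let K := CompactExhaustion.choice X
  have h : ∀ n, ∃ χ : C(X, ℝ), Set.EqOn χ 1 (K n) ∧ Set.EqOn χ 0 (interior (K (n + 1)))ᶜ ∧
      HasCompactSupport χ ∧ ∀ x, χ x ∈ Set.Icc (0 : ℝ) 1 := fun n =>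
    exists_continuous_one_zero_of_isCompact (K.isCompact n) isOpen_interior.isClosed_compl
      (Set.disjoint_compl_right_iff_subset.2 (K.subset_interior_succ n))
  choose χ hone hzero hsupp hmem using h
  refine ⟨fun n => ⟨χ n, hsupp n⟩, fun n x => (hmem n x).1, fun n x => (hmem n x).2,
    fun x => monotone_nat_of_le_succ fun n => ?_, fun Q hQ => ?_⟩
  · change χ n x ≤ χ (n + 1) x
    by_cases hx : x ∈ interior (K (n + 1))
    · rw [hone (n + 1) (interior_subset hx)]
      exact (hmem n x).2
    · rw [hzero n hx]
      exact (hmem (n + 1) x).1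
  · obtain ⟨N, hN⟩ := K.exists_superset_of_isCompact hQ
    exact ⟨N, fun n hn x hx => hone n (K.subset hn (hN hx))⟩

/-- The function `χ f`. -/
def cutoff (χ : C_c(X, ℝ)) (f : C(X, ℂ)) : C_c(X, ℂ) where
  toFun x := (χ x : ℂ) * f x
  continuous_toFun := by fun_prop
  hasCompactSupport' := (complexify χ).hasCompactSupport.mul_right

@[simp]
theorem cutoff_apply (χ : C_c(X, ℝ)) (f : C(X, ℂ)) (x : X) :
    cutoff χ f x = (χ x : ℂ) * f x := rfl

variable {χ : ℕ → C_c(X, ℝ)}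

theorem IsCutoffSeq.eventually_eq_one (hχ : IsCutoffSeq χ) (x : X) :
    ∀ᶠ n in atTop, χ n x = 1 := by
  obtain ⟨N, hN⟩ := hχ.eventually_one {x} isCompact_singleton
  exact eventually_atTop.2 ⟨N, fun n hn => hN n hn x rfl⟩

theorem IsCutoffSeq.norm_cutoff (hχ : IsCutoffSeq χ) (f : C(X, ℂ)) (n : ℕ) (x : X) :
    ‖cutoff (χ n) f x‖ = χ n x * ‖f x‖ := by
  rw [cutoff_apply, norm_mul, Complex.norm_real, Real.norm_of_nonneg (hχ.nonneg n x)]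

theorem IsCutoffSeq.norm_cutoff_le (hχ : IsCutoffSeq χ) (f : C(X, ℂ)) (n : ℕ) (x : X) :
    ‖cutoff (χ n) f x‖ ≤ ‖f x‖ := by
  rw [hχ.norm_cutoff]
  exact mul_le_of_le_one_left (norm_nonneg _) (hχ.le_one n x)

theorem IsCutoffSeq.norm_cutoff_mono (hχ : IsCutoffSeq χ) (f : C(X, ℂ)) (x : X) :
    Monotone fun n => ‖cutoff (χ n) f x‖ := fun n m hnm => by
  simp only [hχ.norm_cutoff]
  exact mul_le_mul_of_nonneg_right (hχ.mono x hnm) (norm_nonneg _)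

theorem IsCutoffSeq.tendsto_cutoff (hχ : IsCutoffSeq χ) (f : C(X, ℂ)) (x : X) :
    Tendsto (fun n => cutoff (χ n) f x) atTop (𝓝 (f x)) := by
  refine tendsto_const_nhds.congr' ?_
  filter_upwards [hχ.eventually_eq_one x] with n hn
  rw [cutoff_apply, hn, Complex.ofReal_one, one_mul]

theorem IsCutoffSeq.enorm_cutoff_sub_le (hχ : IsCutoffSeq χ) (f : C(X, ℂ)) {Q : Set X} {n m : ℕ}
    (hn : ∀ x ∈ Q, χ n x = 1) (hm : ∀ x ∈ Q, χ m x = 1) (x : X) :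
    ‖cutoff (χ m) f x - cutoff (χ n) f x‖ₑ ≤ ‖f x‖ₑ * Qᶜ.indicator 1 x := by
  rw [cutoff_apply, cutoff_apply, ← sub_mul, enorm_mul, mul_comm]
  by_cases hx : x ∈ Q
  · simp [hn x hx, hm x hx]
  · rw [Set.indicator_of_mem (Set.mem_compl hx), Pi.one_apply]
    gcongr
    rw [← Complex.ofReal_sub, ← ofReal_norm, Complex.norm_real, Real.norm_eq_abs]
    refine ENNReal.ofReal_le_one.2 (abs_le.2 ⟨?_, ?_⟩) <;>
      linarith [hχ.nonneg n x, hχ.nonneg m x, hχ.le_one n x, hχ.le_one m x]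

end Cutoff

section TorusValue

variable {G H : Type*} [AddCommGroup G] [TopologicalSpace G]
  [AddCommGroup H] [TopologicalSpace H] [IsTopologicalAddGroup G] [IsTopologicalAddGroup H]
  (L : AddSubgroup (G × H)) (τ : ComplexRadonMeasure ((G × H) ⧸ L))

theorem torusValue_shift (φ : C_c(G, ℂ)) (f : C_c(H, ℂ)) (ζ : (G × H) ⧸ L) (t : G) :
    torusValue L τ (shift t φ) f ζ = torusValue L τ φ f (ζ + toTorus L (t, 0)) := by
  unfold torusValue
  congr 1
  funext ξ
  have htensor : tensor (shift t φ) f = shift (t, 0) (tensor φ f) := by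
    ext x
    simp
  rw [htensor, orbitSum_shift, add_assoc]

variable {L τ} in
theorem IsDisintegration.torusValue_eq {ρ : ComplexRadonMeasure (G × H)}
    (hτ : IsDisintegration L ρ τ) (φ : C_c(G, ℂ)) (g : C_c(H, ℂ)) (x : G × H) :
    torusValue L τ φ g (toTorus L x) = ρ.integral fun y => φ (y.1 + x.1) * g (y.2 + x.2) := by
  unfold torusValue
  simp only [← orbitSum_shift]
  exact (hτ (shift x (tensor φ g))).symm

variable [T2Space G] [T2Space H] [DiscreteTopology L]

theorem orbitSum_sub (g g' : C_c(G × H, ℂ)) (ξ : (G × H) ⧸ L) :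
    orbitSum L (g - g') ξ = orbitSum L g ξ - orbitSum L g' ξ := by
  obtain ⟨x, rfl⟩ := QuotientAddGroup.mk_surjective ξ
  simp only [orbitSum_mk]
  exact (summable_lattice_translates L g.hasCompactSupport x).tsum_sub
    (summable_lattice_translates L g'.hasCompactSupport x)

variable [LocallyCompactSpace G] [LocallyCompactSpace H] [CompactSpace ((G × H) ⧸ L)]

theorem torusValue_sub_of_tensor {φ φ₁ φ₂ : C_c(G, ℂ)} {f f₁ f₂ : C_c(H, ℂ)}
    (h : tensor φ f = tensor φ₁ f₁ - tensor φ₂ f₂) (ζ : (G × H) ⧸ L) :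
    torusValue L τ φ f ζ = torusValue L τ φ₁ f₁ ζ - torusValue L τ φ₂ f₂ ζ := by
  unfold torusValue
  rw [← τ.integral_sub
    (F := fun ξ => orbitSum L (tensor φ₁ f₁) (ξ + ζ))
    (F' := fun ξ => orbitSum L (tensor φ₂ f₂) (ξ + ζ))
    (τ.integrable ((continuous_orbitSum L _).comp (continuous_add_const ζ)))
    (τ.integrable ((continuous_orbitSum L _).comp (continuous_add_const ζ)))]
  simp only [h, orbitSum_sub]

theorem torusValue_sub_right (φ : C_c(G, ℂ)) (f f' : C_c(H, ℂ)) (ζ : (G × H) ⧸ L) :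
    torusValue L τ φ (f - f') ζ = torusValue L τ φ f ζ - torusValue L τ φ f' ζ :=
  torusValue_sub_of_tensor L τ (by ext; simp [mul_sub]) ζ

theorem torusValue_sub_left (φ φ' : C_c(G, ℂ)) (f : C_c(H, ℂ)) (ζ : (G × H) ⧸ L) :
    torusValue L τ (φ - φ') f ζ = torusValue L τ φ f ζ - torusValue L τ φ' f ζ :=
  torusValue_sub_of_tensor L τ (by ext; simp [sub_mul]) ζ

theorem norm_torusValue_le (φ : C_c(G, ℂ)) (f : C_c(H, ℂ)) (ζ : (G × H) ⧸ L) :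
    ‖torusValue L τ φ f ζ‖ ≤ torusNorm L τ (tensor φ f) ζ :=
  norm_integral_orbitSum_le L τ _ ζ

theorem norm_torusValue_le_mul {φ φ' : C_c(G, ℂ)} {c : ℝ} (hφ : ∀ s, ‖φ' s‖ ≤ c * ‖φ s‖)
    (f : C_c(H, ℂ)) (ζ : (G × H) ⧸ L) :
    ‖torusValue L τ φ' f ζ‖ ≤ c * torusNorm L τ (tensor φ f) ζ := by
  refine (norm_torusValue_le L τ _ _ ζ).trans (torusNorm_le_mul L τ (fun x => ?_) ζ)
  rw [tensor_apply, tensor_apply, norm_mul, norm_mul, ← mul_assoc]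
  exact mul_le_mul_of_nonneg_right (hφ _) (norm_nonneg _)

end TorusValue

section Approximation

variable {G H : Type*} [AddCommGroup G] [TopologicalSpace G]
  [AddCommGroup H] [TopologicalSpace H]
  (L : AddSubgroup (G × H)) (τ : ComplexRadonMeasure ((G × H) ⧸ L))

/-- The weights `fn n` form a Cauchy sequence with respect to `|τ|`, uniformly in all translates. -/
def IsUniformCauchy (fn : ℕ → C_c(H, ℂ)) : Prop :=
  ∀ φ : C_c(G, ℂ), ∀ ε > 0, ∃ N, ∀ n ≥ N, ∀ m ≥ N, ∀ ζ,
    torusNorm L τ (tensor φ (fn m - fn n)) ζ ≤ ε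

/-- The measure `β ζ` on `G` is, for every point `ζ` of the torus, the vague limit of the measures
`φ ↦ torusValue L τ φ (fn n) ζ` with the weights `fn n`. -/
def IsTorusLimit (fn : ℕ → C_c(H, ℂ)) (β : (G × H) ⧸ L → RadonFunctional G) : Prop :=
  ∀ ζ φ, Tendsto (fun n => torusValue L τ φ (fn n) ζ) atTop (𝓝 (β ζ φ))

variable {L τ} {fn : ℕ → C_c(H, ℂ)} {β : (G × H) ⧸ L → RadonFunctional G}

variable [IsTopologicalAddGroup G] [IsTopologicalAddGroup H]

theorem IsTorusLimit.apply_add_toTorus (hβ : IsTorusLimit L τ fn β) (ζ : (G × H) ⧸ L) (t : G) :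
    β (ζ + toTorus L (t, 0)) = translate t (β ζ) := by
  refine RadonFunctional.ext fun φ => tendsto_nhds_unique (hβ _ φ) ?_
  simp only [← torusValue_shift]
  exact hβ ζ (shift t φ)

variable [T2Space G] [LocallyCompactSpace G]

theorem IsTorusLimit.reflectConj_innerCorrelation_apply (hβ : IsTorusLimit L τ fn β)
    (φ ψ : C_c(G, ℂ)) (ζ : (G × H) ⧸ L) (s : G) :
    reflectConj (innerCorrelation (β ζ) φ ψ) s =
      (starRingEnd ℂ) (β (ζ - toTorus L (s, 0)) φ) * reflectConj ψ s := by
  have hsub : ζ - toTorus L (s, 0) = ζ + toTorus L (-s, 0) := by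
    rw [sub_eq_add_neg, ← QuotientAddGroup.mk_neg, Prod.neg_mk, neg_zero]
  rw [hsub, hβ.apply_add_toTorus]
  exact map_mul (starRingEnd ℂ) (β ζ (shift (-s) φ)) (ψ (-s))

variable [T2Space H] [LocallyCompactSpace H] [DiscreteTopology L] [CompactSpace ((G × H) ⧸ L)]

theorem IsUniformCauchy.exists_torusNorm_le (hfn : IsUniformCauchy L τ fn) (φ : C_c(G, ℂ)) :
    ∃ C, 0 ≤ C ∧ ∀ n ζ, torusNorm L τ (tensor φ (fn n)) ζ ≤ C := by
  obtain ⟨N, hN⟩ := hfn φ 1 one_pos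
  choose B hB using fun n => CutProject.exists_torusNorm_le L τ (tensor φ (fn n))
  have hB0 : ∀ n, 0 ≤ B n := fun n => (torusNorm_nonneg L τ _ 0).trans (hB n 0)
  have hsum0 : 0 ≤ ∑ i ∈ Finset.range N, B i := Finset.sum_nonneg fun i _ => hB0 i
  refine ⟨(∑ i ∈ Finset.range N, B i) + (B N + 1), by linarith [hB0 N], fun n ζ => ?_⟩
  rcases lt_or_ge n N with hn | hn
  · have hle : B n ≤ ∑ i ∈ Finset.range N, B i :=
      Finset.single_le_sum (fun i _ => hB0 i) (Finset.mem_range.2 hn)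
    linarith [hB n ζ, hB0 N]
  · have htri : torusNorm L τ (tensor φ (fn n)) ζ ≤ torusNorm L τ (tensor φ (fn N)) ζ +
        torusNorm L τ (tensor φ (fn n - fn N)) ζ := torusNorm_le_add L τ (fun x => by
      refine le_trans (le_of_eq ?_) (norm_add_le _ _)
      simp only [tensor_apply, CompactlySupportedContinuousMap.coe_sub, Pi.sub_apply]
      congr 1
      ring) ζ
    linarith [hB N ζ, hN N le_rfl n hn ζ]

theorem IsTorusLimit.norm_sub_torusValue_le (hβ : IsTorusLimit L τ fn β)
    {φ φ' : C_c(G, ℂ)} {c ε : ℝ} (hc : 0 ≤ c) (hφ : ∀ s, ‖φ' s‖ ≤ c * ‖φ s‖) {N n : ℕ}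
    {ζ : (G × H) ⧸ L} (hN : ∀ m ≥ N, torusNorm L τ (tensor φ (fn m - fn n)) ζ ≤ ε) :
    ‖β ζ φ' - torusValue L τ φ' (fn n) ζ‖ ≤ c * ε := by
  refine le_of_tendsto ((hβ ζ φ').sub_const _).norm ?_
  filter_upwards [eventually_ge_atTop N] with m hm
  rw [← torusValue_sub_right]
  exact (norm_torusValue_le_mul L τ hφ _ ζ).trans (mul_le_mul_of_nonneg_left (hN m hm) hc)

theorem IsTorusLimit.norm_sub_torusValue_le_of_cauchy (hβ : IsTorusLimit L τ fn β)
    {φ : C_c(G, ℂ)} {ε : ℝ} {N n : ℕ} {ζ : (G × H) ⧸ L}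
    (hN : ∀ m ≥ N, torusNorm L τ (tensor φ (fn m - fn n)) ζ ≤ ε) :
    ‖β ζ φ - torusValue L τ φ (fn n) ζ‖ ≤ ε := by
  simpa only [one_mul] using
    hβ.norm_sub_torusValue_le zero_le_one (fun s => (one_mul ‖φ s‖).ge) hN

theorem IsUniformCauchy.tendstoUniformly (hfn : IsUniformCauchy L τ fn)
    (hβ : IsTorusLimit L τ fn β) (φ : C_c(G, ℂ)) :
    TendstoUniformly (fun n ζ => torusValue L τ φ (fn n) ζ) (fun ζ => β ζ φ) atTop := by
  rw [Metric.tendstoUniformly_iff]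
  intro ε hε
  obtain ⟨N, hN⟩ := hfn φ (ε / 2) (half_pos hε)
  filter_upwards [eventually_ge_atTop N] with n hn ζ
  rw [dist_eq_norm]
  exact (hβ.norm_sub_torusValue_le_of_cauchy fun m hm => hN n hn m hm ζ).trans_lt
    (half_lt_self hε)

theorem IsUniformCauchy.continuous (hfn : IsUniformCauchy L τ fn)
    (hβ : IsTorusLimit L τ fn β) : Continuous β :=
  RadonFunctional.continuous_iff.2 fun φ => (hfn.tendstoUniformly hβ φ).continuous
    (Frequently.of_forall fun n => continuous_torusValue L τ φ (fn n))

/-- Both correlations pair `fn`-weighted measures with an inner function; the first summand of the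
bound comes from the weight, the second one from the inner function. -/
theorem IsTorusLimit.norm_correlation_sub_le (hβ : IsTorusLimit L τ fn β) {φ ψ : C_c(G, ℂ)}
    {C₁ C₂ δ : ℝ} (hC₁ : ∀ n ζ, torusNorm L τ (tensor φ (fn n)) ζ ≤ C₁)
    (hC₂ : ∀ n ζ, torusNorm L τ (tensor (reflectConj ψ) (fn n)) ζ ≤ C₂) {N n : ℕ}
    (hφ : ∀ m ≥ N, ∀ ζ, torusNorm L τ (tensor φ (fn m - fn n)) ζ ≤ δ)
    (hψ : ∀ m ≥ N, ∀ ζ, torusNorm L τ (tensor (reflectConj ψ) (fn m - fn n)) ζ ≤ δ)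
    (ζ : (G × H) ⧸ L) :
    ‖correlation (β ζ) φ ψ - torusCorrelation L τ φ ψ (fn n) ζ‖ ≤ C₁ * δ + δ * C₂ := by
  have hC₁0 : 0 ≤ C₁ := (torusNorm_nonneg L τ _ ζ).trans (hC₁ n ζ)
  have hδ0 : 0 ≤ δ := (torusNorm_nonneg L τ _ ζ).trans (hφ N le_rfl ζ)
  set r : C_c(G, ℂ) := reflectConj (innerCorrelation (β ζ) φ ψ)
  set rn : C_c(G, ℂ) := torusInnerCorrelation L τ φ ψ (fn n) ζ
  have hβφ : ∀ ζ, ‖β ζ φ‖ ≤ C₁ := fun ζ => le_of_tendsto (hβ ζ φ).norm <|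
    Eventually.of_forall fun n => (norm_torusValue_le L τ φ (fn n) ζ).trans (hC₁ n ζ)
  have hr : ∀ s, ‖r s‖ ≤ C₁ * ‖reflectConj ψ s‖ := fun s => by
    rw [hβ.reflectConj_innerCorrelation_apply, norm_mul, RCLike.norm_conj]
    exact mul_le_mul_of_nonneg_right (hβφ _) (norm_nonneg _)
  have hrn : ∀ s, ‖(r - rn) s‖ ≤ δ * ‖reflectConj ψ s‖ := fun s => by
    change ‖r s - rn s‖ ≤ _
    rw [hβ.reflectConj_innerCorrelation_apply, torusInnerCorrelation_apply, ← sub_mul, ← map_sub,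
      norm_mul, RCLike.norm_conj]
    exact mul_le_mul_of_nonneg_right
      (hβ.norm_sub_torusValue_le_of_cauchy fun m hm => hφ m hm _) (norm_nonneg _)
  have hweight : ‖β ζ r - torusValue L τ r (fn n) ζ‖ ≤ C₁ * δ :=
    hβ.norm_sub_torusValue_le hC₁0 hr fun m hm => hψ m hm ζ
  have hinner : ‖torusValue L τ r (fn n) ζ - torusValue L τ rn (fn n) ζ‖ ≤ δ * C₂ := by
    rw [← torusValue_sub_left]
    exact (norm_torusValue_le_mul L τ hrn _ ζ).trans (mul_le_mul_of_nonneg_left (hC₂ n ζ) hδ0)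
  change ‖(starRingEnd ℂ) (β ζ r) - (starRingEnd ℂ) (torusValue L τ rn (fn n) ζ)‖ ≤ _
  rw [← map_sub, RCLike.norm_conj, ← sub_add_sub_cancel]
  exact (norm_add_le _ _).trans (add_le_add hweight hinner)

theorem IsUniformCauchy.tendstoUniformly_torusCorrelation (hfn : IsUniformCauchy L τ fn)
    (hβ : IsTorusLimit L τ fn β) (φ ψ : C_c(G, ℂ)) :
    TendstoUniformly (fun n ζ => torusCorrelation L τ φ ψ (fn n) ζ)
      (fun ζ => correlation (β ζ) φ ψ) atTop := by
  obtain ⟨C₁, hC₁0, hC₁⟩ := hfn.exists_torusNorm_le φ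
  obtain ⟨C₂, hC₂0, hC₂⟩ := hfn.exists_torusNorm_le (reflectConj ψ)
  rw [Metric.tendstoUniformly_iff]
  intro ε hε
  have hpos : 0 < C₁ + C₂ + 1 := by positivity
  obtain ⟨N₁, hN₁⟩ := hfn φ (ε / (C₁ + C₂ + 1)) (by positivity)
  obtain ⟨N₂, hN₂⟩ := hfn (reflectConj ψ) (ε / (C₁ + C₂ + 1)) (by positivity)
  filter_upwards [eventually_ge_atTop (max N₁ N₂)] with n hn ζ
  rw [dist_eq_norm]
  calc ‖correlation (β ζ) φ ψ - torusCorrelation L τ φ ψ (fn n) ζ‖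
      ≤ C₁ * (ε / (C₁ + C₂ + 1)) + ε / (C₁ + C₂ + 1) * C₂ :=
        hβ.norm_correlation_sub_le hC₁ hC₂
          (fun m hm ζ => hN₁ n (le_of_max_le_left hn) m (le_of_max_le_left hm) ζ)
          (fun m hm ζ => hN₂ n (le_of_max_le_right hn) m (le_of_max_le_right hm) ζ) ζ
    _ = ε * ((C₁ + C₂) / (C₁ + C₂ + 1)) := by ring
    _ < ε := mul_lt_of_lt_one_right hε ((div_lt_one hpos).2 (lt_add_one _))

theorem IsDisintegration.isUniformCauchy_cutoff [MeasurableSpace H]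
    {ρ : ComplexRadonMeasure (G × H)} (hτ : IsDisintegration L ρ τ) {f : H → ℂ}
    (hfc : Continuous f) (hf : IsAdmissible ρ f) {χ : ℕ → C_c(H, ℝ)} (hχ : IsCutoffSeq χ) :
    IsUniformCauchy L τ fun n => cutoff (χ n) ⟨f, hfc⟩ := by
  intro φ ε hε
  obtain ⟨Q, hQ, hsmall⟩ := hf.small_outside ε hε φ
  obtain ⟨N, hN⟩ := hχ.eventually_one Q hQ
  refine ⟨N, fun n hn m hm ζ => ?_⟩
  obtain ⟨x, rfl⟩ := QuotientAddGroup.mk_surjective ζ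
  refine (hτ.torusNorm_le _ x).trans ?_
  let _ : MeasurableSpace (G × H) := borel (G × H)
  have : BorelSpace (G × H) := ⟨rfl⟩
  set g := tensor φ (cutoff (χ m) ⟨f, hfc⟩ - cutoff (χ n) ⟨f, hfc⟩)
  have hgm : Measurable fun y => g (y + x) :=
    ((map_continuous g).comp (continuous_add_const x)).measurable
  rw [integral_norm_eq_lintegral_enorm hgm.aestronglyMeasurable]
  refine ENNReal.toReal_le_of_le_ofReal hε.le
    ((lintegral_mono fun y => ?_).trans (hsmall x.1 x.2))
  rw [tensor_apply, enorm_mul, enorm_mul, mul_assoc]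
  exact mul_le_mul_right (hχ.enorm_cutoff_sub_le ⟨f, hfc⟩ (hN n hn) (hN m hm) _) _

end Approximation

section Admissible

variable {G H : Type*} [AddCommGroup G] [TopologicalSpace G]
  [AddCommGroup H] [TopologicalSpace H] [IsTopologicalAddGroup H]
  [MeasurableSpace H] [BorelSpace H] {ρ : ComplexRadonMeasure (G × H)} {f : H → ℂ}

theorem IsAdmissible.comp_add_right (hf : IsAdmissible ρ f) (k : H) :
    IsAdmissible ρ fun h => f (h + k) where
  measurable := hf.measurable.comp (measurable_add_const k)
  locallyBounded h := by
    obtain ⟨U, hU, C, hC⟩ := hf.locallyBounded (h + k)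
    exact ⟨(· + k) ⁻¹' U, (continuous_add_const k).continuousAt.preimage_mem_nhds hU, C,
      fun x hx => hC _ hx⟩
  small_outside ε hε φ := by
    obtain ⟨Q, hQ, h⟩ := hf.small_outside ε hε φ
    refine ⟨Homeomorph.addRight k ⁻¹' Q, (Homeomorph.isCompact_preimage _).2 hQ,
      fun s k' => (le_of_eq ?_).trans (h s (k' + k))⟩
    congr 1
    funext x
    have hind : (Homeomorph.addRight k ⁻¹' Q)ᶜ.indicator (1 : H → ℝ≥0∞) (x.2 + k') =
        Qᶜ.indicator 1 (x.2 + k' + k) := rfl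
    rw [hind, add_assoc]

variable [IsTopologicalAddGroup G] [T2Space G] [LocallyCompactSpace G] [T2Space H]

/-- The measure `φ ↦ ∫ φ(t + s) f(h + k) dρ(t, h)` on `G`, for `x = (s, k)`. -/
def shiftedMeasure (hf : IsAdmissible ρ f) (x : G × H) : RadonFunctional G :=
  translate x.1 (weightedMeasure ρ _ (hf.comp_add_right x.2))

theorem shiftedMeasure_apply (hf : IsAdmissible ρ f) (x : G × H) (φ : C_c(G, ℂ)) :
    shiftedMeasure hf x φ = ρ.integral fun y => φ (y.1 + x.1) * f (y.2 + x.2) := rfl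

theorem shiftedMeasure_zero (hf : IsAdmissible ρ f) :
    shiftedMeasure hf 0 = weightedMeasure ρ f hf := by
  refine RadonFunctional.ext fun φ => ?_
  rw [shiftedMeasure_apply]
  simp only [Prod.fst_zero, Prod.snd_zero, add_zero]
  rfl

variable {L : AddSubgroup (G × H)} {τ : ComplexRadonMeasure ((G × H) ⧸ L)} {χ : ℕ → C_c(H, ℝ)}

theorem IsDisintegration.tendsto_shiftedMeasure (hτ : IsDisintegration L ρ τ)
    (hfc : Continuous f) (hf : IsAdmissible ρ f) (hχ : IsCutoffSeq χ) (x : G × H)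
    (φ : C_c(G, ℂ)) :
    Tendsto (fun n => torusValue L τ φ (cutoff (χ n) ⟨f, hfc⟩) (toTorus L x)) atTop
      (𝓝 (shiftedMeasure hf x φ)) := by
  let _ : MeasurableSpace (G × H) := borel (G × H)
  have : BorelSpace (G × H) := ⟨rfl⟩
  simp only [hτ.torusValue_eq, shiftedMeasure_apply]
  have hi := integrable_weight (hf.comp_add_right x.2) (shift x.1 φ)
  refine tendsto_integral_of_dominated_convergence _ (fun n => ?_) hi.norm
    (fun n => ae_of_all _ fun y => ?_) (ae_of_all _ fun y => ?_)
  · refine (Measurable.mul (Continuous.measurable ?_) ρ.measurable_phase).aestronglyMeasurable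
    fun_prop
  · simp only [norm_mul, ρ.norm_phase, mul_one]
    exact mul_le_mul_of_nonneg_left (hχ.norm_cutoff_le ⟨f, hfc⟩ n _) (norm_nonneg _)
  · exact ((hχ.tendsto_cutoff ⟨f, hfc⟩ (y.2 + x.2)).const_mul _).mul_const _

end Admissible

section WeightIntegrable

theorem exists_integral_norm_eq_one {G : Type*} [AddCommGroup G] [TopologicalSpace G]
    [IsTopologicalAddGroup G] [T2Space G] [LocallyCompactSpace G] [MeasurableSpace G]
    [BorelSpace G] (mG : Measure G) [mG.IsAddHaarMeasure] :
    ∃ ψ : C_c(G, ℂ), ∫ t, ‖ψ t‖ ∂mG = 1 := by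
  obtain ⟨χ, hχ1, -, hχc, hχ01⟩ := exists_continuous_one_zero_of_isCompact
    (isCompact_singleton (x := (0 : G))) isClosed_empty (Set.disjoint_empty _)
  have hpos : 0 < ∫ t, χ t ∂mG :=
    χ.continuous.integral_pos_of_hasCompactSupport_nonneg_nonzero hχc (fun t => (hχ01 t).1)
      (x := 0) (by rw [hχ1 rfl]; exact one_ne_zero)
  have hnorm : ∀ t, ‖complexify (⟨χ, hχc⟩ : C_c(G, ℝ)) t‖ = χ t := fun t => by
    rw [complexify_apply, Complex.norm_real]
    exact Real.norm_of_nonneg (hχ01 t).1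
  refine ⟨((∫ t, χ t ∂mG)⁻¹ : ℂ) • complexify ⟨χ, hχc⟩, ?_⟩
  simp only [CompactlySupportedContinuousMap.smul_apply, norm_smul, hnorm, norm_inv,
    integral_const_mul]
  rw [integral_complex_ofReal, Complex.norm_real, Real.norm_of_nonneg hpos.le,
    inv_mul_cancel₀ hpos.ne']

section Cutoff

variable {X : Type*} [TopologicalSpace X] {χ : ℕ → C_c(X, ℝ)}

theorem IsCutoffSeq.enorm_cutoff_mono (hχ : IsCutoffSeq χ) (f : C(X, ℂ)) (x : X) :
    Monotone fun n => ‖cutoff (χ n) f x‖ₑ := fun n m hnm => by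
  simp only [← ofReal_norm]
  exact ENNReal.ofReal_le_ofReal (hχ.norm_cutoff_mono f x hnm)

theorem IsCutoffSeq.integrable_of_integral_norm_cutoff_le [T2Space X] [MeasurableSpace X]
    [BorelSpace X] {μ : Measure X} [IsFiniteMeasureOnCompacts μ] (hχ : IsCutoffSeq χ)
    {f : C(X, ℂ)} {C : ℝ} (hC : ∀ n, ∫ x, ‖cutoff (χ n) f x‖ ∂μ ≤ C) : Integrable f μ := by
  refine ⟨f.continuous.measurable.aestronglyMeasurable, ?_⟩
  have hlim := lintegral_tendsto_of_tendsto_of_monotone (μ := μ)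
    (f := fun n x => ‖cutoff (χ n) f x‖ₑ) (F := fun x => ‖f x‖ₑ)
    (fun n => (map_continuous (cutoff (χ n) f)).measurable.enorm.aemeasurable)
    (ae_of_all _ (hχ.enorm_cutoff_mono f))
    (ae_of_all _ fun x => (hχ.tendsto_cutoff f x).enorm)
  refine lt_of_le_of_lt (le_of_tendsto' hlim fun n => ?_) (ENNReal.ofReal_lt_top (r := C))
  have hi : Integrable (cutoff (χ n) f) μ :=
    (map_continuous _).integrable_of_hasCompactSupport (cutoff (χ n) f).hasCompactSupport
  rw [← ofReal_integral_norm_eq_lintegral_enorm hi]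
  exact ENNReal.ofReal_le_ofReal (hC n)

end Cutoff

variable {G H : Type*} [AddCommGroup G] [TopologicalSpace G] [IsTopologicalAddGroup G] [T2Space G]
  [LocallyCompactSpace G] [MeasurableSpace G]
  [AddCommGroup H] [TopologicalSpace H] [IsTopologicalAddGroup H] [T2Space H]
  [LocallyCompactSpace H] [MeasurableSpace H]
  {mG : Measure G} [SFinite mG] {mH : Measure H} [SFinite mH]
  {L : AddSubgroup (G × H)} [DiscreteTopology L] [CompactSpace ((G × H) ⧸ L)]
  {τ : ComplexRadonMeasure ((G × H) ⧸ L)} {v : ℝ} {m : @Measure ((G × H) ⧸ L) (borel _)}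
  {χ : ℕ → C_c(H, ℝ)} {f : C(H, ℂ)}

theorem IsTorusHaar.integral_torusNorm (hm : IsTorusHaar mG mH L v m) (φ : C_c(G, ℂ))
    (g : C_c(H, ℂ)) :
    ∫ ζ, torusNorm L τ (tensor φ g) ζ ∂m =
      v⁻¹ * ((∫ t, ‖φ t‖ ∂mG) * ∫ k, ‖g k‖ ∂mH) * τ.variation.real Set.univ := by
  let _ : MeasurableSpace ((G × H) ⧸ L) := borel _
  have : BorelSpace ((G × H) ⧸ L) := ⟨rfl⟩
  have := hm.isProbabilityMeasure
  have hcl : IsClosed (L : Set (G × H)) := AddSubgroup.isClosed_of_discrete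
  have hswap := τ.abs.integral_integral_swap m
    (F := fun ζ ξ => orbitSum L (complexNorm (tensor φ g)) (ξ + ζ))
    ((continuous_orbitSum L _).comp (continuous_snd.add continuous_fst)) isCompact_univ
    (fun p hp => absurd (Set.mem_univ p) hp)
  have hinner : ∀ ξ, ∫ ζ, orbitSum L (complexNorm (tensor φ g)) (ξ + ζ) ∂m =
      ((v⁻¹ * ((∫ t, ‖φ t‖ ∂mG) * ∫ k, ‖g k‖ ∂mH) : ℝ) : ℂ) := fun ξ => by
    have hshift := hm.integral_add_right ⟨_, continuous_orbitSum L (complexNorm (tensor φ g))⟩ ξ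
    simp only [ContinuousMap.coe_mk] at hshift
    simp only [add_comm ξ]
    rw [hshift, hm.integral_orbitSum, complexNorm_tensor]
    simp only [tensor_apply]
    rw [integral_prod_mul]
    simp only [complexNorm_apply]
    rw [integral_complex_ofReal, integral_complex_ofReal]
    push_cast
    ring
  simp only [hinner, abs_integral_orbitSum_complexNorm] at hswap
  rw [τ.abs_integral_ofReal, integral_complex_ofReal] at hswap
  rw [Complex.ofReal_injective hswap, integral_const, smul_eq_mul, mul_comm]

theorem IsTorusHaar.integral_norm_le (hm : IsTorusHaar mG mH L v m) (hv : 0 < v)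
    (hτ : τ.variation ≠ 0) {ψ : C_c(G, ℂ)} (hψ : ∫ t, ‖ψ t‖ ∂mG = 1) {g : C_c(H, ℂ)} {C : ℝ}
    (hC : ∀ ζ, torusNorm L τ (tensor ψ g) ζ ≤ C) :
    ∫ k, ‖g k‖ ∂mH ≤ v * C / τ.variation.real Set.univ := by
  let _ : MeasurableSpace ((G × H) ⧸ L) := borel _
  have : BorelSpace ((G × H) ⧸ L) := ⟨rfl⟩
  have := hm.isProbabilityMeasure
  have hmass : 0 < τ.variation.real Set.univ :=
    ENNReal.toReal_pos (by rwa [Ne, Measure.measure_univ_eq_zero]) (measure_ne_top _ _)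
  have hle : ∫ ζ, torusNorm L τ (tensor ψ g) ζ ∂m ≤ C := by
    have := norm_integral_le_of_norm_le_const (μ := m) (ae_of_all _ fun ζ =>
      (Real.norm_of_nonneg (torusNorm_nonneg L τ (tensor ψ g) ζ)).trans_le (hC ζ))
    rw [probReal_univ, mul_one] at this
    exact (Real.le_norm_self _).trans this
  rw [hm.integral_torusNorm, hψ, one_mul, mul_assoc, inv_mul_le_iff₀ hv] at hle
  rwa [le_div_iff₀ hmass]

theorem IsUniformCauchy.integrable [BorelSpace G] [BorelSpace H] [mG.IsAddHaarMeasure]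
    [mH.IsAddHaarMeasure] (hm : IsTorusHaar mG mH L v m) (hv : 0 < v) (hτ : τ.variation ≠ 0)
    (hχ : IsCutoffSeq χ) (hfn : IsUniformCauchy L τ fun n => cutoff (χ n) f) :
    Integrable f mH := by
  obtain ⟨ψ, hψ⟩ := exists_integral_norm_eq_one mG
  obtain ⟨C, -, hC⟩ := hfn.exists_torusNorm_le ψ
  exact hχ.integrable_of_integral_norm_cutoff_le fun n => hm.integral_norm_le hv hτ hψ (hC n)

end WeightIntegrable

section NormConvolution

variable {H : Type*} [AddCommGroup H] [MeasurableSpace H] {mH : Measure H}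

/-- The integral `∫ |f(k + h) f(k)| dk`, which bounds `|(f ∗ f̃)(h)|` and is finite exactly when
`(f ∗ f̃)(h)` exists. -/
def normConv (mH : Measure H) (f : H → ℂ) (h : H) : ℝ≥0∞ :=
  ∫⁻ k, ‖f (k + h)‖ₑ * ‖f k‖ₑ ∂mH

theorem normConv_mono {f f' : H → ℂ} (hff' : ∀ k, ‖f k‖ ≤ ‖f' k‖) (h : H) :
    normConv mH f h ≤ normConv mH f' h := by
  have hle : ∀ k, ‖f k‖ₑ ≤ ‖f' k‖ₑ := fun k => enorm_le_iff_norm_le.2 (hff' k)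
  exact lintegral_mono fun k => mul_le_mul' (hle _) (hle _)

theorem enorm_mul_conj (a b : ℂ) : ‖a * (starRingEnd ℂ) b‖ₑ = ‖a‖ₑ * ‖b‖ₑ := by
  rw [enorm_mul, RCLike.enorm_conj]

variable [TopologicalSpace H] [IsTopologicalAddGroup H] [BorelSpace H] [mH.IsAddRightInvariant]

theorem selfConvExistsAt_iff (f : H → ℂ) (h : H) :
    SelfConvExistsAt mH f h ↔ Integrable (fun k => f (k + h) * (starRingEnd ℂ) (f k)) mH := by
  refine ((measurePreserving_add_right mH h).integrable_comp_emb
    (MeasurableEquiv.addRight h).measurableEmbedding).symm.trans ?_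
  refine iff_of_eq (congrArg (Integrable · mH) (funext fun k => ?_))
  simp [tildeFun]

theorem selfConvExistsAt_iff_normConv_lt_top {f : H → ℂ} (hf : Continuous f) (h : H) :
    SelfConvExistsAt mH f h ↔ normConv mH f h < ∞ := by
  rw [selfConvExistsAt_iff]
  have hm : AEStronglyMeasurable (fun k => f (k + h) * (starRingEnd ℂ) (f k)) mH :=
    ((hf.comp (continuous_add_const h)).mul
      (Complex.continuous_conj.comp hf)).measurable.aestronglyMeasurable
  refine (and_iff_right hm).trans ?_
  unfold HasFiniteIntegral normConv
  simp only [enorm_mul_conj]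

theorem enorm_selfConv_le (f : H → ℂ) (h : H) : ‖selfConv mH f h‖ₑ ≤ normConv mH f h := by
  rw [selfConv_eq_integral_add]
  refine (enorm_integral_le_lintegral_enorm _).trans (le_of_eq ?_)
  simp only [enorm_mul_conj]
  rfl

theorem memLp_two_of_selfConvExistsAt_zero {f : H → ℂ} (hf : Continuous f)
    (h : SelfConvExistsAt mH f 0) : MemLp f 2 mH := by
  rw [memLp_two_iff_integrable_sq_norm hf.measurable.aestronglyMeasurable]
  simpa [sq] using ((selfConvExistsAt_iff _ _).1 h).norm

theorem selfConvExistsAt_of_memLp_two {f : H → ℂ} (hf : MemLp f 2 mH) (h : H) :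
    SelfConvExistsAt mH f h := by
  rw [selfConvExistsAt_iff]
  exact (hf.comp_measurePreserving (measurePreserving_add_right mH h)).integrable_mul hf.star

end NormConvolution

section ConvolutionLimit

variable {H : Type*} [AddCommGroup H] [TopologicalSpace H] [IsTopologicalAddGroup H]
  [MeasurableSpace H] [BorelSpace H] {mH : Measure H} {χ : ℕ → C_c(H, ℝ)} {f : C(H, ℂ)}

theorem IsCutoffSeq.tendsto_normConv (hχ : IsCutoffSeq χ) (h : H) :
    Tendsto (fun n => normConv mH (cutoff (χ n) f) h) atTop (𝓝 (normConv mH f h)) := by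
  have hmeas : ∀ n, Measurable fun k => ‖cutoff (χ n) f k‖ₑ := fun n =>
    (map_continuous (cutoff (χ n) f)).measurable.enorm
  refine lintegral_tendsto_of_tendsto_of_monotone
    (fun n => (((hmeas n).comp (measurable_add_const h)).mul (hmeas n)).aemeasurable)
    (ae_of_all _ fun k n n' hn =>
      mul_le_mul' (hχ.enorm_cutoff_mono f _ hn) (hχ.enorm_cutoff_mono f _ hn))
    (ae_of_all _ fun k => ?_)
  exact ENNReal.Tendsto.mul (hχ.tendsto_cutoff f _).enorm (Or.inr enorm_ne_top)
    (hχ.tendsto_cutoff f _).enorm (Or.inr enorm_ne_top)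

theorem IsCutoffSeq.tendsto_selfConv [mH.IsAddRightInvariant] (hχ : IsCutoffSeq χ) {h : H}
    (hh : normConv mH f h < ∞) :
    Tendsto (fun n => selfConv mH (cutoff (χ n) f) h) atTop (𝓝 (selfConv mH f h)) := by
  have hi := (selfConvExistsAt_iff _ h).1
    ((selfConvExistsAt_iff_normConv_lt_top (mH := mH) f.continuous h).2 hh)
  simp only [selfConv_eq_integral_add]
  refine tendsto_integral_of_dominated_convergence _ (fun n => ?_) hi.norm
    (fun n => ae_of_all _ fun k => ?_) (ae_of_all _ fun k => ?_)
  · exact (((map_continuous (cutoff (χ n) f)).comp (continuous_add_const h)).mul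
      (Complex.continuous_conj.comp (map_continuous _))).measurable.aestronglyMeasurable
  · rw [norm_mul, norm_mul, RCLike.norm_conj, RCLike.norm_conj]
    exact mul_le_mul (hχ.norm_cutoff_le f n _) (hχ.norm_cutoff_le f n _) (norm_nonneg _)
      (norm_nonneg _)
  · exact (hχ.tendsto_cutoff f _).mul
      ((Complex.continuous_conj.tendsto _).comp (hχ.tendsto_cutoff f k))

/-- `H` need not be second countable, so the continuity of this function on `H × H` does not give
its measurability for the product σ-algebra: it is a pointwise limit of functions of compact
support. -/
theorem IsCutoffSeq.measurable_comp_add_mul (hχ : IsCutoffSeq χ) (f : C(H, ℂ)) :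
    Measurable fun p : H × H => f (p.2 + p.1) * f p.2 := by
  refine measurable_of_tendsto_metrizable
    (f := fun n (p : H × H) => cutoff (χ n) f (p.2 + p.1) * cutoff (χ n) f p.2) (fun n => ?_)
    (tendsto_pi_nhds.2 fun p => (hχ.tendsto_cutoff f _).mul (hχ.tendsto_cutoff f _))
  set g := cutoff (χ n) f
  have hg : IsCompact (tsupport g) := g.hasCompactSupport
  refine HasCompactSupport.measurable_of_prod (by fun_prop) (HasCompactSupport.intro
    ((hg.prod hg).image (f := fun q : H × H => (q.1 - q.2, q.2)) (by fun_prop)) fun p hp => ?_)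
  by_contra h
  exact hp ⟨(p.2 + p.1, p.2), ⟨subset_tsupport _ (left_ne_zero_of_mul h),
    subset_tsupport _ (right_ne_zero_of_mul h)⟩, by simp⟩

theorem IsCutoffSeq.ae_selfConvExistsAt [mH.IsAddLeftInvariant] [SFinite mH]
    (hχ : IsCutoffSeq χ) (hf : Integrable f mH) : ∀ᵐ h ∂mH, SelfConvExistsAt mH f h := by
  have hmeas : Measurable (Function.uncurry fun h k : H => ‖f (k + h)‖ₑ * ‖f k‖ₑ) := by
    simpa only [enorm_mul, Function.uncurry_def] using (hχ.measurable_comp_add_mul f).enorm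
  have hinner : ∀ k, ∫⁻ h, ‖f (k + h)‖ₑ * ‖f k‖ₑ ∂mH = (∫⁻ h, ‖f h‖ₑ ∂mH) * ‖f k‖ₑ := fun k => by
    rw [lintegral_mul_const' _ _ enorm_ne_top, lintegral_add_left_eq_self (fun h => ‖f h‖ₑ) k]
  have htotal : ∫⁻ h, normConv mH f h ∂mH ≠ ∞ := by
    unfold normConv
    rw [lintegral_lintegral_swap hmeas.aemeasurable]
    simp only [hinner]
    rw [lintegral_const_mul' _ _ hf.hasFiniteIntegral.ne]
    exact ENNReal.mul_ne_top hf.hasFiniteIntegral.ne hf.hasFiniteIntegral.ne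
  filter_upwards [ae_lt_top hmeas.lintegral_prod_right' htotal] with h hh
  exact (selfConvExistsAt_iff_normConv_lt_top f.continuous h).2 hh

end ConvolutionLimit

section GammaMajorant

variable {G H : Type*} [AddCommGroup G] [TopologicalSpace G]
  [AddCommGroup H] [MeasurableSpace H] {mH : Measure H}
  {L : AddSubgroup (G × H)} {v : ℝ} {φ : C_c(G, ℂ)} {x : G × H}

/-- The sum `∑_{(l, l⋆) ∈ L} |φ(s - l)| ∫ |f(k + h - l⋆) f(k)| dk` for `x = (s, h)`. Up to the
factor `v⁻¹`, it dominates the terms of `γ_ξ(φ)` at the class `ξ` of `x`. -/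
def gammaMajorant (L : AddSubgroup (G × H)) (mH : Measure H) (φ : C_c(G, ℂ)) (f : H → ℂ)
    (x : G × H) : ℝ≥0∞ :=
  ∑' l : L, ‖φ (x.1 - l.1.1)‖ₑ * normConv mH f (x.2 - l.1.2)

theorem gammaMajorant_mono (φ : C_c(G, ℂ)) {f f' : H → ℂ} (hff' : ∀ k, ‖f k‖ ≤ ‖f' k‖)
    (x : G × H) : gammaMajorant L mH φ f x ≤ gammaMajorant L mH φ f' x :=
  ENNReal.tsum_le_tsum fun _ => mul_le_mul' le_rfl (normConv_mono hff' _)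

theorem normConv_ne_top {f : H → ℂ} (hx : gammaMajorant L mH φ f x ≠ ∞) {l : L}
    (hl : φ (x.1 - l.1.1) ≠ 0) : normConv mH f (x.2 - l.1.2) ≠ ∞ := fun htop =>
  ENNReal.ne_top_of_tsum_ne_top hx l <| by
    rw [htop, ENNReal.mul_top (enorm_ne_zero.2 hl)]

theorem gammaAt_mk (f : H → ℂ) (x : G × H) (φ : C_c(G, ℂ)) :
    gammaAt L mH v f (toTorus L x) φ =
      (v : ℂ)⁻¹ * ∑' l : L, selfConv mH f (x.2 - l.1.2) * φ (x.1 - l.1.1) := rfl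

variable [TopologicalSpace H] [IsTopologicalAddGroup H] [BorelSpace H] {χ : ℕ → C_c(H, ℝ)}

theorem IsCutoffSeq.gammaMajorant_le (hχ : IsCutoffSeq χ) {f : C(H, ℂ)} {S : ℝ≥0∞}
    (h : ∀ n, gammaMajorant L mH φ (cutoff (χ n) f) x ≤ S) : gammaMajorant L mH φ f x ≤ S := by
  unfold gammaMajorant
  rw [ENNReal.tsum_eq_iSup_sum]
  refine iSup_le fun s => le_of_tendsto' (tendsto_finsetSum s fun l _ =>
    ENNReal.Tendsto.const_mul (hχ.tendsto_normConv (x.2 - l.1.2)) (Or.inr enorm_ne_top))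
    fun n => ?_
  exact (ENNReal.sum_le_tsum s).trans (h n)

section AutoConv

variable [T2Space H] [LocallyCompactSpace H] [mH.IsAddHaarMeasure]

theorem autoConv_complexNorm (g : C_c(H, ℂ)) (h : H) :
    autoConv mH (complexNorm g) h = ((∫ k, ‖g (k + h)‖ * ‖g k‖ ∂mH : ℝ) : ℂ) := by
  rw [autoConv_apply, selfConv_eq_integral_add, ← integral_complex_ofReal]
  simp

theorem normConv_eq_enorm_autoConv (g : C_c(H, ℂ)) (h : H) :
    normConv mH g h = ‖autoConv mH (complexNorm g) h‖ₑ := by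
  have hi : Integrable (fun k => ‖g (k + h)‖ * ‖g k‖) mH :=
    Continuous.integrable_of_hasCompactSupport (by fun_prop) g.hasCompactSupport.norm.mul_left
  have h0 : ∀ k, 0 ≤ ‖g (k + h)‖ * ‖g k‖ := fun k => by positivity
  rw [autoConv_complexNorm, ← ofReal_norm, Complex.norm_real,
    Real.norm_of_nonneg (integral_nonneg h0),
    ofReal_integral_eq_lintegral_ofReal hi (ae_of_all _ h0)]
  unfold normConv
  simp only [← ofReal_norm, ENNReal.ofReal_mul (norm_nonneg _)]

theorem gammaMajorant_eq_normSum [IsTopologicalAddGroup G] [T2Space G] [DiscreteTopology L]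
    (φ : C_c(G, ℂ)) (g : C_c(H, ℂ)) (x : G × H) :
    gammaMajorant L mH φ g x =
      ENNReal.ofReal (normSum L (tensor φ (autoConv mH (complexNorm g))) (toTorus L x)) := by
  rw [normSum_mk, ENNReal.ofReal_tsum_of_nonneg (fun _ => norm_nonneg _)
    (summable_norm_translates L _ x), ← (Equiv.neg L).tsum_eq]
  refine tsum_congr fun l => ?_
  rw [ofReal_norm, tensor_apply, enorm_mul, normConv_eq_enorm_autoConv]
  simp [sub_eq_add_neg]

end AutoConv

variable [mH.IsAddRightInvariant]

theorem norm_gamma_term_le {f g : H → ℂ} (hx : gammaMajorant L mH φ f x ≠ ∞)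
    (hgf : ∀ k, ‖g k‖ ≤ ‖f k‖) (l : L) :
    ‖selfConv mH g (x.2 - l.1.2) * φ (x.1 - l.1.1)‖ ≤
      (‖φ (x.1 - l.1.1)‖ₑ * normConv mH f (x.2 - l.1.2)).toReal := by
  rw [← toReal_enorm, enorm_mul, mul_comm]
  exact ENNReal.toReal_mono (ENNReal.ne_top_of_tsum_ne_top hx l)
    (mul_le_mul' le_rfl ((enorm_selfConv_le g _).trans (normConv_mono hgf _)))

theorem summable_gamma {f : H → ℂ} (hx : gammaMajorant L mH φ f x ≠ ∞) :
    Summable fun l : L => selfConv mH f (x.2 - l.1.2) * φ (x.1 - l.1.1) :=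
  Summable.of_norm_bounded (ENNReal.summable_toReal hx) (norm_gamma_term_le hx fun _ => le_rfl)

theorem norm_gammaAt_le (hv : 0 < v) {f g : H → ℂ} (hx : gammaMajorant L mH φ f x ≠ ∞)
    (hgf : ∀ k, ‖g k‖ ≤ ‖f k‖) :
    ‖gammaAt L mH v g (toTorus L x) φ‖ ≤ v⁻¹ * (gammaMajorant L mH φ f x).toReal := by
  rw [gammaAt_mk, norm_mul, norm_inv, Complex.norm_real, Real.norm_of_nonneg hv.le]
  refine mul_le_mul_of_nonneg_left ?_ (inv_nonneg.2 hv.le)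
  unfold gammaMajorant
  rw [ENNReal.tsum_toReal_eq (ENNReal.ne_top_of_tsum_ne_top hx)]
  exact tsum_of_norm_bounded (ENNReal.summable_toReal hx).hasSum (norm_gamma_term_le hx hgf)

theorem IsCutoffSeq.tendsto_gammaAt (hχ : IsCutoffSeq χ) {f : C(H, ℂ)}
    (hx : gammaMajorant L mH φ f x ≠ ∞) :
    Tendsto (fun n => gammaAt L mH v (cutoff (χ n) f) (toTorus L x) φ) atTop
      (𝓝 (gammaAt L mH v f (toTorus L x) φ)) := by
  simp only [gammaAt_mk]
  refine Tendsto.const_mul _ (tendsto_tsum_of_dominated_convergence (ENNReal.summable_toReal hx)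
    (fun l => ?_) (Eventually.of_forall fun n l =>
      norm_gamma_term_le hx (hχ.norm_cutoff_le f n) l))
  by_cases hl : φ (x.1 - l.1.1) = 0
  · simp [hl]
  · exact (hχ.tendsto_selfConv (normConv_ne_top hx hl).lt_top).mul_const _

/-- Where `φ` vanishes, the majorant says nothing about the existence of `f ∗ f̃`; this is why the
majorants for functions exhausting `G` are needed too. -/
theorem IsCutoffSeq.gammaExistsAt {χG : ℕ → C_c(G, ℝ)} (hχG : IsCutoffSeq χG) {f : C(H, ℂ)}
    {ξ : (G × H) ⧸ L} (hφ : ∀ x, toTorus L x = ξ → gammaMajorant L mH φ f x ≠ ∞)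
    (hall : ∀ j x, toTorus L x = ξ → gammaMajorant L mH (complexify (χG j)) f x ≠ ∞) :
    GammaExistsAt L mH f ξ φ := by
  refine fun x hx => ⟨fun l => ?_, summable_gamma (hφ x hx)⟩
  obtain ⟨j, hj⟩ := (hχG.eventually_eq_one (x.1 - l.1.1)).exists
  have hl : complexify (χG j) (x.1 - l.1.1) ≠ 0 := by simp [hj]
  exact (selfConvExistsAt_iff_normConv_lt_top f.continuous _).2
    (normConv_ne_top (hall j x hx) hl).lt_top

end GammaMajorant

section ProductIntegral

variable {T : Type*} [TopologicalSpace T] (τ : ComplexRadonMeasure T)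

theorem ComplexRadonMeasure.measurable_prodPhase :
    Measurable[@Prod.instMeasurableSpace T T (borel T) (borel T)]
      fun p : T × T => τ.phase p.1 * (starRingEnd ℂ) (τ.phase p.2) := by
  let _ : MeasurableSpace T := borel T
  exact (τ.measurable_phase.comp measurable_fst).mul
    (Complex.continuous_conj.measurable.comp (τ.measurable_phase.comp measurable_snd))

theorem ComplexRadonMeasure.norm_mul_prodPhase (c : ℂ) (p : T × T) :
    ‖c * (τ.phase p.1 * (starRingEnd ℂ) (τ.phase p.2))‖ = ‖c‖ := by
  rw [norm_mul, norm_mul, RCLike.norm_conj, τ.norm_phase, τ.norm_phase, mul_one, mul_one]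

variable [CompactSpace T]

theorem ComplexRadonMeasure.conjIntegral_integral_eq_integral_prod {F : T × T → ℂ}
    (hF : Integrable F τ.prodVariation) :
    τ.conjIntegral (fun η => τ.integral fun ξ => F (ξ, η)) =
      ∫ p, F p * (τ.phase p.1 * (starRingEnd ℂ) (τ.phase p.2)) ∂τ.prodVariation := by
  let _ : MeasurableSpace T := borel T
  have hi : Integrable (fun p => F p * (τ.phase p.1 * (starRingEnd ℂ) (τ.phase p.2)))
      (τ.variation.prod τ.variation) :=
    hF.mono (hF.aestronglyMeasurable.mul τ.measurable_prodPhase.aestronglyMeasurable)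
      (ae_of_all _ fun p => (τ.norm_mul_prodPhase _ p).le)
  unfold ComplexRadonMeasure.prodVariation
  rw [integral_prod_symm _ hi]
  unfold ComplexRadonMeasure.conjIntegral ComplexRadonMeasure.integral
  rw [← integral_conj]
  congr 1
  funext η
  rw [map_mul, Complex.conj_conj, ← integral_mul_const]
  simp only [mul_assoc]

theorem ComplexRadonMeasure.tendsto_conjIntegral_of_dominated {F : ℕ → T × T → ℂ}
    {F₀ : T × T → ℂ} {b : T × T → ℝ} (hF : ∀ n, Continuous (F n))
    (hb : Integrable b τ.prodVariation) (hFb : ∀ n, ∀ᵐ p ∂τ.prodVariation, ‖F n p‖ ≤ b p)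
    (hlim : ∀ᵐ p ∂τ.prodVariation, Tendsto (fun n => F n p) atTop (𝓝 (F₀ p))) :
    Integrable F₀ τ.prodVariation ∧
      Tendsto (fun n => τ.conjIntegral fun η => τ.integral fun ξ => F n (ξ, η)) atTop
        (𝓝 (τ.conjIntegral fun η => τ.integral fun ξ => F₀ (ξ, η))) := by
  let _ : MeasurableSpace T := borel T
  have : BorelSpace T := ⟨rfl⟩
  have hm : ∀ n, AEStronglyMeasurable (F n) τ.prodVariation := fun n =>
    (HasCompactSupport.stronglyMeasurable_of_prod (hF n)
      (HasCompactSupport.of_compactSpace _)).aestronglyMeasurable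
  have hi : ∀ n, Integrable (F n) τ.prodVariation := fun n => hb.mono' (hm n) (hFb n)
  have hi₀ : Integrable F₀ τ.prodVariation := by
    refine hb.mono' (aestronglyMeasurable_of_tendsto_ae atTop hm hlim) ?_
    filter_upwards [hlim, ae_all_iff.2 hFb] with p hp hbp
    exact le_of_tendsto' hp.norm hbp
  refine ⟨hi₀, ?_⟩
  rw [τ.conjIntegral_integral_eq_integral_prod hi₀]
  simp only [fun n => τ.conjIntegral_integral_eq_integral_prod (hi n)]
  refine tendsto_integral_of_dominated_convergence b
    (fun n => (hm n).mul τ.measurable_prodPhase.aestronglyMeasurable) hb (fun n => ?_) ?_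
  · filter_upwards [hFb n] with p hp
    rwa [τ.norm_mul_prodPhase]
  · filter_upwards [hlim] with p hp
    exact hp.mul_const _

end ProductIntegral

section AbsoluteValues

variable {X : Type*} [TopologicalSpace X]

theorem complexNorm_complexNorm (g : C_c(X, ℂ)) : complexNorm (complexNorm g) = complexNorm g := by
  ext x
  rw [complexNorm_apply, complexNorm_apply, Complex.norm_real, norm_norm]

variable {G H : Type*} [AddCommGroup G] [TopologicalSpace G] [AddCommGroup H] [TopologicalSpace H]
  {L : AddSubgroup (G × H)} {τ : ComplexRadonMeasure ((G × H) ⧸ L)}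

theorem reflectConj_complexNorm [IsTopologicalAddGroup G] (ψ : C_c(G, ℂ)) :
    reflectConj (complexNorm ψ) = complexNorm (reflectConj ψ) := by
  ext t
  simp only [reflectConj_apply, complexNorm_apply, Complex.conj_ofReal, RCLike.norm_conj]

theorem torusNorm_abs_complexNorm (φ : C_c(G, ℂ)) (g : C_c(H, ℂ)) (ζ : (G × H) ⧸ L) :
    torusNorm L τ.abs (tensor (complexNorm φ) (complexNorm g)) ζ =
      torusNorm L τ (tensor φ g) ζ := by
  rw [← complexNorm_tensor]
  unfold torusNorm normSum
  rw [complexNorm_complexNorm]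
  rfl

variable [IsTopologicalAddGroup H] [T2Space H] [LocallyCompactSpace H] [MeasurableSpace H]
  [BorelSpace H] (mH : Measure H) [mH.IsAddHaarMeasure]

theorem complexNorm_autoConv_complexNorm (g : C_c(H, ℂ)) :
    complexNorm (autoConv mH (complexNorm g)) = autoConv mH (complexNorm g) := by
  ext h
  have h0 : 0 ≤ ∫ k, ‖g (k + h)‖ * ‖g k‖ ∂mH := integral_nonneg fun k => by positivity
  rw [complexNorm_apply, autoConv_complexNorm, Complex.norm_real, Real.norm_of_nonneg h0]

theorem gammaAt_complexNorm (v : ℝ) (φ : C_c(G, ℂ)) (g : C_c(H, ℂ)) (ξ : (G × H) ⧸ L) :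
    gammaAt L mH v (complexNorm g) ξ (complexNorm φ) =
      ((v⁻¹ * normSum L (tensor φ (autoConv mH (complexNorm g))) ξ : ℝ) : ℂ) := by
  rw [gammaAt_eq_orbitSum, ← complexNorm_autoConv_complexNorm, ← complexNorm_tensor,
    orbitSum_complexNorm, complexNorm_autoConv_complexNorm]
  push_cast
  rfl

end AbsoluteValues

section AbsoluteCorrelation

variable {G H : Type*} [AddCommGroup G] [TopologicalSpace G] [IsTopologicalAddGroup G] [T2Space G]
  [LocallyCompactSpace G]
  [AddCommGroup H] [TopologicalSpace H] [IsTopologicalAddGroup H] [T2Space H]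
  [LocallyCompactSpace H] {L : AddSubgroup (G × H)} [DiscreteTopology L]

theorem continuous_normSum_sub (g : C_c(G × H, ℂ)) :
    Continuous fun p : ((G × H) ⧸ L) × ((G × H) ⧸ L) => normSum L g (p.1 - p.2) :=
  (continuous_normSum L g).comp continuous_sub

variable [CompactSpace ((G × H) ⧸ L)] (τ : ComplexRadonMeasure ((G × H) ⧸ L))

theorem integrable_normSum_sub (g : C_c(G × H, ℂ)) :
    Integrable (fun p => normSum L g (p.1 - p.2)) τ.prodVariation := by
  let _ : MeasurableSpace ((G × H) ⧸ L) := borel _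
  have : BorelSpace ((G × H) ⧸ L) := ⟨rfl⟩
  exact integrable_prod_of_hasCompactSupport τ.variation τ.variation (continuous_normSum_sub g)
    (HasCompactSupport.of_compactSpace _)

theorem measurable_normSum_sub (g : C_c(G × H, ℂ)) :
    Measurable[@Prod.instMeasurableSpace _ _ (borel _) (borel _)]
      fun p : ((G × H) ⧸ L) × ((G × H) ⧸ L) => normSum L g (p.1 - p.2) := by
  let _ : MeasurableSpace ((G × H) ⧸ L) := borel _
  have : BorelSpace ((G × H) ⧸ L) := ⟨rfl⟩
  exact HasCompactSupport.measurable_of_prod (continuous_normSum_sub g)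
    (HasCompactSupport.of_compactSpace _)

variable {τ} {φ ψ : C_c(G, ℂ)} {g : C_c(H, ℂ)} {C D : ℝ}

theorem norm_torusCorrelation_le (hC : ∀ ζ, torusNorm L τ (tensor φ g) ζ ≤ C)
    (hD : ∀ ζ, torusNorm L τ (tensor (reflectConj ψ) g) ζ ≤ D) (ζ : (G × H) ⧸ L) :
    ‖torusCorrelation L τ φ ψ g ζ‖ ≤ C * D := by
  have hC0 : 0 ≤ C := (torusNorm_nonneg L τ _ 0).trans (hC 0)
  unfold torusCorrelation
  rw [RCLike.norm_conj]
  refine (norm_torusValue_le_mul L τ (φ := reflectConj ψ) (c := C) (fun s => ?_) g ζ).trans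
    (mul_le_mul_of_nonneg_left (hD ζ) hC0)
  rw [torusInnerCorrelation_apply, norm_mul, RCLike.norm_conj]
  exact mul_le_mul_of_nonneg_right ((norm_torusValue_le L τ _ _ _).trans (hC _)) (norm_nonneg _)

theorem norm_torusCorrelation_abs_le (hC : ∀ ζ, torusNorm L τ (tensor φ g) ζ ≤ C)
    (hD : ∀ ζ, torusNorm L τ (tensor (reflectConj ψ) g) ζ ≤ D) (ζ : (G × H) ⧸ L) :
    ‖torusCorrelation L τ.abs (complexNorm φ) (complexNorm ψ) (complexNorm g) ζ‖ ≤ C * D := by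
  refine norm_torusCorrelation_le (fun ζ => (torusNorm_abs_complexNorm φ g ζ).trans_le (hC ζ))
    (fun ζ => ?_) ζ
  rw [reflectConj_complexNorm]
  exact (torusNorm_abs_complexNorm (reflectConj ψ) g ζ).trans_le (hD ζ)

variable [MeasurableSpace H] [BorelSpace H] (mH : Measure H) [mH.IsAddHaarMeasure]

variable (τ) in
theorem abs_conjIntegral_gammaAt_complexNorm (v : ℝ) (φ : C_c(G, ℂ)) (g : C_c(H, ℂ)) :
    (τ.abs.conjIntegral fun η => τ.abs.integral fun ξ =>
        gammaAt L mH v (complexNorm g) (ξ - η) (complexNorm φ)) =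
      ((v⁻¹ * ∫ p, normSum L (tensor φ (autoConv mH (complexNorm g))) (p.1 - p.2)
        ∂τ.prodVariation : ℝ) : ℂ) := by
  let _ : MeasurableSpace ((G × H) ⧸ L) := borel _
  simp only [gammaAt_complexNorm]
  refine (τ.abs.conjIntegral_integral_eq_integral_prod
    (((integrable_normSum_sub τ.abs _).const_mul v⁻¹).ofReal)).trans ?_
  have hphase : ∀ p : ((G × H) ⧸ L) × ((G × H) ⧸ L),
      τ.abs.phase p.1 * (starRingEnd ℂ) (τ.abs.phase p.2) = 1 := fun p => by
    simp [ComplexRadonMeasure.abs]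
  simp only [hphase, mul_one]
  exact integral_complex_ofReal.trans (congrArg _ (integral_const_mul _ _))

theorem IsTorusHaar.integral_normSum_autoConv_le [SigmaCompactSpace H] [SigmaCompactSpace G]
    [MeasurableSpace G] [BorelSpace G] {mG : Measure G} [mG.IsAddHaarMeasure] [mG.Regular]
    {v : ℝ} {m : @Measure ((G × H) ⧸ L) (borel _)}
    (hm : IsTorusHaar mG mH L v m) (hv : 0 < v) (hψ : ∫ t, ‖ψ t‖ ∂mG = 1)
    (hC : ∀ ζ, torusNorm L τ (tensor φ g) ζ ≤ C)
    (hD : ∀ ζ, torusNorm L τ (tensor (reflectConj ψ) g) ζ ≤ D) :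
    ∫ p, normSum L (tensor φ (autoConv mH (complexNorm g))) (p.1 - p.2) ∂τ.prodVariation ≤
      v * (C * D) := by
  let _ : MeasurableSpace ((G × H) ⧸ L) := borel _
  have := hm.isProbabilityMeasure
  have hψ' : ∫ t, complexNorm ψ t ∂mG = 1 := by
    simp only [complexNorm_apply]
    rw [integral_complex_ofReal, hψ, Complex.ofReal_one]
  have hcorr := norm_integral_le_of_norm_le_const (μ := m)
    (ae_of_all _ (norm_torusCorrelation_abs_le hC hD))
  rw [probReal_univ, mul_one, integral_torusCorrelation L τ.abs mG mH hm _ _ hψ',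
    abs_conjIntegral_gammaAt_complexNorm, Complex.norm_real] at hcorr
  rw [← inv_mul_le_iff₀ hv]
  exact (Real.le_norm_self _).trans hcorr

end AbsoluteCorrelation

section Majorant

variable {G H : Type*} [AddCommGroup G] [TopologicalSpace G] [IsTopologicalAddGroup G] [T2Space G]
  [AddCommGroup H] [TopologicalSpace H] [IsTopologicalAddGroup H] [T2Space H]
  [LocallyCompactSpace H] [MeasurableSpace H] [BorelSpace H] {mH : Measure H}
  [mH.IsAddHaarMeasure] {L : AddSubgroup (G × H)} [DiscreteTopology L]
  {χ : ℕ → C_c(H, ℝ)} {f : C(H, ℂ)}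

/-- The supremum over `n` of the majorants of `γ` for the weights `fn n`. Unlike `gammaMajorant`
it is a function on the torus whose measurability is clear. -/
def torusMajorant (L : AddSubgroup (G × H)) (mH : Measure H) [mH.IsAddHaarMeasure]
    (φ : C_c(G, ℂ)) (fn : ℕ → C_c(H, ℂ)) (ξ : (G × H) ⧸ L) : ℝ≥0∞ :=
  ⨆ n, ENNReal.ofReal (normSum L (tensor φ (autoConv mH (complexNorm (fn n)))) ξ)

theorem IsCutoffSeq.monotone_normSum_autoConv (hχ : IsCutoffSeq χ) (φ : C_c(G, ℂ))
    (ξ : (G × H) ⧸ L) :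
    Monotone fun n => ENNReal.ofReal
      (normSum L (tensor φ (autoConv mH (complexNorm (cutoff (χ n) f)))) ξ) := by
  intro n n' hn
  obtain ⟨x, rfl⟩ := QuotientAddGroup.mk_surjective ξ
  have hmono := gammaMajorant_mono (L := L) (mH := mH) φ
    (fun k => hχ.norm_cutoff_mono f k hn) x
  rwa [gammaMajorant_eq_normSum, gammaMajorant_eq_normSum] at hmono

theorem IsCutoffSeq.gammaMajorant_le_torusMajorant (hχ : IsCutoffSeq χ) (φ : C_c(G, ℂ))
    (x : G × H) :
    gammaMajorant L mH φ f x ≤ torusMajorant L mH φ (fun n => cutoff (χ n) f) (toTorus L x) := by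
  refine hχ.gammaMajorant_le fun n => ?_
  rw [gammaMajorant_eq_normSum]
  exact le_iSup (fun n => ENNReal.ofReal
    (normSum L (tensor φ (autoConv mH (complexNorm (cutoff (χ n) f)))) (toTorus L x))) n

variable [LocallyCompactSpace G] [CompactSpace ((G × H) ⧸ L)]

theorem measurable_torusMajorant_sub (φ : C_c(G, ℂ)) (fn : ℕ → C_c(H, ℂ)) :
    Measurable[@Prod.instMeasurableSpace _ _ (borel _) (borel _)]
      fun p : ((G × H) ⧸ L) × ((G × H) ⧸ L) => torusMajorant L mH φ fn (p.1 - p.2) := by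
  let _ : MeasurableSpace ((G × H) ⧸ L) := borel _
  exact Measurable.iSup fun n => ENNReal.measurable_ofReal.comp (measurable_normSum_sub _)

variable [MeasurableSpace G] [BorelSpace G] {mG : Measure G} [mG.IsAddHaarMeasure] [mG.Regular]
  [SigmaCompactSpace G] [SigmaCompactSpace H]
  {τ : ComplexRadonMeasure ((G × H) ⧸ L)} {v : ℝ} {m : @Measure ((G × H) ⧸ L) (borel _)}

theorem IsUniformCauchy.lintegral_torusMajorant_ne_top
    (hfn : IsUniformCauchy L τ fun n => cutoff (χ n) f) (hχ : IsCutoffSeq χ)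
    (hm : IsTorusHaar mG mH L v m) (hv : 0 < v) (φ : C_c(G, ℂ)) :
    ∫⁻ p, torusMajorant L mH φ (fun n => cutoff (χ n) f) (p.1 - p.2) ∂τ.prodVariation ≠ ∞ := by
  let _ : MeasurableSpace ((G × H) ⧸ L) := borel _
  obtain ⟨ψ, hψ⟩ := exists_integral_norm_eq_one mG
  obtain ⟨C, -, hC⟩ := hfn.exists_torusNorm_le φ
  obtain ⟨D, -, hD⟩ := hfn.exists_torusNorm_le (reflectConj ψ)
  unfold torusMajorant
  rw [lintegral_iSup (fun n => (measurable_normSum_sub _).ennreal_ofReal)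
    fun n n' hn p => hχ.monotone_normSum_autoConv φ (p.1 - p.2) hn]
  refine ne_top_of_le_ne_top (ENNReal.ofReal_ne_top (r := v * (C * D))) (iSup_le fun n => ?_)
  rw [← ofReal_integral_eq_lintegral_ofReal (integrable_normSum_sub τ _)
    (ae_of_all _ fun p => normSum_nonneg L _ _)]
  exact ENNReal.ofReal_le_ofReal (hm.integral_normSum_autoConv_le mH hv hψ (hC n) (hD n))

theorem IsUniformCauchy.ae_gammaMajorant_ne_top
    (hfn : IsUniformCauchy L τ fun n => cutoff (χ n) f) (hχ : IsCutoffSeq χ)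
    (hm : IsTorusHaar mG mH L v m) (hv : 0 < v) (φ : C_c(G, ℂ)) :
    ∀ᵐ p ∂τ.prodVariation, ∀ x, toTorus L x = p.1 - p.2 → gammaMajorant L mH φ f x ≠ ∞ := by
  filter_upwards [ae_lt_top (measurable_torusMajorant_sub φ _)
    (hfn.lintegral_torusMajorant_ne_top hχ hm hv φ)] with p hp x hx
  rw [← hx] at hp
  exact ne_top_of_le_ne_top hp.ne (hχ.gammaMajorant_le_torusMajorant φ x)

theorem IsUniformCauchy.ae_gammaExistsAt
    (hfn : IsUniformCauchy L τ fun n => cutoff (χ n) f) (hχ : IsCutoffSeq χ)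
    (hm : IsTorusHaar mG mH L v m) (hv : 0 < v) (φ : C_c(G, ℂ)) :
    ∀ᵐ p ∂τ.prodVariation, GammaExistsAt L mH f (p.1 - p.2) φ := by
  obtain ⟨χG, hχG⟩ := exists_isCutoffSeq G
  filter_upwards [hfn.ae_gammaMajorant_ne_top hχ hm hv φ,
    ae_all_iff.2 fun j => hfn.ae_gammaMajorant_ne_top hχ hm hv (complexify (χG j))] with p h1 h2
  exact hχG.gammaExistsAt h1 h2

theorem IsUniformCauchy.tendsto_conjIntegral_gammaAt
    (hfn : IsUniformCauchy L τ fun n => cutoff (χ n) f) (hχ : IsCutoffSeq χ)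
    (hm : IsTorusHaar mG mH L v m) (hv : 0 < v) (φ : C_c(G, ℂ)) :
    Integrable (fun p => gammaAt L mH v f (p.1 - p.2) φ) τ.prodVariation ∧
      Tendsto (fun n => τ.conjIntegral fun η => τ.integral fun ξ =>
          gammaAt L mH v (cutoff (χ n) f) (ξ - η) φ) atTop
        (𝓝 (τ.conjIntegral fun η => τ.integral fun ξ => gammaAt L mH v f (ξ - η) φ)) := by
  have hfin := hfn.lintegral_torusMajorant_ne_top hχ hm hv φ
  have hmeas := measurable_torusMajorant_sub (L := L) (mH := mH) φ fun n => cutoff (χ n) f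
  refine τ.tendsto_conjIntegral_of_dominated
    (F := fun n p => gammaAt L mH v (cutoff (χ n) f) (p.1 - p.2) φ)
    (F₀ := fun p => gammaAt L mH v f (p.1 - p.2) φ)
    (b := fun p => v⁻¹ * (torusMajorant L mH φ (fun n => cutoff (χ n) f) (p.1 - p.2)).toReal)
    (fun n => ?_) ((integrable_toReal_of_lintegral_ne_top hmeas.aemeasurable hfin).const_mul _)
    (fun n => ?_) ?_
  · simp only [gammaAt_eq_orbitSum]
    exact continuous_const.mul ((continuous_orbitSum L _).comp continuous_sub)
  · filter_upwards [ae_lt_top hmeas hfin] with p hp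
    obtain ⟨x, hx⟩ := QuotientAddGroup.mk_surjective (p.1 - p.2)
    rw [← hx] at hp ⊢
    have hle := hχ.gammaMajorant_le_torusMajorant (L := L) (mH := mH) (f := f) φ x
    refine (norm_gammaAt_le hv (ne_top_of_le_ne_top hp.ne hle) (hχ.norm_cutoff_le f n)).trans ?_
    exact mul_le_mul_of_nonneg_left (ENNReal.toReal_mono hp.ne hle) (inv_nonneg.2 hv.le)
  · filter_upwards [hfn.ae_gammaMajorant_ne_top hχ hm hv φ] with p hp
    obtain ⟨x, hx⟩ := QuotientAddGroup.mk_surjective (p.1 - p.2)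
    rw [← hx]
    exact hχ.tendsto_gammaAt (hp x hx)

end Majorant

section Autocorrelation

theorem tendsto_integral_of_tendstoUniformly {T ι E : Type*} [TopologicalSpace T]
    [CompactSpace T] [MeasurableSpace T] [BorelSpace T] [NormedAddCommGroup E] [NormedSpace ℝ E]
    [SecondCountableTopologyEither T E] {l : Filter ι} [l.NeBot] [l.IsCountablyGenerated]
    (μ : Measure T) [IsFiniteMeasure μ] {F : ι → T → E} {F₀ : T → E}
    (hF : ∀ i, Continuous (F i)) (h : TendstoUniformly F F₀ l) :
    Tendsto (fun i => ∫ x, F i x ∂μ) l (𝓝 (∫ x, F₀ x ∂μ)) := by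
  have hF₀ : Continuous F₀ := h.continuous (Frequently.of_forall hF)
  obtain ⟨C, hC⟩ := isCompact_univ.exists_bound_of_continuousOn hF₀.continuousOn
  have hbound : ∀ᶠ i in l, ∀ᵐ x ∂μ, ‖F i x‖ ≤ C + 1 := by
    filter_upwards [Metric.tendstoUniformly_iff.1 h 1 one_pos] with i hi
    refine ae_of_all _ fun x => (norm_le_norm_add_norm_sub (F₀ x) (F i x)).trans ?_
    exact add_le_add (hC x (Set.mem_univ x)) (dist_eq_norm (F₀ x) (F i x) ▸ hi x).le
  exact tendsto_integral_filter_of_norm_le_const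
    (Eventually.of_forall fun i => (hF i).aestronglyMeasurable) ⟨C + 1, hbound⟩
    (ae_of_all _ h.tendsto_at)

variable {G H : Type*} [AddCommGroup G] [TopologicalSpace G] [AddCommGroup H] [TopologicalSpace H]
  {L : AddSubgroup (G × H)}

theorem denseRange_toTorus_fst (hL : Dense (Prod.snd '' (L : Set (G × H)))) :
    DenseRange fun t : G => toTorus L (t, 0) := by
  have hD : Dense ((Set.univ : Set G) ×ˢ (Prod.snd '' (L : Set (G × H)))) := dense_univ.prod hL
  refine (QuotientAddGroup.mk_surjective.denseRange.dense_image (continuous_toTorus L) hD).mono ?_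
  rintro _ ⟨⟨s, _⟩, ⟨-, l, hl, rfl⟩, rfl⟩
  refine ⟨s - l.1, QuotientAddGroup.eq.2 ?_⟩
  have hdiff : -(s - l.1, (0 : H)) + (s, l.2) = l := by ext <;> simp
  rwa [hdiff]

variable [IsTopologicalAddGroup G] [IsTopologicalAddGroup H] [T2Space G] [LocallyCompactSpace G]
  [T2Space H] [MeasurableSpace H] [BorelSpace H] {τ : ComplexRadonMeasure ((G × H) ⧸ L)}
  {χ : ℕ → C_c(H, ℝ)}

theorem IsDisintegration.exists_isTorusLimit {ρ : ComplexRadonMeasure (G × H)} {f : H → ℂ}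
    (hτ : IsDisintegration L ρ τ) (hfc : Continuous f) (hf : IsAdmissible ρ f)
    (hχ : IsCutoffSeq χ) :
    ∃ β, IsTorusLimit L τ (fun n => cutoff (χ n) ⟨f, hfc⟩) β ∧ β 0 = weightedMeasure ρ f hf := by
  obtain ⟨out, hout⟩ : ∃ out : (G × H) ⧸ L → G × H, ∀ ζ, toTorus L (out ζ) = ζ :=
    QuotientAddGroup.mk_surjective.hasRightInverse
  have hlim : IsTorusLimit L τ (fun n => cutoff (χ n) ⟨f, hfc⟩)
      fun ζ => shiftedMeasure hf (out ζ) := fun ζ φ => by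
    simpa only [hout] using hτ.tendsto_shiftedMeasure hfc hf hχ (out ζ) φ
  refine ⟨_, hlim, ?_⟩
  rw [← shiftedMeasure_zero hf]
  exact RadonFunctional.ext fun φ =>
    tendsto_nhds_unique (hlim 0 φ) (hτ.tendsto_shiftedMeasure hfc hf hχ 0 φ)

theorem IsUniformCauchy.isAutocorrelation [LocallyCompactSpace H] [SigmaCompactSpace G]
    [SigmaCompactSpace H] [MeasurableSpace G] [BorelSpace G] [DiscreteTopology L]
    [CompactSpace ((G × H) ⧸ L)] {mG : Measure G} [mG.IsAddHaarMeasure] [mG.Regular]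
    {mH : Measure H} [mH.IsAddHaarMeasure] {v : ℝ} {m : @Measure ((G × H) ⧸ L) (borel _)}
    {f : C(H, ℂ)} {β : (G × H) ⧸ L → RadonFunctional G}
    (hfn : IsUniformCauchy L τ fun n => cutoff (χ n) f)
    (hβ : IsTorusLimit L τ (fun n => cutoff (χ n) f) β) (hχ : IsCutoffSeq χ)
    (hL : Dense (Prod.snd '' (L : Set (G × H)))) (hm : IsTorusHaar mG mH L v m) (hv : 0 < v) :
    IsAutocorrelation mG (β 0) fun φ =>
      τ.conjIntegral fun η => τ.integral fun ξ => gammaAt L mH v f (ξ - η) φ := by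
  let _ : MeasurableSpace ((G × H) ⧸ L) := borel _
  have : BorelSpace ((G × H) ⧸ L) := ⟨rfl⟩
  have hcl : IsClosed (L : Set (G × H)) := AddSubgroup.isClosed_of_discrete
  have := hm.isProbabilityMeasure
  have := hm.regular
  have := isAddRightInvariant_of_integral_add_right hm.integral_add_right
  obtain ⟨mΩ, hinv, huniq, hint⟩ := exists_unique_isInvariantProbability m
    (hfn.continuous hβ) (denseRange_toTorus_fst hL) hβ.apply_add_toTorus
  refine ⟨mΩ, hinv, huniq, fun ψ hψ φ => ?_⟩
  have hunif := hfn.tendstoUniformly_torusCorrelation hβ φ ψ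
  have hcont n := continuous_torusCorrelation L τ φ ψ (cutoff (χ n) f)
  have hcorr : ∫ ω, correlation ω.1 φ ψ ∂mΩ = ∫ ζ, correlation (β ζ) φ ψ ∂m :=
    hint (fun ω => correlation ω φ ψ) (hunif.continuous (Frequently.of_forall hcont))
  have hlim := tendsto_integral_of_tendstoUniformly m hcont hunif
  simp only [integral_torusCorrelation L τ mG mH hm φ ψ hψ] at hlim
  rw [hcorr]
  exact tendsto_nhds_unique (hfn.tendsto_conjIntegral_gammaAt hχ hm hv φ).2 hlim

end Autocorrelation

section DiracComb

variable {T : Type*} [TopologicalSpace T] [T1Space T]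

theorem regular_dirac [MeasurableSpace T] [BorelSpace T] (a : T) :
    (Measure.dirac a).Regular where
  outerRegular A _ r hr := by
    by_cases ha : a ∈ A
    · rw [Measure.dirac_apply_of_mem ha] at hr
      exact ⟨Set.univ, Set.subset_univ _, isOpen_univ, by simpa using hr⟩
    · refine ⟨{a}ᶜ, fun x hx h => ha (h ▸ hx), isOpen_compl_singleton, ?_⟩
      rw [Measure.dirac_apply' _ (measurableSet_singleton a).compl]
      exact lt_of_le_of_lt (by simp) hr
  innerRegular U hU r hr := by
    by_cases ha : a ∈ U
    · refine ⟨{a}, Set.singleton_subset_iff.2 ha, isCompact_singleton, ?_⟩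
      rw [Measure.dirac_apply_of_mem (Set.mem_singleton a)]
      rwa [Measure.dirac_apply_of_mem ha] at hr
    · rw [Measure.dirac_apply' _ hU.measurableSet] at hr
      simp [ha] at hr

/-- The unit point mass at `a`, as a complex Radon measure. -/
def ComplexRadonMeasure.dirac (a : T) : ComplexRadonMeasure T where
  variation := @Measure.dirac T (borel T) a
  regular :=
    let _ : MeasurableSpace T := borel T
    have : BorelSpace T := ⟨rfl⟩
    regular_dirac a
  phase _ := 1
  measurable_phase := @measurable_const _ _ _ (borel T) _
  norm_phase _ := norm_one

theorem ComplexRadonMeasure.integral_dirac (a : T) (F : T → ℂ) :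
    (ComplexRadonMeasure.dirac a).integral F = F a := by
  let _ : MeasurableSpace T := borel T
  have : BorelSpace T := ⟨rfl⟩
  exact (MeasureTheory.integral_dirac (fun x => F x * (1 : ℂ)) a).trans (mul_one _)

theorem ComplexRadonMeasure.conjIntegral_dirac (a : T) (F : T → ℂ) :
    (ComplexRadonMeasure.dirac a).conjIntegral F = F a := by
  rw [ComplexRadonMeasure.conjIntegral, ComplexRadonMeasure.integral_dirac, Complex.conj_conj]

theorem ComplexRadonMeasure.of_ae_prodVariation_dirac {a : T} {P : T × T → Prop}
    (h : ∀ᵐ p ∂(ComplexRadonMeasure.dirac a).prodVariation, P p) : P (a, a) := by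
  let _ : MeasurableSpace T := borel T
  have : BorelSpace T := ⟨rfl⟩
  have h' : ∀ᵐ p ∂((Measure.dirac a).prod (Measure.dirac a)), P p := h
  rwa [Measure.dirac_prod_dirac, ae_dirac_eq] at h'

variable {G H : Type*} [AddCommGroup G] [TopologicalSpace G] [AddCommGroup H]
  {L : AddSubgroup (G × H)}

theorem IsDiracComb.isDisintegration [TopologicalSpace H] [T1Space ((G × H) ⧸ L)]
    {ρ : ComplexRadonMeasure (G × H)} (hρ : IsDiracComb L ρ) :
    IsDisintegration L ρ (ComplexRadonMeasure.dirac 0) := fun g => by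
  rw [hρ g, ComplexRadonMeasure.integral_dirac, ← QuotientAddGroup.mk_zero, orbitSum_mk]
  simp only [zero_add]

variable [MeasurableSpace H] {mH : Measure H}

theorem gammaAt_zero {v : ℝ} (f : H → ℂ) (φ : C_c(G, ℂ)) : gammaAt L mH v f 0 φ =
    (v : ℂ)⁻¹ * ∑' l : L, selfConv mH f (-l.1.2) * φ (-l.1.1) := by
  rw [← QuotientAddGroup.mk_zero, gammaAt_mk]
  simp only [Prod.fst_zero, Prod.snd_zero, zero_sub]

theorem GammaExistsAt.memLp_two [TopologicalSpace H] [IsTopologicalAddGroup H] [BorelSpace H]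
    [mH.IsAddRightInvariant] {f : H → ℂ} {φ : C_c(G, ℂ)} (hγ : GammaExistsAt L mH f 0 φ)
    (hfc : Continuous f) : MemLp f 2 mH := by
  refine memLp_two_of_selfConvExistsAt_zero hfc ?_
  simpa using (hγ 0 rfl).1 0

end DiracComb

end CutProject

end

theorem mainTheorem3_general {G H : Type*}
    [AddCommGroup G] [TopologicalSpace G] [IsTopologicalAddGroup G] [T2Space G]
    [LocallyCompactSpace G] [SigmaCompactSpace G] [MeasurableSpace G] [BorelSpace G]
    [AddCommGroup H] [TopologicalSpace H] [IsTopologicalAddGroup H] [T2Space H]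
    [LocallyCompactSpace H] [SigmaCompactSpace H] [MeasurableSpace H] [BorelSpace H]
    (mG : Measure G) [mG.IsAddHaarMeasure] [mG.Regular]
    (mH : Measure H) [mH.IsAddHaarMeasure]
    (L : AddSubgroup (G × H)) [DiscreteTopology L] [CompactSpace ((G × H) ⧸ L)]
    (hL : Dense (Prod.snd '' (L : Set (G × H))))
    (ρ : ComplexRadonMeasure (G × H)) (hρL : IsInvariantUnder L ρ) (hρ : ρ.variation ≠ 0)
    (Z : Set (G × H)) (hZ : IsFundamentalCell L Z)
    (f : H → ℂ) (hfc : Continuous f) (hf : IsAdmissible ρ f) :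
    Integrable f mH ∧ (∀ᵐ h ∂mH, SelfConvExistsAt mH f h) ∧
    (∃ ρT : ComplexRadonMeasure ((G × H) ⧸ L), IsDisintegration L ρ ρT) ∧
    (∀ ρT : ComplexRadonMeasure ((G × H) ⧸ L), IsDisintegration L ρ ρT →
      (∀ φ : C_c(G, ℂ),
        (∀ᵐ p ∂ρT.prodVariation, GammaExistsAt L mH f (p.1 - p.2) φ) ∧
        Integrable (fun p => gammaAt L mH ((mG.prod mH).real Z) f (p.1 - p.2) φ)
          ρT.prodVariation) ∧
      IsAutocorrelation mG (weightedMeasure ρ f hf) fun φ =>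
        ρT.conjIntegral fun η => ρT.integral fun ξ =>
          gammaAt L mH ((mG.prod mH).real Z) f (ξ - η) φ) ∧
    (IsDiracComb L ρ →
      MemLp f 2 mH ∧ (∀ h, SelfConvExistsAt mH f h) ∧
      (∀ φ : C_c(G, ℂ), GammaExistsAt L mH f 0 φ ∧
        gammaAt L mH ((mG.prod mH).real Z) f 0 φ =
          ((mG.prod mH).real Z : ℂ)⁻¹ * ∑' l : L, selfConv mH f (-l.1.2) * φ (-l.1.1)) ∧
      IsAutocorrelation mG (weightedMeasure ρ f hf)
        (gammaAt L mH ((mG.prod mH).real Z) f 0)) := by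
  have hcl : IsClosed (L : Set (G × H)) := AddSubgroup.isClosed_of_discrete
  have hv := hZ.measureReal_pos mG mH
  obtain ⟨m, hm⟩ := hZ.exists_isTorusHaar mG mH
  obtain ⟨χ, hχ⟩ := exists_isCutoffSeq H
  obtain ⟨ρ₀, hρ₀⟩ := exists_isDisintegration L hρL
  have hcauchy {ρT} (hρT : IsDisintegration L ρ ρT) := hρT.isUniformCauchy_cutoff hfc hf hχ
  have hint : Integrable f mH :=
    IsUniformCauchy.integrable hm hv (hρ₀.variation_ne_zero hρ) hχ (hcauchy hρ₀)
  have hexists {ρT} (hρT : IsDisintegration L ρ ρT) (φ : C_c(G, ℂ)) :=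
    (hcauchy hρT).ae_gammaExistsAt hχ hm hv φ
  have hauto {ρT} (hρT : IsDisintegration L ρ ρT) : IsAutocorrelation mG (weightedMeasure ρ f hf)
      fun φ => ρT.conjIntegral fun η => ρT.integral fun ξ =>
        gammaAt L mH ((mG.prod mH).real Z) f (ξ - η) φ := by
    obtain ⟨β, hβ, hβ₀⟩ := hρT.exists_isTorusLimit hfc hf hχ
    exact hβ₀ ▸ (hcauchy hρT).isAutocorrelation hβ hχ hL hm hv
  refine ⟨hint, hχ.ae_selfConvExistsAt (f := ⟨f, hfc⟩) hint, ⟨ρ₀, hρ₀⟩, fun ρT hρT =>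
    ⟨fun φ => ⟨hexists hρT φ, ((hcauchy hρT).tendsto_conjIntegral_gammaAt hχ hm hv φ).1⟩,
      hauto hρT⟩, fun hδ => ?_⟩
  have hγ₀ (φ : C_c(G, ℂ)) : GammaExistsAt L mH f 0 φ := by
    simpa using ComplexRadonMeasure.of_ae_prodVariation_dirac (hexists hδ.isDisintegration φ)
  have hL2 : MemLp f 2 mH := (hγ₀ 0).memLp_two hfc
  refine ⟨hL2, selfConvExistsAt_of_memLp_two hL2, fun φ => ⟨hγ₀ φ, gammaAt_zero f φ⟩, ?_⟩
  simpa only [ComplexRadonMeasure.conjIntegral_dirac, ComplexRadonMeasure.integral_dirac,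
    sub_zero] using hauto hδ.isDisintegration

theorem mainTheorem3 {G H : Type*}
    [AddCommGroup G] [TopologicalSpace G] [IsTopologicalAddGroup G] [T2Space G]
    [LocallyCompactSpace G] [SigmaCompactSpace G] [MeasurableSpace G] [BorelSpace G]
    [AddCommGroup H] [TopologicalSpace H] [IsTopologicalAddGroup H] [T2Space H]
    [LocallyCompactSpace H] [SigmaCompactSpace H] [MeasurableSpace H] [BorelSpace H]
    (mG : Measure G) [mG.IsAddHaarMeasure] [mG.Regular]
    (mH : Measure H) [mH.IsAddHaarMeasure] [mH.Regular]
    (L : AddSubgroup (G × H)) (hL : IsCutProjectScheme L)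
    (ρ : ComplexRadonMeasure (G × H)) (hρL : IsInvariantUnder L ρ) (hρ : ρ.variation ≠ 0)
    (Z : Set (G × H)) (hZ : IsFundamentalCell L Z)
    (f : H → ℂ) (hfc : Continuous f) (hf : IsAdmissible ρ f) :
    -- `f` is integrable and `f ∗ f̃` exists almost everywhere
    Integrable f mH ∧ (∀ᵐ h ∂mH, SelfConvExistsAt mH f h) ∧
    -- the measure `ρT` on `(G × H) / L` exists, and the autocorrelation is given by it
    (∃ ρT : ComplexRadonMeasure ((G × H) ⧸ L), IsDisintegration L ρ ρT) ∧
    (∀ ρT : ComplexRadonMeasure ((G × H) ⧸ L), IsDisintegration L ρ ρT →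
      (∀ φ : C_c(G, ℂ),
        (∀ᵐ p ∂ρT.prodVariation, GammaExistsAt L mH f (p.1 - p.2) φ) ∧
        Integrable (fun p => gammaAt L mH ((mG.prod mH).real Z) f (p.1 - p.2) φ)
          ρT.prodVariation) ∧
      IsAutocorrelation mG (weightedMeasure ρ f hf) fun φ =>
        ρT.conjIntegral fun η => ρT.integral fun ξ =>
          gammaAt L mH ((mG.prod mH).real Z) f (ξ - η) φ) ∧
    -- the case of the Dirac comb of `L`
    (IsDiracComb L ρ →
      MemLp f 2 mH ∧ (∀ h, SelfConvExistsAt mH f h) ∧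
      (∀ φ : C_c(G, ℂ), GammaExistsAt L mH f 0 φ ∧
        gammaAt L mH ((mG.prod mH).real Z) f 0 φ =
          ((mG.prod mH).real Z : ℂ)⁻¹ * ∑' l : L, selfConv mH f (-l.1.2) * φ (-l.1.1)) ∧
      IsAutocorrelation mG (weightedMeasure ρ f hf)
        (gammaAt L mH ((mG.prod mH).real Z) f 0)) := by
  have := hL.discrete
  have := hL.cocompact
  exact mainTheorem3_general mG mH L hL.dense_snd ρ hρL hρ Z hZ f hfc hf
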